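/- **Setting.** Let $E$ be a finite-dimensional real normed space, $\mathcal W\subset E$ nonempty, convex and compact, and let $\psi_w$ be a distance-generating function on $\mathcal W$: continuous and convex, and on the set $\mathcal W^o$ of points where it has a subgradient (assumed convex) continuously differentiable and $1$-strongly convex w.r.t. $\|\cdot\|$. Let $D>0$ with $\max_{\mathcal W}\psi_w-\min_{\mathcal W}\psi_w\le D^2$. There are $m\ge 2$ groups, group $i$ having $n_i\ge 1$ component losses $\ell_{ij}$; put $\bar n=\frac1m\sum_i n_i$, $R_i=\frac1{n_i}\sum_j\ell_{ij}$, $R_i^*=\min_{\mathcal W}R_i$. Every $\ell_{ij}$ is $L$-smooth and $G$-Lipschitz on $\mathcal W$ ($L>0$, $G\ge0$), and every $R_i$ is convex on $\mathcal W$. For $\bar z=(\bar w,\bar q)\in\mathcal Z=\mathcal W\times\Delta_m$ the MERO duality gap is $$\underline\epsilon(\bar z)=\max_{q\in\Delta_m}\sum_i q_i\,(R_i(\bar w)-R_i^*)-\min_{w\in\mathcal W}\sum_i\bar q_i\,(R_i(w)-R_i^*).$$ **Algorithm ALEG** (for risks $R_1,\dots,R_m$; $S$ epochs of $K$ iterations,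 learning rates $\eta_k^s$, weights $\alpha_k^s$). Let $\psi(z)=\frac{\psi_w(w)}{2D^2}+\frac{\sum_i q_i\ln q_i}{2\ln m}$ (without the second term if $m=1$), with Bregman divergence $B$, $F(w,q)=\sum_i q_iR_i(w)$, $\nabla F=(\nabla_wF;-\nabla_qF)$. Start at $z_0^0=\arg\min_{\mathcal Z}\psi$. In epoch $s=0,\dots,S-1$ let $z^s$ and $\nabla\psi(\bar z^s)$ be the averages of $z^{s-1}_k$ and of $\nabla\psi(z^{s-1}_k)$, $k=1,\dots,K$, with normalized weights $\alpha^{s-1}_{k-1}$ (for $s=0$: $z_0^0$ and $\nabla\psi(z_0^0)$), and compute $\nabla F(z^s)$. For $k=0,\dots,K-1$: set $z^s_{k+1/2}=\arg\min_{z\in\mathcal Z}\{\eta_k^s\langle\nabla F(z^s),z\rangle+\alpha_k^sB(z,\bar z^s)+(1-\alpha_k^s)B(z,z_k^s)\}$; draw one index uniformly from each group, independently; form the stochastic gradients $\nabla F(\cdot;\xi_k^s)$ in which $R_i$ is replaced by the drawn loss of group $i$; set $g_k^s=\nabla F(z^s_{k+1/2};\xi_k^s)-\nabla F(z^s;\xi_k^s)+\nabla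 F(z^s)$; let $z^s_{k+1}$ be the same argmin with $g_k^s$ in place of $\nabla F(z^s)$. Put $z_0^{s+1}=z_K^s$. Return the average of all $z_{k+1/2}^s$ with weights proportional to $\eta_k^s$. **Algorithm ALEM.** Stage 1: for each $i$ run ALEG on the one-group problem $R_i$ to get $\bar w_i$, and put $\hat R_i^*=R_i(\bar w_i)$. Stage 2: run ALEG on the risks $R_i-\hat R_i^*$, $i\in[m]$, and return its output $\bar z$. **Parameters.** With a budget $T>0$: $S=\lceil T/\sqrt{\bar n}\rceil$, $K=\lceil\bar n\rceil$, $\alpha_k^s=1/K$, and any learning rates with $\frac1{10\Lambda\sqrt K}\le\eta_k^s\le\frac1{\Lambda\sqrt{5K}}$, where $\Lambda=\Lambda_1$ in stage 1, $\Lambda=\Lambda_m$ in stage 2, and $\Lambda_k=2D\max\{\sqrt{2D^2L^2+G^2\ln k},\,G\sqrt{2\ln k}\}$ for $k\in\{1,m\}$. **Cost.** Unit-cost operations: one evaluation of some $\ell_{ij}$ or $\nabla\ell_{ij}$, one draw of an index, one operation on reals, one vector operation in $E$ or its dual, one evaluation of $\nabla\psi_w$, one prox-mapping onto $\mathcal W$;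 vectors in $\mathbb R^m$ are handled coordinatewise. **Statement.** For all $L,D,c>0$, $G\ge 0$ there is a constant $C$, depending only on $L,G,D,c$, such that for all $m\ge2$, all group sizes $n_i\ge1$, all $\varepsilon>0$ and $\delta\in(0,1)$ there is a budget $T>0$ for which, on every problem as above with these constants and sizes, ALEM returns with probability at least $1-\delta$ a point $\bar z\in\mathcal Z$ with $\underline\epsilon(\bar z)\le\varepsilon$, while the total computation of both stages is, in every run, at most $$C\Big(m\bar n+\frac{m\sqrt{\bar n\ln m}}{\varepsilon}\big(1+\ln(1+\tfrac1\varepsilon)+\ln\tfrac1\delta+\ln m\big)\Big),$$ and, if moreover $m\le c\,\bar n$ and $\varepsilon\le c\sqrt{\ln m/\bar n}$, at most $$C\,\frac{m\sqrt{\bar n\ln m}}{\varepsilon}\Big(1+\ln(1+\tfrac1\varepsilon)+\ln\tfrac1\delta\Big)=\tilde{\mathcal O}\Big(\frac{m\sqrt{\bar n\ln m}}{\varepsilon}\Big).$$ Thus, up to logarithmic factors, this is the complexity $\mathcal O(m\sqrt{\bar n\ln m}/\varepsilon)$ of ALEG for empirical GDRO. -/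

import Mathlib

noncomputable section

namespace Mero

/-! ## Values with an operation count, loops and minimisers -/

/-- A computed value together with the number of elementary operations spent on it. The unit-cost
operations are: evaluating one component loss or one component gradient, drawing one sample index,
one operation on real numbers, one vector operation (sum, scalar multiple) in `E` or its dual, one
evaluation of the gradient of the distance-generating function of the domain, and one
prox-mapping (mirror projection) onto the domain. Vectors in `ℝᵐ` are handled coordinatewise. -/
structure Timed (α : Type*) where
  val : α
  ops : ℕ

/-- Sum of finitely many computed values; each summand costs its own computation and an addition. -/
def Timed.sum {α : Type*} [AddCommMonoid α] {k : ℕ} (f : Fin k → Timed α) : Timed α :=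
  ⟨∑ j, (f j).val, ∑ j, ((f j).ops + 1)⟩

/-- Vector of finitely many computed values. -/
def Timed.vec {k : ℕ} (f : Fin k → Timed ℝ) : Timed (Fin k → ℝ) :=
  ⟨fun j => (f j).val, ∑ j, (f j).ops⟩

/-- Apply one further elementary operation to a computed value. -/
def Timed.step {α β : Type*} (f : α → β) (x : Timed α) : Timed β :=
  ⟨f x.val, x.ops + 1⟩

/-- `for i in l do x ← body i x`, for a randomised loop body. -/
def forEach {ι σ : Type*} (body : ι → σ → PMF σ) : List ι → σ → PMF σ
  | [], x => PMF.pure x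
  | i :: l, x => (body i x).bind (forEach body l)

/-- A minimiser of `f` over `s` (wherever it is used below it exists and is unique). -/
def argminOn {α : Type*} [Nonempty α] (s : Set α) (f : α → ℝ) : α :=
  Classical.epsilon fun x => x ∈ s ∧ IsMinOn f s x

/-! ## The empirical problem -/

/-- Component losses `ℓ(·; ξ_{ij})`, `i ∈ [m]`, `j ∈ [n_i]`, with their gradients. -/
structure Problem (E : Type*) [NormedAddCommGroup E] [NormedSpace ℝ E] (m : ℕ)
    (n : Fin m → ℕ) where
  loss : (i : Fin m) → Fin (n i) → E → ℝ
  grad : (i : Fin m) → Fin (n i) → E → (E →L[ℝ] ℝ)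

/-- The domain `W` with its distance-generating function and the gradient of the latter. -/
structure Geometry (E : Type*) [NormedAddCommGroup E] [NormedSpace ℝ E] where
  dom : Set E
  psi : E → ℝ
  dpsi : E → (E →L[ℝ] ℝ)

/-- Average group size. -/
def avgSize {m : ℕ} (n : Fin m → ℕ) : ℝ := (∑ i, (n i : ℝ)) / m

section

variable {E : Type*} [NormedAddCommGroup E] [NormedSpace ℝ E]

/-- The set `X° ⊆ X` of the points of `X` at which `ψ : X → ℝ` has a subgradient. -/
def subgradientDomain (X : Set E) (ψ : E → ℝ) : Set E :=
  {x | x ∈ X ∧ ∃ g : E →L[ℝ] ℝ, ∀ y ∈ X, ψ x + g (y - x) ≤ ψ y}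

/-- `ψ` is a distance-generating function on `X` of modulus `1` w.r.t. the norm of `E`, and `ψ'` is
its (continuous) gradient on `X°`. -/
structure IsDistanceGenerating (X : Set E) (ψ : E → ℝ) (ψ' : E → (E →L[ℝ] ℝ)) : Prop where
  continuousOn : ContinuousOn ψ X
  convexOn : ConvexOn ℝ X ψ
  convex_domain : Convex ℝ (subgradientDomain X ψ)
  hasGrad : ∀ x ∈ subgradientDomain X ψ,
    HasFDerivWithinAt ψ (ψ' x) (subgradientDomain X ψ) x
  continuousOn_grad : ContinuousOn ψ' (subgradientDomain X ψ)
  strong : ∀ x ∈ subgradientDomain X ψ, ∀ y ∈ subgradientDomain X ψ,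
    ‖x - y‖ ^ 2 ≤ (ψ' x - ψ' y) (x - y)

variable {m : ℕ} {n : Fin m → ℕ}

/-- Empirical risk `R_i(w)` of group `i`. -/
def Problem.risk (P : Problem E m n) (i : Fin m) (w : E) : ℝ :=
  (n i : ℝ)⁻¹ * ∑ j, P.loss i j w

/-- The standing assumptions: bounded convex domain, smooth Lipschitz losses, convex risks. -/
structure Assumptions (A : Geometry E) (P : Problem E m n) (L G D : ℝ) : Prop where
  nonempty : A.dom.Nonempty
  compact : IsCompact A.dom
  convex : Convex ℝ A.dom
  distGen : IsDistanceGenerating A.dom A.psi A.dpsi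
  diameter : ∀ x ∈ A.dom, ∀ y ∈ A.dom, A.psi x - A.psi y ≤ D ^ 2
  hasGrad : ∀ i j, ∀ w ∈ A.dom, HasFDerivWithinAt (P.loss i j) (P.grad i j w) A.dom w
  smooth : ∀ i j, ∀ v ∈ A.dom, ∀ w ∈ A.dom, ‖P.grad i j v - P.grad i j w‖ ≤ L * ‖v - w‖
  lipschitz : ∀ i j, ∀ v ∈ A.dom, ∀ w ∈ A.dom, |P.loss i j v - P.loss i j w| ≤ G * ‖v - w‖
  convex_risk : ∀ i, ConvexOn ℝ A.dom (P.risk i)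

/-- Excess empirical risk `R_i(w) - R_i^*` with `R_i^* = min_W R_i`. -/
def excessRisk (A : Geometry E) (P : Problem E m n) (i : Fin m) (w : E) : ℝ :=
  P.risk i w - sInf (P.risk i '' A.dom)

/-- The objective `∑ q_i (R_i(w) - R_i^*)` of the empirical MERO saddle-point problem. -/
def meroObjective (A : Geometry E) (P : Problem E m n) (w : E) (q : Fin m → ℝ) : ℝ :=
  ∑ i, q i * excessRisk A P i w

/-- The duality gap of `z = (w, q)` for the empirical MERO problem. -/
def meroGap (A : Geometry E) (P : Problem E m n) (z : E × (Fin m → ℝ)) : ℝ :=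
  sSup ((fun q => meroObjective A P z.1 q) '' stdSimplex ℝ (Fin m)) -
    sInf ((fun w => meroObjective A P w z.2) '' A.dom)

/-! ## Bregman setup on `Z = W × Δ_m` -/

/-- The feasible set `Z = W × Δ_m`. -/
def feasible (A : Geometry E) (m : ℕ) : Set (E × (Fin m → ℝ)) :=
  A.dom ×ˢ stdSimplex ℝ (Fin m)

/-- Dual pairing. -/
def pair (g : (E →L[ℝ] ℝ) × (Fin m → ℝ)) (z : E × (Fin m → ℝ)) : ℝ :=
  g.1 z.1 + ∑ i, g.2 i * z.2 i

/-- `ψ(z) = ψ_w(w) / (2 D²) + (∑ q_i ln q_i) / (2 ln m)`. For `m = 1` the simplex is a point and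
the second term is `0`. -/
def psi (A : Geometry E) (D : ℝ) (z : E × (Fin m → ℝ)) : ℝ :=
  A.psi z.1 / (2 * D ^ 2) + (∑ i, z.2 i * Real.log (z.2 i)) / (2 * Real.log m)

/-- `∇ψ(z)`. -/
def gradPsi (A : Geometry E) (D : ℝ) (z : E × (Fin m → ℝ)) :
    Timed ((E →L[ℝ] ℝ) × (Fin m → ℝ)) :=
  ⟨((2 * D ^ 2)⁻¹ • A.dpsi z.1, fun i => (2 * Real.log m)⁻¹ * (Real.log (z.2 i) + 1)),
    2 + 3 * m⟩

/-- The Bregman divergence `B(z, z°) = ψ(z) - ψ(z°) - ⟨∇ψ(z°), z - z°⟩` as a function of `z` up to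
an additive constant, expressed through `p = ∇ψ(z°)`, which is all that the algorithm knows about
the mirror snapshot. -/
def bregman (A : Geometry E) (D : ℝ) (p : (E →L[ℝ] ℝ) × (Fin m → ℝ)) (z : E × (Fin m → ℝ)) : ℝ :=
  psi A D z - pair p z

/-- `argmin_{z ∈ Z} η ⟨g, z⟩ + α B(z, z̄) + (1 - α) B(z, z')`, where `p̄ = ∇ψ(z̄)` and `p = ∇ψ(z')`.
Five operations on pairs form the linear term; then the problem splits into one prox-mapping
onto `W` and an exponential weighting on the simplex. -/
def prox (A : Geometry E) (D η α : ℝ) (g pbar p : (E →L[ℝ] ℝ) × (Fin m → ℝ)) :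
    Timed (E × (Fin m → ℝ)) :=
  ⟨argminOn (feasible A m) fun z =>
      η * pair g z + α * bregman A D pbar z + (1 - α) * bregman A D p z,
    5 * (m + 1) + (3 * m + 1)⟩

/-! ## Gradients -/

/-- One loss evaluation (including the subtraction of a possible offset). -/
def Problem.evalLoss (P : Problem E m n) (i : Fin m) (j : Fin (n i)) (w : E) : Timed ℝ :=
  ⟨P.loss i j w, 2⟩

/-- One gradient evaluation. -/
def Problem.evalGrad (P : Problem E m n) (i : Fin m) (j : Fin (n i)) (w : E) :
    Timed (E →L[ℝ] ℝ) :=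
  ⟨P.grad i j w, 1⟩

/-- Computation of `R_i(w)`. -/
def Problem.evalRisk (P : Problem E m n) (i : Fin m) (w : E) : Timed ℝ :=
  (Timed.sum fun j => P.evalLoss i j w).step fun r => (n i : ℝ)⁻¹ * r

/-- Computation of `∇R_i(w)`. -/
def Problem.evalRiskGrad (P : Problem E m n) (i : Fin m) (w : E) : Timed (E →L[ℝ] ℝ) :=
  (Timed.sum fun j => P.evalGrad i j w).step fun g => (n i : ℝ)⁻¹ • g

/-- The merged full gradient `∇F(z) = (∑ q_i ∇R_i(w), -(R_i(w))_i)`. -/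
def Problem.fullGrad (P : Problem E m n) (z : E × (Fin m → ℝ)) :
    Timed ((E →L[ℝ] ℝ) × (Fin m → ℝ)) :=
  let gw := Timed.sum fun i => (P.evalRiskGrad i z.1).step fun g => z.2 i • g
  let gq := Timed.vec fun i => (P.evalRisk i z.1).step fun r => -r
  ⟨(gw.val, gq.val), gw.ops + gq.ops⟩

/-- The group-sampling stochastic gradient
`∇F(z; ξ) = (∑ q_i ∇ℓ(w; ξ_i), -(ℓ(w; ξ_i))_i)`. -/
def Problem.stochGrad (P : Problem E m n) (ξ : (i : Fin m) → Fin (n i)) (z : E × (Fin m → ℝ)) :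
    Timed ((E →L[ℝ] ℝ) × (Fin m → ℝ)) :=
  let gw := Timed.sum fun i => (P.evalGrad i (ξ i) z.1).step fun g => z.2 i • g
  let gq := Timed.vec fun i => (P.evalLoss i (ξ i) z.1).step fun r => -r
  ⟨(gw.val, gq.val), gw.ops + gq.ops⟩

/-! ## ALEG: the variance-reduced stochastic mirror prox solver for empirical GDRO -/

/-- State of ALEG: the iterate `z_k^s`; the sums over the current epoch of the weights `α_k^s`, of
`α_k^s z_{k+1}^s` and of `α_k^s ∇ψ(z_{k+1}^s)`; the sums over the whole run of the learning rates
`η_k^s` and of `η_k^s z_{k+1/2}^s`; the number of operations so far. -/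
structure AlegState (E : Type*) [NormedAddCommGroup E] [NormedSpace ℝ E] (m : ℕ) where
  cur : E × (Fin m → ℝ)
  wtSum : ℝ
  ptSum : E × (Fin m → ℝ)
  mirrorSum : (E →L[ℝ] ℝ) × (Fin m → ℝ)
  rateSum : ℝ
  outSum : E × (Fin m → ℝ)
  ops : ℕ

/-- Initialisation at `z_0 = argmin_Z ψ`. All points of the fictitious epoch `-1` equal `z_0`, so
that its weighted averages are `z_0` and `∇ψ(z_0)`. -/
def alegInit (A : Geometry E) (m : ℕ) (D : ℝ) : AlegState E m :=
  let z0 : E × (Fin m → ℝ) := argminOn (feasible A m) (psi A D)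
  let d := gradPsi A D z0
  { cur := z0, wtSum := 1, ptSum := z0, mirrorSum := d.val, rateSum := 0, outSum := 0,
    ops := (3 * m + 1) + d.ops }

/-- The inner iteration of ALEG for a drawn sample `ξ`, with snapshot `zs`, mirror snapshot `pbar`,
full gradient `gs`, learning rate `η` and weight `α`. -/
def alegUpdate (A : Geometry E) (P : Problem E m n) (D : ℝ) (zs : E × (Fin m → ℝ))
    (pbar gs : (E →L[ℝ] ℝ) × (Fin m → ℝ)) (η α : ℝ) (st : AlegState E m)
    (ξ : (i : Fin m) → Fin (n i)) : AlegState E m :=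
  let p := gradPsi A D st.cur
  let half := prox A D η α gs pbar p.val
  let g1 := P.stochGrad ξ half.val
  let g2 := P.stochGrad ξ zs
  let next := prox A D η α (g1.val - g2.val + gs) pbar p.val
  let d := gradPsi A D next.val
  { cur := next.val
    wtSum := st.wtSum + α
    ptSum := st.ptSum + α • next.val
    mirrorSum := st.mirrorSum + α • d.val
    rateSum := st.rateSum + η
    outSum := st.outSum + η • half.val
    -- `m` draws, two operations on pairs for the estimator, six and two for the running sums
    ops := st.ops + p.ops + half.ops + g1.ops + g2.ops + next.ops + d.ops +
      (m + 2 * (m + 1) + 6 * (m + 1) + 2) }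

/-- Inner iteration: draw one index uniformly and independently from every group and update. -/
def alegStep (A : Geometry E) (P : Problem E m n) [∀ i, NeZero (n i)] (D : ℝ)
    (zs : E × (Fin m → ℝ)) (pbar gs : (E →L[ℝ] ℝ) × (Fin m → ℝ)) (η α : ℝ)
    (st : AlegState E m) : PMF (AlegState E m) :=
  (PMF.uniformOfFintype ((i : Fin m) → Fin (n i))).map (alegUpdate A P D zs pbar gs η α st)

/-- One epoch: snapshot, mirror snapshot, full gradient, then `K` inner iterations. -/
def alegEpoch (A : Geometry E) (P : Problem E m n) [∀ i, NeZero (n i)] (D : ℝ) (K : ℕ)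
    (η α : ℕ → ℝ) (st : AlegState E m) : PMF (AlegState E m) :=
  let zs := st.wtSum⁻¹ • st.ptSum
  let pbar := st.wtSum⁻¹ • st.mirrorSum
  let gs := P.fullGrad zs
  forEach (fun k => alegStep A P D zs pbar gs.val (η k) (α k)) (List.range K)
    { st with
      wtSum := 0, ptSum := 0, mirrorSum := 0
      ops := st.ops + (2 * (m + 1) + 1) + gs.ops }

/-- ALEG with `S` epochs, iteration numbers `K s`, learning rates `η s k` and weights `α s k`: the
law of the returned point together with the number of operations. -/
def aleg (A : Geometry E) (P : Problem E m n) [∀ i, NeZero (n i)] (D : ℝ) (S : ℕ) (K : ℕ → ℕ)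
    (η α : ℕ → ℕ → ℝ) : PMF (Timed (E × (Fin m → ℝ))) :=
  (forEach (fun s => alegEpoch A P D (K s) (η s) (α s)) (List.range S) (alegInit A m D)).map
    fun st => ⟨st.rateSum⁻¹ • st.outSum, st.ops + (m + 1) + 1⟩

/-! ## ALEM: the two-stage solver for empirical MERO -/

/-- The one-group problem with risk `R_i`. -/
def Problem.single (P : Problem E m n) (i : Fin m) : Problem E 1 (fun _ => n i) where
  loss _ j := P.loss i j
  grad _ j := P.grad i j

/-- The problem with risks `R_i - b_i`. -/
def Problem.shift (P : Problem E m n) (b : Fin m → ℝ) : Problem E m n where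
  loss i j w := P.loss i j w - b i
  grad := P.grad

/-- Output of ALEM: `z̄`, the approximate minimisers `w̄_i`, the estimates `R̂_i^* = R_i(w̄_i)`, and
the number of operations of the whole run. -/
structure AlemOutput (E : Type*) (m : ℕ) where
  zbar : E × (Fin m → ℝ)
  wbar : Fin m → E
  rhat : Fin m → ℝ
  ops : ℕ

/-- First stage: ALEG on every single group. (The `zbar` of the output is a placeholder.) -/
def alemStageOne (A : Geometry E) (P : Problem E m n) [∀ i, NeZero (n i)] (D : ℝ) (S : ℕ)
    (K : ℕ → ℕ) (η α : ℕ → ℕ → ℝ) : PMF (AlemOutput E m) :=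
  forEach
    (fun i (out : AlemOutput E m) =>
      (aleg A (P.single i) D S K η α).map fun r =>
        let R := P.evalRisk i r.val.1
        { out with
          wbar := Function.update out.wbar i r.val.1
          rhat := Function.update out.rhat i R.val
          ops := out.ops + r.ops + R.ops })
    (List.finRange m) { zbar := 0, wbar := 0, rhat := 0, ops := 0 }

/-- ALEM, with learning rates `η₁` in the first and `η₂` in the second stage. -/
def alem (A : Geometry E) (P : Problem E m n) [∀ i, NeZero (n i)] (D : ℝ) (S : ℕ) (K : ℕ → ℕ)
    (η₁ η₂ α : ℕ → ℕ → ℝ) : PMF (AlemOutput E m) :=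
  (alemStageOne A P D S K η₁ α).bind fun out =>
    (aleg A (P.shift out.rhat) D S K η₂ α).map fun r =>
      { out with zbar := r.val, ops := out.ops + r.ops }

end

/-- The Lipschitz constant of the merged stochastic gradient for `m` groups,
`L_z = 2 D max {√(2 D² L² + G² ln m), G √(2 ln m)}`. -/
def lipConst (L G D : ℝ) (m : ℕ) : ℝ :=
  2 * D * max (√(2 * D ^ 2 * L ^ 2 + G ^ 2 * Real.log m)) (G * √(2 * Real.log m))

/-- Admissible learning rates for `S` epochs of `K` iterations and Lipschitz constant `Λ`:
`1 / (10 Λ √K) ≤ η_k^s ≤ 1 / (Λ √(5 K))`. -/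
def AdmissibleRates (Λ : ℝ) (S K : ℕ) (η : ℕ → ℕ → ℝ) : Prop :=
  ∀ s < S, ∀ k < K, 1 / (10 * Λ * √K) ≤ η s k ∧ η s k ≤ 1 / (Λ * √(5 * K))

end Mero

end

/-! The core is a pathwise regret bound for ALEG, followed by an exponential supermartingale for the
noise. Regret: the optimality inequalities of the two prox-mappings make the divergences B(z, z_k)
telescope within an epoch. The divergences collected with weights α add up to ψ(z) - ⟨mirror
average, z⟩ + const, which is the snapshot divergence of the next epoch, so the bound also
telescopes across epochs; by Jensen it dominates half the squared distance to the averaged snapshot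
zˢ. Each step leaves over -(2/5) α ‖z_{k+1/2} - zˢ‖² (`mirrorProx_step`, `TraceInv.update`,
`tracedEpoch_spec`). Noise: the estimator error Δ has mean zero and, on feasible directions, size at
most 2Λ ‖z_{k+1/2} - zˢ‖. The sum of -η⟨Δ, z⟩ has to be controlled for all z at once, although the
worst z depends on the noise. The conjugate of 2(ψ - min ψ) does this at a fixed price, and being
smooth it grows per step by a linear term at a point determined by the past plus a quadratic term
(`dualPotential_add_le`). The linear terms are martingale differences; the left-over negative square
pays both for the quadratic term and for Hoeffding's lemma. Hence exp(potential / 16) is a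
supermartingale (`expect_tracedStep_le`), and Markov's inequality bounds the gap by 10 Λ (4 + 16
ln(1/δ)) / (S √K) with probability at least 1 - δ (`aleg_gap`). ALEM: the dependence on δ is only
logarithmic, so a union bound over the m runs of the first stage costs just ln m. Replacing R_i^* by
an overestimate within ε/2 changes the duality gap by at most ε/2 (`meroGap_le`, `alem_good`). The
operation count is the same in every run; an epoch costs O(m n̄) because K is about n̄, and there
are about T/√n̄ epochs (`alem_ops`, `ops_le_of_budget`). -/

noncomputable section

namespace Mero

open Set Filter Topology
open scoped ENNReal

/-! ### Subgradients, strong convexity and optimality on a set where ψ is only partly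
differentiable. -/

section Convexity

variable {E : Type*} [NormedAddCommGroup E] [NormedSpace ℝ E]

/-- A minimiser over `X` of the sum of `ψ` and a continuous convex function is a point at which `ψ`
has a subgradient. -/
theorem exists_subgradient_of_isMin_add {X : Set E} {ψ h : E → ℝ} (hψ : ConvexOn ℝ X ψ)
    (hh : ConvexOn ℝ univ h) (hcont : Continuous h) {y : E} (hy : y ∈ X)
    (hmin : ∀ z ∈ X, ψ y + h y ≤ ψ z + h z) :
    ∃ g : E →L[ℝ] ℝ, ∀ z ∈ X, ψ y + g (z - y) ≤ ψ z := by
  -- Minimality of y makes the strict hypograph of the concave function ψ y + h y - h disjoint from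
  -- the epigraph of ψ. Only the hypograph has to be open for the separation, so ψ need not be
  -- continuous.
  have hs : Convex ℝ {p : E × ℝ | p.2 + h p.1 < ψ y + h y} := by
    intro p hp q hq a b ha hb hab
    simp only [mem_ofPred_eq] at hp hq ⊢
    have h1 := hh.2 (mem_univ p.1) (mem_univ q.1) ha hb hab
    simp only [Prod.snd_add, Prod.smul_snd, Prod.fst_add, Prod.smul_fst, smul_eq_mul] at h1 ⊢
    have h2 : a * (p.2 + h p.1) + b * (q.2 + h q.1) < ψ y + h y :=
      convex_Iio (ψ y + h y) hp hq ha hb hab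
    linarith
  have ho : IsOpen {p : E × ℝ | p.2 + h p.1 < ψ y + h y} :=
    isOpen_lt (by fun_prop) continuous_const
  have hd : Disjoint {p : E × ℝ | p.2 + h p.1 < ψ y + h y} {p : E × ℝ | p.1 ∈ X ∧ ψ p.1 ≤ p.2} := by
    rw [Set.disjoint_left]
    rintro p hp ⟨hp1, hp2⟩
    simp only [mem_ofPred_eq] at hp
    have := hmin _ hp1
    linarith
  obtain ⟨f, u, hf1, hf2⟩ := geometric_hahn_banach_open hs ho hψ.convex_epigraph hd
  have hsplit : ∀ (z : E) (t : ℝ), f (z, t) = f (z, 0) + t * f (0, 1) := by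
    intro z t
    have : ((z, t) : E × ℝ) = (z, 0) + t • (0, 1) := by simp
    rw [this, map_add, map_smul, smul_eq_mul]
  have hlow : ∀ τ > 0, f (y, 0) + (ψ y - τ) * f (0, 1) < u := by
    intro τ hτ
    rw [← hsplit]
    apply hf1
    simp only [mem_ofPred_eq]
    linarith
  have hup : ∀ z ∈ X, u ≤ f (z, 0) + ψ z * f (0, 1) := by
    intro z hz
    rw [← hsplit]
    exact hf2 _ ⟨hz, le_rfl⟩
  -- The separating hyperplane is not vertical: it strictly separates (y, ψ y - 1) from (y, ψ y).
  have hpos : 0 < f (0, 1) := by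
    have h1 := hlow 1 one_pos
    have h2 := hup y hy
    linarith
  have hle : f (y, 0) + ψ y * f (0, 1) ≤ u := by
    refine le_of_forall_pos_lt_add fun τ hτ => ?_
    have := hlow (τ / f (0, 1)) (by positivity)
    rw [sub_mul, div_mul_cancel₀ _ hpos.ne'] at this
    linarith
  refine ⟨-((f (0, 1))⁻¹ • f.comp (ContinuousLinearMap.inl ℝ E ℝ)), fun z hz => ?_⟩
  have h1 := hup z hz
  have h3 : f (y, 0) - f (z, 0) ≤ (ψ z - ψ y) * f (0, 1) := by linarith
  have h4 : f (z - y, 0) = f (z, 0) - f (y, 0) := by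
    rw [← map_sub]; simp
  simp only [neg_apply, smul_apply,
    ContinuousLinearMap.comp_apply, ContinuousLinearMap.inl_apply, smul_eq_mul, h4]
  have h5 : (f (0, 1))⁻¹ * (f (y, 0) - f (z, 0)) ≤ ψ z - ψ y := by
    rw [inv_mul_le_iff₀ hpos]; linarith
  linarith

/-- The points with a subgradient are dense. -/
theorem subset_closure_subgradientDomain {X : Set E} {ψ : E → ℝ} (hX : IsCompact X)
    (hc : ContinuousOn ψ X) (hψ : ConvexOn ℝ X ψ) : X ⊆ closure (subgradientDomain X ψ) := by
  intro x hx
  rw [Metric.mem_closure_iff]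
  intro ε hε
  obtain ⟨y₀, hy₀, hy₀min⟩ := hX.exists_isMinOn ⟨x, hx⟩ hc
  -- With this c the penalty c‖y - x‖² at distance ε exceeds ψ x - min ψ, so the penalised minimiser
  -- lies closer to x than ε.
  set c : ℝ := (ψ x - ψ y₀ + 1) / ε ^ 2 with hcdef
  have hx0 : ψ y₀ ≤ ψ x := hy₀min hx
  have hc0 : 0 < c := by
    have : 0 < ψ x - ψ y₀ + 1 := by linarith
    positivity
  have hcont : Continuous fun y : E => c * ‖y - x‖ ^ 2 := by fun_prop
  obtain ⟨y, hy, hymin⟩ := hX.exists_isMinOn ⟨x, hx⟩ (hc.add hcont.continuousOn)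
  have hconv : ConvexOn ℝ univ fun y : E => c * ‖y - x‖ ^ 2 := by
    have h1 : ConvexOn ℝ univ fun y : E => ‖y - x‖ := by
      have := (convexOn_univ_norm (E := E)).translate_left (-x)
      simpa [Function.comp_def, sub_eq_add_neg] using this
    exact (h1.pow (fun _ _ => norm_nonneg _) 2).smul hc0.le
  obtain ⟨g, hg⟩ := exists_subgradient_of_isMin_add hψ hconv hcont hy fun z hz => hymin hz
  refine ⟨y, ⟨hy, g, hg⟩, ?_⟩
  have h1 : ψ y + c * ‖y - x‖ ^ 2 ≤ ψ x + c * ‖x - x‖ ^ 2 := hymin hx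
  have h2 : ψ y₀ ≤ ψ y := hy₀min hy
  have h3 : c * ε ^ 2 = ψ x - ψ y₀ + 1 := by
    rw [hcdef, div_mul_cancel₀]; positivity
  simp only [sub_self, norm_zero] at h1
  rw [dist_comm, dist_eq_norm]
  refine lt_of_pow_lt_pow_left₀ 2 hε.le (lt_of_mul_lt_mul_left (a := c) ?_ hc0.le)
  linarith

theorem hasDerivWithinAt_segment {S : Set E} (hS : Convex ℝ S) {f : E → ℝ} {f' : E →L[ℝ] ℝ}
    {x z : E} (hx : x ∈ S) (hz : z ∈ S) {t : ℝ}
    (h : HasFDerivWithinAt f f' S (x + t • (z - x))) :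
    HasDerivWithinAt (fun t : ℝ => f (x + t • (z - x))) (f' (z - x)) (Icc 0 1) t := by
  have hl : HasDerivWithinAt (fun t : ℝ => x + t • (z - x)) (z - x) (Icc 0 1) t := by
    have := (((hasDerivAt_id t).smul_const (z - x)).const_add x).hasDerivWithinAt (s := Icc 0 1)
    simpa using this
  exact h.comp_hasDerivWithinAt t hl fun u hu => hS.add_smul_sub_mem hx hz hu

/-- First-order lower bound of a convex function. -/
theorem convexOn_gradient_le {S : Set E} {f : E → ℝ} {f' : E →L[ℝ] ℝ} (hf : ConvexOn ℝ S f)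
    {x z : E} (hx : x ∈ S) (hz : z ∈ S) (h : HasFDerivWithinAt f f' S x) :
    f x + f' (z - x) ≤ f z := by
  have h0 : HasFDerivWithinAt f f' S (x + (0 : ℝ) • (z - x)) := by simpa using h
  have hd := hasDerivWithinAt_segment hf.1 hx hz h0
  have hc : ConvexOn ℝ (Icc (0 : ℝ) 1) fun t : ℝ => f (x + t • (z - x)) := by
    refine ⟨convex_Icc 0 1, fun s hs t ht a b ha hb hab => ?_⟩
    have := hf.2 (hf.1.add_smul_sub_mem hx hz hs) (hf.1.add_smul_sub_mem hx hz ht) ha hb hab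
    convert this using 2
    have hx' : x = a • x + b • x := by rw [← add_smul, hab, one_smul]
    nth_rewrite 1 [hx']
    simp only [smul_add, add_smul, smul_smul, smul_eq_mul]
    abel
  have := hc.le_slope_of_hasDerivWithinAt (left_mem_Icc.2 zero_le_one)
    (right_mem_Icc.2 zero_le_one) one_pos hd
  simp [slope_def_field] at this
  rw [map_sub]
  linarith

variable {X : Set E} {ψ : E → ℝ} {ψ' : E → (E →L[ℝ] ℝ)}

/-- Along the segment from x to z, subtract from ψ its linear part at x and t²‖z - x‖²/2. Strong
monotonicity of ψ' makes the derivative of the difference nonnegative, and its values at 0 and 1 are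
compared. -/
theorem IsDistanceGenerating.half_sq_le_of_mem (h : IsDistanceGenerating X ψ ψ') {x z : E}
    (hx : x ∈ subgradientDomain X ψ) (hz : z ∈ subgradientDomain X ψ) :
    ‖z - x‖ ^ 2 / 2 ≤ ψ z - ψ x - ψ' x (z - x) := by
  have hmem : ∀ t ∈ Icc (0 : ℝ) 1, x + t • (z - x) ∈ subgradientDomain X ψ :=
    fun t ht => h.convex_domain.add_smul_sub_mem hx hz ht
  have hd : ∀ t ∈ Icc (0 : ℝ) 1, HasDerivWithinAt
      (fun t : ℝ => ψ (x + t • (z - x)) - t * ψ' x (z - x) - t ^ 2 * (‖z - x‖ ^ 2 / 2))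
      (ψ' (x + t • (z - x)) (z - x) - ψ' x (z - x) - t * ‖z - x‖ ^ 2) (Icc 0 1) t := by
    intro t ht
    have h1 := hasDerivWithinAt_segment h.convex_domain hx hz (h.hasGrad _ (hmem t ht))
    have h2 := ((hasDerivAt_id t).mul_const (ψ' x (z - x))).hasDerivWithinAt (s := Icc 0 1)
    have h3 := ((hasDerivAt_pow 2 t).mul_const (‖z - x‖ ^ 2 / 2)).hasDerivWithinAt (s := Icc 0 1)
    refine ((h1.sub h2).sub h3).congr_deriv ?_
    simp
    ring
  have hmono := monotoneOn_of_hasDerivWithinAt_nonneg (convex_Icc (0 : ℝ) 1)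
    (fun t ht => (hd t ht).continuousWithinAt)
    (fun t ht => (hd t (interior_subset ht)).mono interior_subset) (fun t ht => by
      rw [interior_Icc] at ht
      have h1 := h.strong _ (hmem t ⟨ht.1.le, ht.2.le⟩) x hx
      simp only [add_sub_cancel_left, map_smul, smul_eq_mul, norm_smul, Real.norm_eq_abs,
        abs_of_pos ht.1, sub_apply] at h1
      have h2 : t * (t * ‖z - x‖ ^ 2) ≤ t * (ψ' (x + t • (z - x)) (z - x) - ψ' x (z - x)) := by
        linarith [h1, mul_pow t ‖z - x‖ 2]
      have h3 := le_of_mul_le_mul_left h2 ht.1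
      linarith)
  have := hmono (left_mem_Icc.2 zero_le_one) (right_mem_Icc.2 zero_le_one) zero_le_one
  simp at this
  rw [map_sub]
  linarith

/-- Strong convexity: the Bregman divergence dominates half the squared distance. -/
theorem IsDistanceGenerating.half_sq_le (h : IsDistanceGenerating X ψ ψ') (hX : IsCompact X)
    {x z : E} (hx : x ∈ subgradientDomain X ψ) (hz : z ∈ X) :
    ‖z - x‖ ^ 2 / 2 ≤ ψ z - ψ x - ψ' x (z - x) := by
  -- The base point x stays in X°, and both sides are continuous in z on X, so the inequality passes
  -- from the dense subset X° to X.
  have hsub : subgradientDomain X ψ ⊆ X := fun y hy => hy.1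
  have hcl : X ⊆ closure (subgradientDomain X ψ) :=
    subset_closure_subgradientDomain hX h.continuousOn h.convexOn
  have hne : (𝓝[subgradientDomain X ψ] z).NeBot := mem_closure_iff_nhdsWithin_neBot.1 (hcl hz)
  have h1 : Tendsto ψ (𝓝[subgradientDomain X ψ] z) (𝓝 (ψ z)) :=
    ((h.continuousOn z hz).mono hsub).tendsto
  have h2 : Tendsto (fun y => ‖y - x‖ ^ 2 / 2) (𝓝[subgradientDomain X ψ] z)
      (𝓝 (‖z - x‖ ^ 2 / 2)) :=
    ((by fun_prop : Continuous fun y => ‖y - x‖ ^ 2 / 2).tendsto z).mono_left nhdsWithin_le_nhds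
  have h3 : Tendsto (fun y => ψ' x (y - x)) (𝓝[subgradientDomain X ψ] z)
      (𝓝 (ψ' x (z - x))) :=
    ((by fun_prop : Continuous fun y => ψ' x (y - x)).tendsto z).mono_left nhdsWithin_le_nhds
  refine le_of_tendsto_of_tendsto h2 ((h1.sub_const _).sub h3) ?_
  filter_upwards [self_mem_nhdsWithin] with y hy
  exact h.half_sq_le_of_mem hx hy

/-- First-order optimality condition for a linear perturbation of a distance-generating function. -/
theorem IsDistanceGenerating.optimality (h : IsDistanceGenerating X ψ ψ') (hX : IsCompact X)
    {p : E →L[ℝ] ℝ} {x : E} (hx : x ∈ X) (hmin : ∀ z ∈ X, ψ x - p x ≤ ψ z - p z) :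
    x ∈ subgradientDomain X ψ ∧ ∀ z ∈ X, 0 ≤ (ψ' x - p) (z - x) := by
  have hxd : x ∈ subgradientDomain X ψ := by
    refine ⟨hx, p, fun y hy => ?_⟩
    have := hmin y hy
    rw [map_sub]; linarith
  refine ⟨hxd, fun z hz => ?_⟩
  have hcl : X ⊆ closure (subgradientDomain X ψ) :=
    subset_closure_subgradientDomain hX h.continuousOn h.convexOn
  -- First-order conditions are available only for directions inside the convex set X°; the
  -- half-space they describe is closed and therefore contains X.
  have key : ∀ z ∈ subgradientDomain X ψ, 0 ≤ (ψ' x - p) (z - x) := by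
    intro z hz
    have h0 : HasFDerivWithinAt ψ (ψ' x) (subgradientDomain X ψ) x := h.hasGrad x hxd
    have h1 : HasFDerivWithinAt (fun y => ψ y - p y) (ψ' x - p) (subgradientDomain X ψ) x :=
      h0.sub p.hasFDerivWithinAt
    have hm : IsLocalMinOn (fun y => ψ y - p y) (subgradientDomain X ψ) x :=
      IsMinOn.localize fun y hy => hmin y hy.1
    exact hm.hasFDerivWithinAt_nonneg h1
      (sub_mem_posTangentConeAt_of_segment_subset (h.convex_domain.segment_subset hxd hz))
  have hclosed : IsClosed {z : E | 0 ≤ (ψ' x - p) (z - x)} :=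
    isClosed_le continuous_const (by fun_prop)
  exact closure_minimal key hclosed (hcl hz)

/-- The differential of a function that is `G`-Lipschitz on a convex set is bounded by `G` in all
directions that join points of the set. -/
theorem abs_fderiv_sub_le {S : Set E} (hS : Convex ℝ S) {f : E → ℝ} {f' : E → (E →L[ℝ] ℝ)}
    {G L : ℝ} (hd : ∀ w ∈ S, HasFDerivWithinAt f (f' w) S w)
    (hL : ∀ v ∈ S, ∀ w ∈ S, ‖f' v - f' w‖ ≤ L * ‖v - w‖)
    (hG : ∀ v ∈ S, ∀ w ∈ S, |f v - f w| ≤ G * ‖v - w‖)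
    {w x y : E} (hw : w ∈ S) (hx : x ∈ S) (hy : y ∈ S) : |f' w (x - y)| ≤ G * ‖x - y‖ := by
  have feas : ∀ v ∈ S, ∀ u ∈ S, |f' v (u - v)| ≤ G * ‖u - v‖ := by
    intro v hv u hu
    have h0 : HasFDerivWithinAt f (f' v) S (v + (0 : ℝ) • (u - v)) := by simpa using hd v hv
    have h1 := (hasDerivWithinAt_segment hS hv hu h0).mono Ioc_subset_Icc_self
    rw [hasDerivWithinAt_iff_tendsto_slope' (by simp)] at h1
    have hne : (𝓝[Ioc (0 : ℝ) 1] 0).NeBot := by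
      rw [← mem_closure_iff_nhdsWithin_neBot, closure_Ioc (by norm_num)]; simp
    refine le_of_tendsto h1.abs ?_
    filter_upwards [self_mem_nhdsWithin] with t ht
    have h2 := hG (v + t • (u - v)) (hS.add_smul_sub_mem hv hu ⟨ht.1.le, ht.2⟩) v hv
    simp only [add_sub_cancel_left, norm_smul, Real.norm_eq_abs, abs_of_pos ht.1] at h2
    simp only [slope_def_field, sub_zero, zero_smul, add_zero, abs_div, abs_of_pos ht.1]
    rw [div_le_iff₀ ht.1]
    linarith
  have hmem : ∀ z ∈ S, ∀ t ∈ Ioc (0 : ℝ) 1, w + t • (z - w) ∈ S :=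
    fun z hz t ht => hS.add_smul_sub_mem hw hz ⟨ht.1.le, ht.2⟩
  -- The direction x - y need not be feasible at w. Moving the base point to w + t(y - w) makes t(x
  -- - y) a difference of two points of S; continuity of f' then lets t tend to 0.
  have hb : ∀ t ∈ Ioc (0 : ℝ) 1, |f' (w + t • (y - w)) (x - y)| ≤ G * ‖x - y‖ := by
    intro t ht
    have h1 := feas _ (hmem y hy t ht) _ (hmem x hx t ht)
    have h2 : w + t • (x - w) - (w + t • (y - w)) = t • (x - y) := by
      simp only [smul_sub]; abel
    rw [h2, map_smul, smul_eq_mul, abs_mul, norm_smul, Real.norm_eq_abs, abs_of_pos ht.1] at h1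
    have h3 : t * |f' (w + t • (y - w)) (x - y)| ≤ t * (G * ‖x - y‖) := by linarith
    exact le_of_mul_le_mul_left h3 ht.1
  have hne : (𝓝[Ioc (0 : ℝ) 1] 0).NeBot := by
    rw [← mem_closure_iff_nhdsWithin_neBot, closure_Ioc (by norm_num)]; simp
  have hlim : Tendsto (fun t : ℝ => G * ‖x - y‖ + L * (t * ‖y - w‖) * ‖x - y‖)
      (𝓝[Ioc (0 : ℝ) 1] 0) (𝓝 (G * ‖x - y‖)) := by
    have : Continuous fun t : ℝ => G * ‖x - y‖ + L * (t * ‖y - w‖) * ‖x - y‖ := by fun_prop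
    simpa using (this.tendsto 0).mono_left nhdsWithin_le_nhds
  refine ge_of_tendsto hlim ?_
  filter_upwards [self_mem_nhdsWithin] with t ht
  have h1 := hb t ht
  have h2 := (f' w - f' (w + t • (y - w))).le_opNorm (x - y)
  have h3 := hL w hw _ (hmem y hy t ht)
  have h4 : ‖w - (w + t • (y - w))‖ = t * ‖y - w‖ := by
    rw [sub_add_cancel_left, norm_neg, norm_smul, Real.norm_eq_abs, abs_of_pos ht.1]
  rw [h4] at h3
  have h5 := mul_le_mul_of_nonneg_right h3 (norm_nonneg (x - y))
  have h6 : f' w (x - y) = (f' w - f' (w + t • (y - w))) (x - y)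
      + f' (w + t • (y - w)) (x - y) := by simp
  rw [h6]
  refine (abs_add_le _ _).trans ?_
  rw [Real.norm_eq_abs] at h2
  linarith

end Convexity

/-! ### Pinsker's inequality and Gibbs distributions on the simplex. -/

section Entropy

/-- A Padé-type lower bound of the logarithm. -/
theorem div_le_log {t : ℝ} (ht : 0 < t) : (t - 1) * (5 * t + 1) / (2 * t * (t + 2)) ≤ Real.log t := by
  set g : ℝ → ℝ := fun t => Real.log t - (t - 1) * (5 * t + 1) / (2 * t * (t + 2)) with hg
  -- The derivative of the difference has the sign of t - 1, so the minimum is the value 0 at t = 1.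
  have hd : ∀ t : ℝ, 0 < t → HasDerivAt g ((t - 1) ^ 3 / (t ^ 2 * (t + 2) ^ 2)) t := by
    intro t ht
    have h1 : HasDerivAt (fun t : ℝ => (t - 1) * (5 * t + 1)) (1 * (5 * t + 1) + (t - 1) * 5) t := by
      have ha := (hasDerivAt_id t).sub_const 1
      have hb := ((hasDerivAt_id t).const_mul 5).add_const 1
      exact (ha.mul hb).congr_deriv (by simp)
    have h2 : HasDerivAt (fun t : ℝ => 2 * t * (t + 2)) (2 * (t + 2) + 2 * t * 1) t := by
      have ha := (hasDerivAt_id t).const_mul 2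
      have hb := (hasDerivAt_id t).add_const 2
      exact (ha.mul hb).congr_deriv (by simp)
    refine ((Real.hasDerivAt_log ht.ne').sub (h1.div h2 (by positivity))).congr_deriv ?_
    field_simp
    ring
  have g1 : g 1 = 0 := by simp [hg]
  have hcont : ∀ t : ℝ, 0 < t → ContinuousAt g t := fun t ht => (hd t ht).continuousAt
  have key : 0 ≤ g t := by
    rw [← g1]
    rcases le_total t 1 with h | h
    · refine antitoneOn_of_hasDerivWithinAt_nonpos (convex_Icc t 1)
        (f' := fun t => (t - 1) ^ 3 / (t ^ 2 * (t + 2) ^ 2))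
        (fun x hx => (hcont x (ht.trans_le hx.1)).continuousWithinAt)
        (fun x hx => (hd x (ht.trans_le (interior_subset hx).1)).hasDerivWithinAt)
        (fun x hx => ?_) (left_mem_Icc.2 h) (right_mem_Icc.2 h) h
      have hx1 := (interior_subset hx).2
      have : (x - 1) ^ 3 ≤ 0 := by
        rw [show (x - 1) ^ 3 = (x - 1) ^ 2 * (x - 1) by ring]
        exact mul_nonpos_of_nonneg_of_nonpos (sq_nonneg _) (by linarith)
      exact div_nonpos_of_nonpos_of_nonneg this (by positivity)
    · refine monotoneOn_of_hasDerivWithinAt_nonneg (convex_Icc 1 t)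
        (f' := fun t => (t - 1) ^ 3 / (t ^ 2 * (t + 2) ^ 2))
        (fun x hx => (hcont x (one_pos.trans_le hx.1)).continuousWithinAt)
        (fun x hx => (hd x (one_pos.trans_le (interior_subset hx).1)).hasDerivWithinAt)
        (fun x hx => ?_) (left_mem_Icc.2 h) (right_mem_Icc.2 h) h
      have hx1 := (interior_subset hx).1
      have : 0 ≤ x - 1 := by linarith
      positivity
  simp only [hg] at key
  linarith

/-- Pointwise form of Pinsker's inequality, from `div_le_log` at p/q. The weights (4q + 2p)/3 sum to
2 over two probability vectors, which is what Cauchy–Schwarz needs in `pinsker`. -/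
theorem three_mul_sq_le {p q : ℝ} (hp : 0 ≤ p) (hq : 0 < q) :
    (p - q) ^ 2 ≤ (4 * q + 2 * p) / 3 * (p * Real.log p - p * Real.log q - p + q) := by
  rcases eq_or_lt_of_le hp with h | h
  · subst h
    simp
    nlinarith
  · have h1 := div_le_log (div_pos h hq)
    rw [Real.log_div h.ne' hq.ne'] at h1
    have h2 : (p / q - 1) * (5 * (p / q) + 1) / (2 * (p / q) * (p / q + 2))
        = (p - q) * (5 * p + q) / (2 * p * (p + 2 * q)) := by
      field_simp
    rw [h2, div_le_iff₀ (by positivity)] at h1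
    nlinarith

variable {m : ℕ}

theorem stdSimplex_sum_sub {p q : Fin m → ℝ} (hp : p ∈ stdSimplex ℝ (Fin m))
    (hq : q ∈ stdSimplex ℝ (Fin m)) : ∑ i, (p i - q i) = 0 := by
  rw [Finset.sum_sub_distrib, hp.2, hq.2, sub_self]

/-- Pinsker's inequality: the negative entropy is `1`-strongly convex w.r.t. the `ℓ₁` norm. -/
theorem pinsker {p q : Fin m → ℝ} (hp : p ∈ stdSimplex ℝ (Fin m)) (hq : q ∈ stdSimplex ℝ (Fin m))
    (hq0 : ∀ i, 0 < q i) :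
    (∑ i, |p i - q i|) ^ 2 / 2 ≤ ∑ i, p i * Real.log (p i) - ∑ i, q i * Real.log (q i)
      - ∑ i, (Real.log (q i) + 1) * (p i - q i) := by
  have h0 : ∀ i, 0 ≤ p i * Real.log (p i) - p i * Real.log (q i) - p i + q i := by
    intro i
    have h1 := three_mul_sq_le (hp.1 i) (hq0 i)
    have h2 : 0 < (4 * q i + 2 * p i) / 3 := by have := hq0 i; have := hp.1 i; positivity
    exact nonneg_of_mul_nonneg_right ((sq_nonneg _).trans h1) h2
  have h1 : (∑ i, |p i - q i|) ^ 2 ≤ (∑ i, (4 * q i + 2 * p i) / 3) *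
      ∑ i, (p i * Real.log (p i) - p i * Real.log (q i) - p i + q i) := by
    refine Finset.sum_sq_le_sum_mul_sum_of_sq_le_mul _ (fun i _ => ?_) (fun i _ => h0 i)
      (fun i _ => ?_)
    · have := hq0 i; have := hp.1 i; positivity
    · rw [sq_abs]; exact three_mul_sq_le (hp.1 i) (hq0 i)
  have h2 : ∑ i, (4 * q i + 2 * p i) / 3 = 2 := by
    rw [← Finset.sum_div, Finset.sum_add_distrib, ← Finset.mul_sum, ← Finset.mul_sum, hp.2, hq.2]
    norm_num
  have h3 : ∑ i, (p i * Real.log (p i) - p i * Real.log (q i) - p i + q i)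
      = ∑ i, p i * Real.log (p i) - ∑ i, q i * Real.log (q i)
      - ∑ i, (Real.log (q i) + 1) * (p i - q i) := by
    rw [← Finset.sum_sub_distrib, ← Finset.sum_sub_distrib]
    exact Finset.sum_congr rfl fun i _ => by ring
  rw [h2, h3] at h1
  linarith

theorem entropy_nonpos {q : Fin m → ℝ} (hq : q ∈ stdSimplex ℝ (Fin m)) :
    ∑ i, q i * Real.log (q i) ≤ 0 :=
  Finset.sum_nonpos fun i _ => mul_nonpos_of_nonneg_of_nonpos (hq.1 i) <|
    Real.log_nonpos (hq.1 i) <| by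
      rw [← hq.2]; exact Finset.single_le_sum (fun j _ => hq.1 j) (Finset.mem_univ i)

/-- Pinsker's inequality against the uniform distribution, whose linear term vanishes because its
logarithms are all equal. -/
theorem neg_log_le_entropy {q : Fin m → ℝ} (hq : q ∈ stdSimplex ℝ (Fin m)) :
    -Real.log m ≤ ∑ i, q i * Real.log (q i) := by
  have hm : 0 < m := by
    rcases Nat.eq_zero_or_pos m with h | h
    · subst h; simpa using hq.2
    · exact h
  have hm' : (0 : ℝ) < m := by exact_mod_cast hm
  have hu : (fun _ => (m : ℝ)⁻¹ : Fin m → ℝ) ∈ stdSimplex ℝ (Fin m) :=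
    ⟨fun _ => by positivity, by simp [hm'.ne']⟩
  have h1 := pinsker hq hu (fun _ => by positivity)
  rw [← Finset.mul_sum (a := Real.log (m : ℝ)⁻¹ + 1), stdSimplex_sum_sub hq hu] at h1
  simp [hm'.ne'] at h1
  have : 0 ≤ (∑ i, |q i - (m : ℝ)⁻¹|) ^ 2 / 2 := by positivity
  linarith

/-- The minimiser over the simplex of the negative entropy plus a linear function is positive and
satisfies the first-order conditions. -/
theorem entropy_optimality {c : ℝ} (hc : 0 < c) (p : Fin m → ℝ) {q : Fin m → ℝ}
    (hq : q ∈ stdSimplex ℝ (Fin m))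
    (hmin : ∀ r ∈ stdSimplex ℝ (Fin m), (∑ i, q i * Real.log (q i)) / c - ∑ i, p i * q i ≤
      (∑ i, r i * Real.log (r i)) / c - ∑ i, p i * r i) :
    (∀ i, 0 < q i) ∧ ∀ r ∈ stdSimplex ℝ (Fin m),
      0 ≤ ∑ i, (c⁻¹ * (Real.log (q i) + 1) - p i) * (r i - q i) := by
  have hne : (Finset.univ : Finset (Fin m)).Nonempty := by
    by_contra h
    rw [Finset.not_nonempty_iff_eq_empty] at h
    have := hq.2
    rw [h] at this
    simp at this
  -- The minimiser must be the Gibbs distribution s proportional to exp(c p). Up to a constant, log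
  -- s is c p, so Pinsker's inequality at s combined with the minimality of q leaves ‖q - s‖₁² ≤ 0.
  set Z : ℝ := ∑ i, Real.exp (c * p i) with hZ
  have hZ0 : 0 < Z := Finset.sum_pos (fun i _ => Real.exp_pos _) hne
  set s : Fin m → ℝ := fun i => Real.exp (c * p i) / Z with hs
  have hs0 : ∀ i, 0 < s i := fun i => div_pos (Real.exp_pos _) hZ0
  have hss : s ∈ stdSimplex ℝ (Fin m) :=
    ⟨fun i => (hs0 i).le, by rw [hs, ← Finset.sum_div, ← hZ, div_self hZ0.ne']⟩
  have hlog : ∀ i, Real.log (s i) = c * p i - Real.log Z := fun i => by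
    rw [hs, Real.log_div (Real.exp_pos _).ne' hZ0.ne', Real.log_exp]
  have hlin : ∀ r ∈ stdSimplex ℝ (Fin m), ∑ i, (Real.log (s i) + 1) * (r i - s i) =
      c * (∑ i, p i * r i - ∑ i, p i * s i) := by
    intro r hr
    have h1 := stdSimplex_sum_sub hr hss
    have h2 : ∑ i, (Real.log (s i) + 1) * (r i - s i) =
        ∑ i, (c * (p i * r i - p i * s i) + (1 - Real.log Z) * (r i - s i)) :=
      Finset.sum_congr rfl fun i _ => by rw [hlog]; ring
    rw [h2, Finset.sum_add_distrib, ← Finset.mul_sum, ← Finset.mul_sum, h1,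
      Finset.sum_sub_distrib]
    ring
  have h1 := pinsker hq hss hs0
  rw [hlin q hq] at h1
  have h2 := hmin s hss
  have h3 : (∑ i, q i * Real.log (q i)) - c * ∑ i, p i * q i ≤
      (∑ i, s i * Real.log (s i)) - c * ∑ i, p i * s i := by
    have := mul_le_mul_of_nonneg_left h2 hc.le
    rw [mul_sub, mul_sub, mul_div_cancel₀ _ hc.ne', mul_div_cancel₀ _ hc.ne'] at this
    exact this
  have h4 : ∑ i, |q i - s i| = 0 := by
    have : (∑ i, |q i - s i|) ^ 2 ≤ 0 := by linarith
    exact pow_eq_zero_iff two_ne_zero |>.1 (le_antisymm this (sq_nonneg _))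
  have h5 : q = s := by
    funext i
    have := (Finset.sum_eq_zero_iff_of_nonneg fun i _ => abs_nonneg (q i - s i)).1 h4 i
      (Finset.mem_univ i)
    linarith [abs_eq_zero.1 this]
  rw [h5]
  refine ⟨hs0, fun r hr => ?_⟩
  have h6 : ∑ i, (c⁻¹ * (Real.log (s i) + 1) - p i) * (r i - s i) =
      c⁻¹ * ∑ i, (Real.log (s i) + 1) * (r i - s i) - (∑ i, p i * r i - ∑ i, p i * s i) := by
    rw [Finset.mul_sum, ← Finset.sum_sub_distrib, ← Finset.sum_sub_distrib]
    exact Finset.sum_congr rfl fun i _ => by ring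
  rw [h6, hlin r hr, inv_mul_cancel_left₀ hc.ne', sub_self]

end Entropy

/-! ### The mirror setup on the product of the domain and the simplex. -/

section Product

set_option linter.unusedSectionVars false

variable {E : Type*} [NormedAddCommGroup E] [NormedSpace ℝ E] {m : ℕ}

/-- The assumptions on the domain and its distance-generating function. -/
structure IsMirrorGeometry (A : Geometry E) (D : ℝ) : Prop where
  nonempty : A.dom.Nonempty
  compact : IsCompact A.dom
  convex : Convex ℝ A.dom
  distGen : IsDistanceGenerating A.dom A.psi A.dpsi
  diameter : ∀ x ∈ A.dom, ∀ y ∈ A.dom, A.psi x - A.psi y ≤ D ^ 2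

theorem Assumptions.geometry {n : Fin m → ℕ} {A : Geometry E} {P : Problem E m n} {L G D : ℝ}
    (h : Assumptions A P L G D) : IsMirrorGeometry A D :=
  ⟨h.nonempty, h.compact, h.convex, h.distGen, h.diameter⟩

section Pairing

variable (g h : (E →L[ℝ] ℝ) × (Fin m → ℝ)) (x y : E × (Fin m → ℝ)) (c : ℝ)

theorem pair_add_left : pair (g + h) x = pair g x + pair h x := by
  simp only [pair, Prod.fst_add, Prod.snd_add, Pi.add_apply, add_apply, add_mul,
    Finset.sum_add_distrib]
  ring

theorem pair_sub_left : pair (g - h) x = pair g x - pair h x := by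
  simp only [pair, Prod.fst_sub, Prod.snd_sub, Pi.sub_apply, sub_apply, sub_mul,
    Finset.sum_sub_distrib]
  ring

theorem pair_smul_left : pair (c • g) x = c * pair g x := by
  simp only [pair, Prod.smul_fst, Prod.smul_snd, Pi.smul_apply, smul_apply, smul_eq_mul, mul_add,
    Finset.mul_sum, mul_assoc]

theorem pair_sub_right : pair g (x - y) = pair g x - pair g y := by
  simp only [pair, Prod.fst_sub, Prod.snd_sub, Pi.sub_apply, map_sub, mul_sub,
    Finset.sum_sub_distrib]
  ring

theorem pair_zero_left : pair (0 : (E →L[ℝ] ℝ) × (Fin m → ℝ)) x = 0 := by simp [pair]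

theorem continuous_pair : Continuous (pair g) := by unfold pair; fun_prop

end Pairing

/-- The norm of `Z`, with respect to which `ψ` is `1`-strongly convex. (For `m = 1` only the first
component matters.) -/
def znorm (D : ℝ) (z : E × (Fin m → ℝ)) : ℝ :=
  √((‖z.1‖ / (√2 * D)) ^ 2 + ((∑ i, |z.2 i|) / √(2 * Real.log m)) ^ 2)

theorem znorm_nonneg (D : ℝ) (z : E × (Fin m → ℝ)) : 0 ≤ znorm D z := Real.sqrt_nonneg _

theorem znorm_sq (D : ℝ) (z : E × (Fin m → ℝ)) :
    znorm D z ^ 2 = ‖z.1‖ ^ 2 / (2 * D ^ 2) + (∑ i, |z.2 i|) ^ 2 / (2 * Real.log m) := by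
  have h2 : 0 ≤ 2 * Real.log m := mul_nonneg zero_le_two (Real.log_natCast_nonneg m)
  rw [znorm, Real.sq_sqrt (by positivity), div_pow, div_pow, mul_pow, Real.sq_sqrt zero_le_two,
    Real.sq_sqrt h2]

theorem sqrt_sq_add_sq_add_le (a b c d : ℝ) :
    √((a + c) ^ 2 + (b + d) ^ 2) ≤ √(a ^ 2 + b ^ 2) + √(c ^ 2 + d ^ 2) := by
  rw [Real.sqrt_le_left (by positivity), add_sq √_, Real.sq_sqrt (by positivity),
    Real.sq_sqrt (by positivity), mul_assoc, ← Real.sqrt_mul (by positivity)]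
  have : a * c + b * d ≤ √((a ^ 2 + b ^ 2) * (c ^ 2 + d ^ 2)) :=
    Real.le_sqrt_of_sq_le (by nlinarith [sq_nonneg (a * d - b * c)])
  nlinarith

theorem znorm_add_le {D : ℝ} (hD : 0 ≤ D) (x y : E × (Fin m → ℝ)) :
    znorm D (x + y) ≤ znorm D x + znorm D y := by
  refine le_trans (Real.sqrt_le_sqrt ?_) (sqrt_sq_add_sq_add_le _ _ _ _)
  have h1 : ‖(x + y).1‖ / (√2 * D) ≤ ‖x.1‖ / (√2 * D) + ‖y.1‖ / (√2 * D) := by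
    rw [← add_div]
    exact div_le_div_of_nonneg_right (norm_add_le _ _) (by positivity)
  have h2 : (∑ i, |(x + y).2 i|) / √(2 * Real.log m) ≤
      (∑ i, |x.2 i|) / √(2 * Real.log m) + (∑ i, |y.2 i|) / √(2 * Real.log m) := by
    rw [← add_div, ← Finset.sum_add_distrib]
    exact div_le_div_of_nonneg_right (Finset.sum_le_sum fun i _ => abs_add_le _ _)
      (by positivity)
  have h3 : 0 ≤ ∑ i, |(x + y).2 i| := Finset.sum_nonneg fun i _ => abs_nonneg _
  gcongr

theorem znorm_smul {D : ℝ} (c : ℝ) (x : E × (Fin m → ℝ)) :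
    znorm D (c • x) = |c| * znorm D x := by
  rw [← Real.sqrt_sq (abs_nonneg c), znorm, znorm, ← Real.sqrt_mul (by positivity)]
  congr 1
  simp only [Prod.smul_fst, Prod.smul_snd, Pi.smul_apply, norm_smul, Real.norm_eq_abs, smul_eq_mul,
    abs_mul, ← Finset.mul_sum, mul_div_assoc, mul_pow]
  ring

theorem znorm_sub_le {D : ℝ} (hD : 0 ≤ D) (x y z : E × (Fin m → ℝ)) :
    znorm D (x - z) ≤ znorm D (x - y) + znorm D (y - z) := by
  rw [← sub_add_sub_cancel x y z]
  exact znorm_add_le hD _ _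

theorem znorm_sub_comm {D : ℝ} (x y : E × (Fin m → ℝ)) : znorm D (x - y) = znorm D (y - x) := by
  rw [← neg_sub, ← neg_one_smul ℝ, znorm_smul]; simp

/-- The points of `Z` at which `ψ` is differentiable. -/
def mirrorDomain (A : Geometry E) (m : ℕ) : Set (E × (Fin m → ℝ)) :=
  {z | z.1 ∈ subgradientDomain A.dom A.psi ∧ z.2 ∈ stdSimplex ℝ (Fin m) ∧ ∀ i, 0 < z.2 i}

theorem mirrorDomain_subset (A : Geometry E) (m : ℕ) : mirrorDomain A m ⊆ feasible A m :=
  fun _ hz => ⟨hz.1.1, hz.2.1⟩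

/-- The Bregman divergence `B(z, x)` of `ψ`. -/
def bregDiv (A : Geometry E) (D : ℝ) (z x : E × (Fin m → ℝ)) : ℝ :=
  psi A D z - psi A D x - pair (gradPsi A D x).val (z - x)

theorem stdSimplex_eq_of_one {p q : Fin 1 → ℝ} (hp : p ∈ stdSimplex ℝ (Fin 1))
    (hq : q ∈ stdSimplex ℝ (Fin 1)) : p = q := by
  have h1 := hp.2
  have h2 := hq.2
  simp at h1 h2
  funext i
  rw [Subsingleton.elim i 0, h1, h2]

theorem feasible_isCompact {A : Geometry E} {D : ℝ} (hA : IsMirrorGeometry A D) (m : ℕ) :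
    IsCompact (feasible A m) := hA.compact.prod (isCompact_stdSimplex ℝ (Fin m))

theorem feasible_convex {A : Geometry E} {D : ℝ} (hA : IsMirrorGeometry A D) (m : ℕ) :
    Convex ℝ (feasible A m) := hA.convex.prod (convex_stdSimplex ℝ (Fin m))

theorem feasible_nonempty {A : Geometry E} {D : ℝ} (hA : IsMirrorGeometry A D) (hm : 1 ≤ m) :
    (feasible A m).Nonempty := by
  have : Nonempty (Fin m) := ⟨⟨0, hm⟩⟩
  obtain ⟨w, hw⟩ := hA.nonempty
  exact ⟨(w, Pi.single ⟨0, hm⟩ 1), hw, single_mem_stdSimplex ℝ _⟩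

theorem continuousOn_psi {A : Geometry E} {D : ℝ} (hA : IsMirrorGeometry A D) (m : ℕ) :
    ContinuousOn (psi A D) (feasible A m) := by
  have h1 : ContinuousOn (fun z : E × (Fin m → ℝ) => A.psi z.1) (feasible A m) :=
    hA.distGen.continuousOn.comp continuousOn_fst fun z hz => hz.1
  have h2 : Continuous fun z : E × (Fin m → ℝ) => ∑ i, z.2 i * Real.log (z.2 i) :=
    continuous_finsetSum _ fun i _ =>
      Real.continuous_mul_log.comp ((continuous_apply i).comp continuous_snd)
  exact (h1.div_const _).add (h2.continuousOn.div_const _)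

theorem log_pos_or_eq_one (hm : 1 ≤ m) : 0 < Real.log m ∨ m = 1 := by
  rcases hm.lt_or_eq with h | h
  · exact Or.inl (Real.log_pos (by exact_mod_cast h))
  · exact Or.inr h.symm

theorem half_sq_le_bregDiv {A : Geometry E} {D : ℝ} (hA : IsMirrorGeometry A D) (hm : 1 ≤ m)
    {x z : E × (Fin m → ℝ)} (hx : x ∈ mirrorDomain A m) (hz : z ∈ feasible A m) :
    znorm D (z - x) ^ 2 / 2 ≤ bregDiv A D z x := by
  have h1 := hA.distGen.half_sq_le hA.compact hx.1 hz.1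
  have h1' := div_le_div_of_nonneg_right h1 (by positivity : 0 ≤ 2 * D ^ 2)
  rw [znorm_sq]
  simp only [bregDiv, psi, pair, gradPsi, smul_apply, smul_eq_mul, Prod.fst_sub, Prod.snd_sub,
    Pi.sub_apply]
  rcases log_pos_or_eq_one hm with h | h
  · have h2 := pinsker hz.2 hx.2.1 hx.2.2
    have h2' := div_le_div_of_nonneg_right h2 (by positivity : 0 ≤ 2 * Real.log m)
    have h3 : ∑ i, (2 * Real.log m)⁻¹ * (Real.log (x.2 i) + 1) * (z.2 i - x.2 i) =
        (∑ i, (Real.log (x.2 i) + 1) * (z.2 i - x.2 i)) / (2 * Real.log m) := by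
      rw [Finset.sum_div]
      exact Finset.sum_congr rfl fun i _ => by field_simp
    rw [h3, inv_mul_eq_div]
    simp only [sub_div] at h1' h2' ⊢
    have e1 : ‖z.1 - x.1‖ ^ 2 / 2 / (2 * D ^ 2) = ‖z.1 - x.1‖ ^ 2 / (2 * D ^ 2) / 2 := by ring
    have e2 : (∑ i, |z.2 i - x.2 i|) ^ 2 / 2 / (2 * Real.log m) =
      (∑ i, |z.2 i - x.2 i|) ^ 2 / (2 * Real.log m) / 2 := by ring
    linarith
  -- For m = 1 the factor 2 ln m is 0, and division by zero gives 0, so the simplex terms disappear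
  -- on both sides.
  · subst h
    simp only [Nat.cast_one, Real.log_one, mul_zero, div_zero, inv_zero, zero_mul,
      Finset.sum_const_zero, add_zero]
    rw [inv_mul_eq_div]
    simp only [sub_div] at h1' ⊢
    have e1 : ‖z.1 - x.1‖ ^ 2 / 2 / (2 * D ^ 2) = ‖z.1 - x.1‖ ^ 2 / (2 * D ^ 2) / 2 := by ring
    linarith

/-- Points that minimise `ψ` plus a linear function over `Z` lie in the mirror domain, and the
objective grows at least like the Bregman divergence. -/
theorem growth_of_isMin {A : Geometry E} {D : ℝ} (hA : IsMirrorGeometry A D) (hD : 0 < D)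
    (hm : 1 ≤ m) (p : (E →L[ℝ] ℝ) × (Fin m → ℝ)) {x : E × (Fin m → ℝ)} (hx : x ∈ feasible A m)
    (hmin : ∀ y ∈ feasible A m, psi A D x - pair p x ≤ psi A D y - pair p y) :
    x ∈ mirrorDomain A m ∧ ∀ y ∈ feasible A m,
      psi A D x - pair p x + bregDiv A D y x ≤ psi A D y - pair p y := by
  have hD2 : 0 < 2 * D ^ 2 := by positivity
  -- The objective separates: w is varied with q fixed, and later q with w fixed. Multiplying by 2D²
  -- turns the first problem into one for ψ_w itself.
  have hw := hA.distGen.optimality hA.compact (p := (2 * D ^ 2) • p.1) hx.1 fun w hw => by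
    have h1 := hmin (w, x.2) ⟨hw, hx.2⟩
    simp only [psi, pair] at h1
    have h2 : A.psi x.1 / (2 * D ^ 2) - p.1 x.1 ≤ A.psi w / (2 * D ^ 2) - p.1 w := by linarith
    have h3 := mul_le_mul_of_nonneg_left h2 hD2.le
    rw [mul_sub, mul_sub, mul_div_cancel₀ _ hD2.ne', mul_div_cancel₀ _ hD2.ne'] at h3
    simpa using h3
  have hq : (∀ i, 0 < x.2 i) ∧ ∀ r ∈ stdSimplex ℝ (Fin m),
      0 ≤ ∑ i, ((2 * Real.log m)⁻¹ * (Real.log (x.2 i) + 1) - p.2 i) * (r i - x.2 i) := by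
    rcases log_pos_or_eq_one hm with h | h
    · refine entropy_optimality (by positivity) p.2 hx.2 fun r hr => ?_
      have h1 := hmin (x.1, r) ⟨hx.1, hr⟩
      simp only [psi, pair] at h1
      linarith
    · subst h
      refine ⟨fun i => ?_, fun r hr => ?_⟩
      · have := hx.2.2
        simp at this
        rw [Subsingleton.elim i 0, this]
        exact one_pos
      · rw [stdSimplex_eq_of_one hr hx.2]
        simp
  refine ⟨⟨hw.1, hx.2, hq.1⟩, fun y hy => ?_⟩
  have h1 := hw.2 y.1 hy.1
  have h2 := hq.2 y.2 hy.2
  have h3 : 0 ≤ pair ((gradPsi A D x).val - p) (y - x) := by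
    have h4 := mul_nonneg (inv_nonneg.2 hD2.le) h1
    have h5 : (2 * D ^ 2)⁻¹ * (A.dpsi x.1 - (2 * D ^ 2) • p.1) (y.1 - x.1) =
        ((2 * D ^ 2)⁻¹ • A.dpsi x.1 - p.1) (y.1 - x.1) := by
      simp only [sub_apply, smul_apply, smul_eq_mul]
      field_simp
    rw [h5] at h4
    exact add_nonneg h4 h2
  rw [pair_sub_left, pair_sub_right p] at h3
  rw [bregDiv]
  linarith

theorem argminOn_spec {α : Type*} [TopologicalSpace α] [Nonempty α] {s : Set α} {f : α → ℝ}
    (hs : IsCompact s) (hne : s.Nonempty) (hf : ContinuousOn f s) :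
    argminOn s f ∈ s ∧ IsMinOn f s (argminOn s f) := by
  obtain ⟨x, hx, hmin⟩ := hs.exists_isMinOn hne hf
  exact Classical.epsilon_spec (p := fun x => x ∈ s ∧ IsMinOn f s x) ⟨x, hx, hmin⟩

/-- The defining property of the prox-mapping. -/
theorem prox_spec {A : Geometry E} {D : ℝ} (hA : IsMirrorGeometry A D) (hD : 0 < D)
    (hm : 1 ≤ m) (η α : ℝ) (g pbar p : (E →L[ℝ] ℝ) × (Fin m → ℝ)) :
    (prox A D η α g pbar p).val ∈ mirrorDomain A m ∧ ∀ y ∈ feasible A m,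
      psi A D (prox A D η α g pbar p).val
          - pair (α • pbar + (1 - α) • p - η • g) (prox A D η α g pbar p).val
        + bregDiv A D y (prox A D η α g pbar p).val
        ≤ psi A D y - pair (α • pbar + (1 - α) • p - η • g) y := by
  -- The weights α and 1 - α sum to 1, so the objective is ψ minus one linear form.
  have hobj : ∀ z : E × (Fin m → ℝ),
      η * pair g z + α * bregman A D pbar z + (1 - α) * bregman A D p z =
        psi A D z - pair (α • pbar + (1 - α) • p - η • g) z := by
    intro z
    rw [pair_sub_left, pair_add_left, pair_smul_left, pair_smul_left, pair_smul_left, bregman,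
      bregman]
    ring
  have hspec := argminOn_spec (f := fun z : E × (Fin m → ℝ) =>
      η * pair g z + α * bregman A D pbar z + (1 - α) * bregman A D p z)
    (feasible_isCompact hA m) (feasible_nonempty hA hm) (by
      simp only [hobj]
      exact (continuousOn_psi hA m).sub (continuous_pair _).continuousOn)
  refine growth_of_isMin hA hD hm _ hspec.1 fun y hy => ?_
  rw [← hobj, ← hobj]
  exact hspec.2 hy

/-- The starting point of ALEG. -/
def initPoint (A : Geometry E) (m : ℕ) (D : ℝ) : E × (Fin m → ℝ) :=
  argminOn (feasible A m) (psi A D)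

theorem initPoint_spec {A : Geometry E} {D : ℝ} (hA : IsMirrorGeometry A D) (hD : 0 < D)
    (hm : 1 ≤ m) :
    initPoint A m D ∈ mirrorDomain A m ∧ ∀ y ∈ feasible A m,
      bregDiv A D y (initPoint A m D) ≤ psi A D y - psi A D (initPoint A m D) := by
  have hspec := argminOn_spec (feasible_isCompact hA m) (feasible_nonempty hA hm)
    (continuousOn_psi hA m)
  have h1 := growth_of_isMin hA hD hm 0 hspec.1 fun y hy => by
    rw [pair_zero_left, pair_zero_left, sub_zero, sub_zero]
    exact hspec.2 hy
  refine ⟨h1.1, fun y hy => ?_⟩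
  have := h1.2 y hy
  rw [pair_zero_left, pair_zero_left] at this
  rw [initPoint]
  linarith

/-- The factors 1/(2D²) and 1/(2 ln m) in ψ are chosen so that each component oscillates by at most
1/2. -/
theorem psi_sub_le_one {A : Geometry E} {D : ℝ} (hA : IsMirrorGeometry A D) (hD : 0 < D)
    {x y : E × (Fin m → ℝ)} (hx : x ∈ feasible A m) (hy : y ∈ feasible A m) :
    psi A D x - psi A D y ≤ 1 := by
  have h1 : A.psi x.1 / (2 * D ^ 2) - A.psi y.1 / (2 * D ^ 2) ≤ 1 / 2 := by
    rw [← sub_div, div_le_iff₀ (by positivity)]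
    have := hA.diameter _ hx.1 _ hy.1
    linarith
  have h2 : (∑ i, x.2 i * Real.log (x.2 i)) / (2 * Real.log m)
      - (∑ i, y.2 i * Real.log (y.2 i)) / (2 * Real.log m) ≤ 1 / 2 := by
    have h3 := entropy_nonpos hx.2
    have h4 := neg_log_le_entropy hy.2
    rcases (Real.log_natCast_nonneg m).eq_or_lt with h | h
    · rw [← h]; norm_num
    · rw [← sub_div, div_le_iff₀ (by positivity)]
      linarith
  simp only [psi]
  linarith

/-- Since B(z, z₀) ≤ 1 on Z, every point is within √2 of z₀, and two points are within 2√2 of each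
other. -/
theorem znorm_sub_sq_le {A : Geometry E} {D : ℝ} (hA : IsMirrorGeometry A D) (hD : 0 < D)
    (hm : 1 ≤ m) {x y : E × (Fin m → ℝ)} (hx : x ∈ feasible A m) (hy : y ∈ feasible A m) :
    znorm D (x - y) ^ 2 ≤ 8 := by
  obtain ⟨h0, h1⟩ := initPoint_spec hA hD hm
  have key : ∀ z ∈ feasible A m, znorm D (z - initPoint A m D) ^ 2 ≤ 2 := fun z hz => by
    have h2 := half_sq_le_bregDiv hA hm h0 hz
    have h3 := h1 z hz
    have h4 := psi_sub_le_one hA hD hz (mirrorDomain_subset A m h0)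
    linarith
  have h5 := key x hx
  have h6 := key y hy
  have h7 := znorm_sub_le hD.le x (initPoint A m D) y
  rw [znorm_sub_comm (initPoint A m D) y] at h7
  have h8 := znorm_nonneg D (x - y)
  nlinarith [sq_nonneg (znorm D (x - initPoint A m D) - znorm D (y - initPoint A m D))]

end Product

/-! ### The constant Λ as the norm of a bilinear form. -/

section LipschitzConstant

theorem lipConst_nonneg {L G D : ℝ} (hD : 0 ≤ D) (m : ℕ) : 0 ≤ lipConst L G D m :=
  mul_nonneg (by positivity) (le_max_of_le_left (Real.sqrt_nonneg _))

theorem lipConst_pos {L G D : ℝ} (hL : 0 < L) (hD : 0 < D) (m : ℕ) : 0 < lipConst L G D m := by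
  have h := Real.log_natCast_nonneg m
  exact mul_pos (by positivity) (lt_max_of_lt_left (Real.sqrt_pos.2 (by positivity)))

theorem le_lipConst_sq_left {L G D : ℝ} (hD : 0 ≤ D) (m : ℕ) :
    4 * D ^ 2 * (2 * D ^ 2 * L ^ 2 + G ^ 2 * Real.log m) ≤ lipConst L G D m ^ 2 := by
  have h := Real.log_natCast_nonneg m
  have h1 : 2 * D * √(2 * D ^ 2 * L ^ 2 + G ^ 2 * Real.log m) ≤ lipConst L G D m :=
    mul_le_mul_of_nonneg_left (le_max_left _ _) (by positivity)
  have h2 := pow_le_pow_left₀ (by positivity) h1 2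
  rw [mul_pow, Real.sq_sqrt (by positivity)] at h2
  linarith

theorem le_lipConst_sq_right {L G D : ℝ} (hG : 0 ≤ G) (hD : 0 ≤ D) (m : ℕ) :
    4 * D ^ 2 * (2 * G ^ 2 * Real.log m) ≤ lipConst L G D m ^ 2 := by
  have h := Real.log_natCast_nonneg m
  have h1 : 2 * D * (G * √(2 * Real.log m)) ≤ lipConst L G D m :=
    mul_le_mul_of_nonneg_left (le_max_right _ _) (by positivity)
  have h2 := pow_le_pow_left₀ (by positivity) h1 2
  rw [mul_pow, mul_pow G, Real.sq_sqrt (by positivity)] at h2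
  linarith

/-- U, V and A, B are the coordinates of two vectors in the units of `znorm`. After Cauchy–Schwarz
in (A, B), the estimate (a + b)² ≤ 2a² + 2b² yields coefficients of U² and V² that are exactly the
two entries of the maximum in `lipConst`, squared. -/
theorem lipConst_bilinear {L G D : ℝ} (hG : 0 ≤ G) (hD : 0 ≤ D) (m : ℕ)
    {U V A B s t : ℝ} (hs : s = √2 * D) (ht : t = √(2 * Real.log m)) :
    L * (s * U) * (s * A) + G * (s * A) * (t * V) + G * (s * U) * (t * B) ≤
      lipConst L G D m * √(U ^ 2 + V ^ 2) * √(A ^ 2 + B ^ 2) := by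
  have hlog := Real.log_natCast_nonneg m
  have hs2 : s ^ 2 = 2 * D ^ 2 := by rw [hs, mul_pow, Real.sq_sqrt zero_le_two]
  have ht2 : t ^ 2 = 2 * Real.log m := by rw [ht, Real.sq_sqrt (by positivity)]
  have hl := lipConst_nonneg (L := L) (G := G) hD m
  have h1 := le_lipConst_sq_left (L := L) (G := G) hD m
  have h2 := le_lipConst_sq_right (L := L) hG hD m
  rw [mul_assoc (lipConst L G D m), ← Real.sqrt_mul (by positivity), ← Real.sqrt_sq hl,
    ← Real.sqrt_mul (by positivity)]
  refine Real.le_sqrt_of_sq_le ?_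
  set X := L * s ^ 2 * U + G * s * t * V with hX
  set Y := G * s * t * U with hY
  have e1 : L * (s * U) * (s * A) + G * (s * A) * (t * V) + G * (s * U) * (t * B) =
      A * X + B * Y := by rw [hX, hY]; ring
  have e2 : (A * X + B * Y) ^ 2 ≤ (X ^ 2 + Y ^ 2) * (A ^ 2 + B ^ 2) := by
    nlinarith [sq_nonneg (A * Y - B * X)]
  have e3 : X ^ 2 ≤ 2 * (L * s ^ 2 * U) ^ 2 + 2 * (G * s * t * V) ^ 2 := by
    nlinarith [sq_nonneg (L * s ^ 2 * U - G * s * t * V)]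
  have e4 : 2 * (L * s ^ 2 * U) ^ 2 + 2 * (G * s * t * V) ^ 2 + Y ^ 2 =
      4 * D ^ 2 * (2 * D ^ 2 * L ^ 2 + G ^ 2 * Real.log m) * U ^ 2
      + 4 * D ^ 2 * (2 * G ^ 2 * Real.log m) * V ^ 2 := by
    have : 2 * (L * s ^ 2 * U) ^ 2 + 2 * (G * s * t * V) ^ 2 + Y ^ 2 =
      2 * L ^ 2 * (s ^ 2) ^ 2 * U ^ 2 + 2 * G ^ 2 * s ^ 2 * t ^ 2 * V ^ 2
        + G ^ 2 * s ^ 2 * t ^ 2 * U ^ 2 := by rw [hY]; ring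
    rw [this, hs2, ht2]; ring
  have e5 : X ^ 2 + Y ^ 2 ≤ lipConst L G D m ^ 2 * (U ^ 2 + V ^ 2) := by
    have := mul_le_mul_of_nonneg_right h1 (sq_nonneg U)
    have := mul_le_mul_of_nonneg_right h2 (sq_nonneg V)
    linarith
  rw [e1, ← mul_assoc (_ ^ 2)]
  exact e2.trans (mul_le_mul_of_nonneg_right e5 (by positivity))

end LipschitzConstant

/-! ### Lipschitz continuity and unbiasedness of the stochastic gradients. -/

section Gradients

variable {E : Type*} [NormedAddCommGroup E] [NormedSpace ℝ E] {m : ℕ} {n : Fin m → ℕ}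
  {A : Geometry E} {P : Problem E m n} {L G D : ℝ}

theorem pair_stochGrad (P : Problem E m n) (ξ : (i : Fin m) → Fin (n i))
    (z d : E × (Fin m → ℝ)) :
    pair (P.stochGrad ξ z).val d =
      ∑ i, z.2 i * P.grad i (ξ i) z.1 d.1 - ∑ i, P.loss i (ξ i) z.1 * d.2 i := by
  simp [pair, Problem.stochGrad, Timed.sum, Timed.vec, Timed.step, Problem.evalGrad,
    Problem.evalLoss, sum_apply, sub_eq_add_neg]

/-- The gradient of the risk of group `i`. -/
def Problem.riskGrad (P : Problem E m n) (i : Fin m) (w : E) : E →L[ℝ] ℝ :=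
  (n i : ℝ)⁻¹ • ∑ j, P.grad i j w

theorem pair_fullGrad (P : Problem E m n) (z d : E × (Fin m → ℝ)) :
    pair (P.fullGrad z).val d =
      ∑ i, z.2 i * P.riskGrad i z.1 d.1 - ∑ i, P.risk i z.1 * d.2 i := by
  simp [pair, Problem.fullGrad, Timed.sum, Timed.vec, Timed.step, Problem.evalRiskGrad,
    Problem.evalRisk, Problem.evalGrad, Problem.evalLoss, sum_apply, sub_eq_add_neg,
    Problem.riskGrad, Problem.risk]

/-- The change of q_i ∇ℓ_i splits into a change of the gradient (smoothness) and a change of the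
weight (bounded gradients); the loss part is Lipschitz. The weights sum to 1, so no factor m
appears. -/
theorem abs_pair_stochGrad_sub_le (h : Assumptions A P L G D) (hG : 0 ≤ G)
    (hD : 0 < D) (hm : 1 ≤ m) (ξ : (i : Fin m) → Fin (n i)) {z z' x y : E × (Fin m → ℝ)}
    (hz : z ∈ feasible A m) (hz' : z' ∈ feasible A m) (hx : x ∈ feasible A m)
    (hy : y ∈ feasible A m) :
    |pair ((P.stochGrad ξ z).val - (P.stochGrad ξ z').val) (x - y)| ≤
      lipConst L G D m * znorm D (z - z') * znorm D (x - y) := by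
  have e : pair ((P.stochGrad ξ z).val - (P.stochGrad ξ z').val) (x - y) =
      ∑ i, (z.2 i * (P.grad i (ξ i) z.1 - P.grad i (ξ i) z'.1) (x.1 - y.1)
        + (z.2 i - z'.2 i) * P.grad i (ξ i) z'.1 (x.1 - y.1)
        - (P.loss i (ξ i) z.1 - P.loss i (ξ i) z'.1) * (x.2 i - y.2 i)) := by
    rw [pair_sub_left, pair_stochGrad, pair_stochGrad, ← Finset.sum_sub_distrib,
      ← Finset.sum_sub_distrib, ← Finset.sum_sub_distrib]
    refine Finset.sum_congr rfl fun i _ => ?_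
    simp only [sub_apply, Prod.fst_sub, Prod.snd_sub, Pi.sub_apply]
    ring
  have b : ∀ i, |z.2 i * (P.grad i (ξ i) z.1 - P.grad i (ξ i) z'.1) (x.1 - y.1)
        + (z.2 i - z'.2 i) * P.grad i (ξ i) z'.1 (x.1 - y.1)
        - (P.loss i (ξ i) z.1 - P.loss i (ξ i) z'.1) * (x.2 i - y.2 i)| ≤
      z.2 i * (L * ‖z.1 - z'.1‖ * ‖x.1 - y.1‖) + |z.2 i - z'.2 i| * (G * ‖x.1 - y.1‖)
        + (G * ‖z.1 - z'.1‖) * |x.2 i - y.2 i| := by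
    intro i
    have h1 : |(P.grad i (ξ i) z.1 - P.grad i (ξ i) z'.1) (x.1 - y.1)| ≤
        L * ‖z.1 - z'.1‖ * ‖x.1 - y.1‖ := by
      rw [← Real.norm_eq_abs]
      exact ((P.grad i (ξ i) z.1 - P.grad i (ξ i) z'.1).le_opNorm _).trans
        (mul_le_mul_of_nonneg_right (h.smooth i (ξ i) _ hz.1 _ hz'.1) (norm_nonneg _))
    have h2 : |P.grad i (ξ i) z'.1 (x.1 - y.1)| ≤ G * ‖x.1 - y.1‖ :=
      abs_fderiv_sub_le h.convex (h.hasGrad i (ξ i)) (h.smooth i (ξ i)) (h.lipschitz i (ξ i))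
        hz'.1 hx.1 hy.1
    have h3 := h.lipschitz i (ξ i) _ hz.1 _ hz'.1
    refine (abs_sub _ _).trans (add_le_add ((abs_add_le _ _).trans (add_le_add ?_ ?_)) ?_)
    · rw [abs_mul, abs_of_nonneg (hz.2.1 i)]
      exact mul_le_mul_of_nonneg_left h1 (hz.2.1 i)
    · rw [abs_mul]
      exact mul_le_mul_of_nonneg_left h2 (abs_nonneg _)
    · rw [abs_mul]
      exact mul_le_mul_of_nonneg_right h3 (abs_nonneg _)
  rw [e]
  refine (Finset.abs_sum_le_sum_abs _ _).trans ((Finset.sum_le_sum fun i _ => b i).trans ?_)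
  rw [Finset.sum_add_distrib, Finset.sum_add_distrib, ← Finset.sum_mul, ← Finset.sum_mul,
    ← Finset.mul_sum, hz.2.2, one_mul]
  have hs : (√2 * D) ≠ 0 := by positivity
  -- For m = 1 the scale √(2 ln m) is 0 and cannot be cancelled, but then both points of the simplex
  -- coincide.
  have ht : ∀ p ∈ stdSimplex ℝ (Fin m), ∀ q ∈ stdSimplex ℝ (Fin m), ∑ i, |p i - q i| =
      √(2 * Real.log m) * ((∑ i, |p i - q i|) / √(2 * Real.log m)) := by
    intro p hp q hq
    rcases log_pos_or_eq_one hm with h | h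
    · rw [mul_div_cancel₀]; positivity
    · subst h
      rw [stdSimplex_eq_of_one hp hq]; simp
  have key := lipConst_bilinear (L := L) hG hD.le m (U := ‖z.1 - z'.1‖ / (√2 * D))
    (V := (∑ i, |z.2 i - z'.2 i|) / √(2 * Real.log m)) (A := ‖x.1 - y.1‖ / (√2 * D))
    (B := (∑ i, |x.2 i - y.2 i|) / √(2 * Real.log m)) rfl rfl
  rw [mul_div_cancel₀ _ hs, mul_div_cancel₀ _ hs, ← ht _ hz.2 _ hz'.2, ← ht _ hx.2 _ hy.2] at key
  refine le_trans (le_of_eq ?_) key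
  ring

theorem hasFDerivWithinAt_risk (h : Assumptions A P L G D) (i : Fin m) {w : E} (hw : w ∈ A.dom) :
    HasFDerivWithinAt (P.risk i) (P.riskGrad i w) A.dom w := by
  have h1 : HasFDerivWithinAt (fun w => ∑ j, P.loss i j w) (∑ j, P.grad i j w) A.dom w :=
    HasFDerivWithinAt.fun_sum fun j _ => h.hasGrad i j w hw
  exact h1.const_mul _

/-- The objective `F(w, q) = ∑ q_i R_i(w)`. -/
def Problem.objective (P : Problem E m n) (w : E) (q : Fin m → ℝ) : ℝ := ∑ i, q i * P.risk i w

/-- The linearised gap dominates the gap of the convex-concave objective. -/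
theorem objective_sub_le_pair (h : Assumptions A P L G D) {x z : E × (Fin m → ℝ)}
    (hx : x ∈ feasible A m) (hz : z ∈ feasible A m) :
    P.objective x.1 z.2 - P.objective z.1 x.2 ≤ pair (P.fullGrad x).val (x - z) := by
  rw [pair_fullGrad, Problem.objective, Problem.objective, ← Finset.sum_sub_distrib,
    ← Finset.sum_sub_distrib]
  refine Finset.sum_le_sum fun i _ => ?_
  have h1 := convexOn_gradient_le (h.convex_risk i) hx.1 hz.1 (hasFDerivWithinAt_risk h i hx.1)
  have h2 := mul_le_mul_of_nonneg_left h1 (hx.2.1 i)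
  simp only [Prod.fst_sub, Prod.snd_sub, Pi.sub_apply, map_sub] at h2 ⊢
  linarith

theorem objective_convex (h : Assumptions A P L G D) {q : Fin m → ℝ}
    (hq : q ∈ stdSimplex ℝ (Fin m)) : ConvexOn ℝ A.dom fun w => P.objective w q := by
  refine ⟨h.convex, fun x hx y hy a b ha hb hab => ?_⟩
  simp only [Problem.objective, smul_eq_mul, Finset.mul_sum, ← Finset.sum_add_distrib]
  refine Finset.sum_le_sum fun i _ => ?_
  have := mul_le_mul_of_nonneg_left ((h.convex_risk i).2 hx hy ha hb hab) (hq.1 i)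
  simp only [smul_eq_mul] at this
  linarith

theorem objective_affine (P : Problem E m n) (w : E) (p q : Fin m → ℝ) (a b : ℝ) :
    P.objective w (a • p + b • q) = a * P.objective w p + b * P.objective w q := by
  simp only [Problem.objective, Pi.add_apply, Pi.smul_apply, smul_eq_mul, Finset.mul_sum,
    ← Finset.sum_add_distrib]
  exact Finset.sum_congr rfl fun i _ => by ring

variable [∀ i, NeZero (n i)]

/-- The i-th coordinate of a uniform draw from the product is uniform: the product splits as
coordinate i times the rest. -/
theorem card_inv_mul_sum_apply (i : Fin m) (f : Fin (n i) → ℝ) :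
    (Fintype.card ((i : Fin m) → Fin (n i)) : ℝ)⁻¹ *
      ∑ ξ : (i : Fin m) → Fin (n i), f (ξ i) = (n i : ℝ)⁻¹ * ∑ j, f j := by
  have h1 : ∑ ξ : (i : Fin m) → Fin (n i), f (ξ i) =
      Fintype.card ((k : { k // k ≠ i }) → Fin (n k)) * ∑ j, f j := by
    rw [Fintype.sum_equiv (Equiv.piSplitAt i fun k => Fin (n k)) (fun ξ => f (ξ i))
      (fun p => f p.1) fun ξ => rfl, Fintype.sum_prod_type, Finset.mul_sum]
    simp
  have h2 : Fintype.card ((i : Fin m) → Fin (n i)) =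
      n i * Fintype.card ((k : { k // k ≠ i }) → Fin (n k)) := by
    rw [Fintype.card_congr (Equiv.piSplitAt i fun k => Fin (n k)), Fintype.card_prod,
      Fintype.card_fin]
  have h3 : (Fintype.card ((k : { k // k ≠ i }) → Fin (n k)) : ℝ) ≠ 0 := by
    exact_mod_cast Fintype.card_ne_zero
  have h4 : (n i : ℝ) ≠ 0 := by exact_mod_cast NeZero.ne (n i)
  rw [h1, h2]
  push_cast
  field_simp

/-- The stochastic gradient is unbiased. -/
theorem card_inv_mul_sum_pair_stochGrad (P : Problem E m n) (z d : E × (Fin m → ℝ)) :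
    (Fintype.card ((i : Fin m) → Fin (n i)) : ℝ)⁻¹ *
      ∑ ξ : (i : Fin m) → Fin (n i), pair (P.stochGrad ξ z).val d =
      pair (P.fullGrad z).val d := by
  simp only [pair_stochGrad, pair_fullGrad]
  have hc : ∀ f : ((i : Fin m) → Fin (n i)) → Fin m → ℝ, ∑ ξ, ∑ i, f ξ i = ∑ i, ∑ ξ, f ξ i :=
    fun f => Finset.sum_comm
  rw [Finset.sum_sub_distrib, mul_sub, hc, hc, Finset.mul_sum, Finset.mul_sum]
  congr 1
  · refine Finset.sum_congr rfl fun i _ => ?_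
    rw [card_inv_mul_sum_apply i fun j => z.2 i * P.grad i j z.1 d.1, ← Finset.mul_sum,
      Problem.riskGrad, smul_apply, sum_apply, smul_eq_mul]
    ring
  · refine Finset.sum_congr rfl fun i _ => ?_
    rw [card_inv_mul_sum_apply i fun j => P.loss i j z.1 * d.2 i, ← Finset.sum_mul,
      Problem.risk]
    ring

theorem abs_card_inv_mul_sum_le {ι : Type*} [Fintype ι] [Nonempty ι] {f : ι → ℝ} {b : ℝ}
    (hf : ∀ i, |f i| ≤ b) : |(Fintype.card ι : ℝ)⁻¹ * ∑ i, f i| ≤ b := by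
  have hc : (0 : ℝ) < Fintype.card ι := by exact_mod_cast Fintype.card_pos
  rw [abs_mul, abs_inv, abs_of_pos hc, inv_mul_le_iff₀ hc]
  refine (Finset.abs_sum_le_sum_abs _ _).trans ((Finset.sum_le_sum fun i _ => hf i).trans ?_)
  simp

theorem abs_pair_fullGrad_sub_le (h : Assumptions A P L G D) (hG : 0 ≤ G)
    (hD : 0 < D) (hm : 1 ≤ m) {z z' x y : E × (Fin m → ℝ)}
    (hz : z ∈ feasible A m) (hz' : z' ∈ feasible A m) (hx : x ∈ feasible A m)
    (hy : y ∈ feasible A m) :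
    |pair ((P.fullGrad z).val - (P.fullGrad z').val) (x - y)| ≤
      lipConst L G D m * znorm D (z - z') * znorm D (x - y) := by
  rw [pair_sub_left, ← card_inv_mul_sum_pair_stochGrad, ← card_inv_mul_sum_pair_stochGrad,
    ← mul_sub, ← Finset.sum_sub_distrib]
  refine abs_card_inv_mul_sum_le fun ξ => ?_
  rw [← pair_sub_left]
  exact abs_pair_stochGrad_sub_le h hG hD hm ξ hz hz' hx hy

end Gradients

/-! ### Expectations, concentration and random loops for discrete laws. -/

section Probability

variable {α β σ τ ι : Type*}

/-- Expectation of a nonnegative function under a discrete law. -/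
def expect (p : PMF α) (f : α → ℝ≥0∞) : ℝ≥0∞ := ∑' x, p x * f x

theorem expect_pure (a : α) (f : α → ℝ≥0∞) : expect (PMF.pure a) f = f a := by
  rw [expect, tsum_eq_single a fun b hb => by simp [PMF.pure_apply, hb]]
  simp

theorem expect_bind (p : PMF α) (g : α → PMF β) (f : β → ℝ≥0∞) :
    expect (p.bind g) f = expect p fun a => expect (g a) f := by
  simp only [expect, PMF.bind_apply, ← ENNReal.tsum_mul_right, ← ENNReal.tsum_mul_left]
  rw [ENNReal.tsum_comm]
  simp only [mul_assoc]

theorem expect_map (p : PMF α) (g : α → β) (f : β → ℝ≥0∞) :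
    expect (p.map g) f = expect p fun a => f (g a) := by
  rw [← PMF.bind_pure_comp, expect_bind]
  simp only [Function.comp_apply, expect_pure]

theorem expect_mono {p : PMF α} {f g : α → ℝ≥0∞} (h : ∀ x ∈ p.support, f x ≤ g x) :
    expect p f ≤ expect p g := by
  refine ENNReal.tsum_le_tsum fun x => ?_
  by_cases hx : x ∈ p.support
  · exact mul_le_mul_right (h x hx) _
  · rw [PMF.apply_eq_zero_iff p x |>.2 hx]; simp

theorem toOuterMeasure_le_one (p : PMF α) (s : Set α) : p.toOuterMeasure s ≤ 1 := by
  rw [PMF.toOuterMeasure_apply, ← p.tsum_coe]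
  exact ENNReal.tsum_le_tsum fun x => Set.indicator_le_self _ _ _

theorem one_le_toOuterMeasure_add_compl (p : PMF α) (s : Set α) :
    1 ≤ p.toOuterMeasure s + p.toOuterMeasure sᶜ := by
  have h : p.toOuterMeasure univ = 1 :=
    (PMF.toOuterMeasure_apply_eq_one_iff p _).2 (subset_univ _)
  rw [← h, ← union_compl_self s]
  exact MeasureTheory.measure_union_le _ _

/-- Markov's inequality. -/
theorem mul_toOuterMeasure_le_expect (p : PMF α) {f : α → ℝ≥0∞} {s : Set α} {c : ℝ≥0∞}
    (h : ∀ x ∈ p.support, x ∈ s → c ≤ f x) : c * p.toOuterMeasure s ≤ expect p f := by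
  rw [PMF.toOuterMeasure_apply, ← ENNReal.tsum_mul_left]
  refine ENNReal.tsum_le_tsum fun x => ?_
  by_cases hs : x ∈ s
  · by_cases hx : x ∈ p.support
    · rw [indicator_of_mem hs, mul_comm]
      exact mul_le_mul_right (h x hx hs) _
    · rw [indicator_of_mem hs, PMF.apply_eq_zero_iff p x |>.2 hx]; simp
  · rw [indicator_of_notMem hs]; simp

/-- Failure probabilities of two consecutive random computations add up. -/
theorem toOuterMeasure_bind_le {p : PMF α} {g : α → PMF β} {s : Set α} {t : Set β} {a b : ℝ≥0∞}
    (ha : p.toOuterMeasure sᶜ ≤ a) (hb : ∀ x ∈ s, (g x).toOuterMeasure t ≤ b) :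
    (p.bind g).toOuterMeasure t ≤ a + b := by
  rw [PMF.toOuterMeasure_bind_apply]
  have h1 : ∀ x, p x * (g x).toOuterMeasure t ≤ sᶜ.indicator p x + p x * b := by
    intro x
    by_cases hx : x ∈ s
    · rw [indicator_of_notMem (by simpa using hx), zero_add]
      exact mul_le_mul_right (hb x hx) _
    · rw [indicator_of_mem (by simpa using hx)]
      exact (mul_le_of_le_one_right' (toOuterMeasure_le_one _ _)).trans le_self_add
  refine (ENNReal.tsum_le_tsum h1).trans ?_
  rw [ENNReal.tsum_add, ← PMF.toOuterMeasure_apply, ENNReal.tsum_mul_right, p.tsum_coe, one_mul]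
  exact add_le_add_left ha _

theorem expect_uniformOfFintype [Fintype ι] [Nonempty ι] {f : ι → ℝ} (hf : ∀ i, 0 ≤ f i) :
    expect (PMF.uniformOfFintype ι) (fun i => ENNReal.ofReal (f i)) =
      ENNReal.ofReal ((Fintype.card ι : ℝ)⁻¹ * ∑ i, f i) := by
  have hc : (0 : ℝ) < Fintype.card ι := by exact_mod_cast Fintype.card_pos
  rw [expect, tsum_fintype, ENNReal.ofReal_mul (by positivity), ENNReal.ofReal_inv_of_pos hc,
    ENNReal.ofReal_sum_of_nonneg fun i _ => hf i, Finset.mul_sum]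
  simp [PMF.uniformOfFintype_apply]

/-- Hoeffding's lemma for the uniform distribution on a finite set. -/
theorem card_inv_mul_sum_exp_le [Fintype ι] [Nonempty ι] {f : ι → ℝ} {b : ℝ} (hb : 0 ≤ b)
    (hf : ∀ i, |f i| ≤ b) (hsum : ∑ i, f i = 0) :
    (Fintype.card ι : ℝ)⁻¹ * ∑ i, Real.exp (f i) ≤ Real.exp (b ^ 2 / 2) := by
  have hc : (0 : ℝ) < Fintype.card ι := by exact_mod_cast Fintype.card_pos
  rw [inv_mul_le_iff₀ hc]
  rcases hb.eq_or_lt with h | h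
  · subst h
    have : ∀ i, f i = 0 := fun i => abs_nonpos_iff.1 (hf i)
    simp [this]
  -- On [-b, b] the exponential lies below its chord. The linear part of the chord averages out,
  -- leaving cosh b ≤ exp(b²/2).
  · have h1 : ∀ i, Real.exp (f i) ≤ Real.cosh b + f i * (Real.sinh b / b) := by
      intro i
      have h2 := abs_le.1 (hf i)
      have h3 := convexOn_exp.2 (mem_univ b) (mem_univ (-b))
        (div_nonneg (by linarith) (by linarith) : 0 ≤ (b + f i) / (2 * b))
        (div_nonneg (by linarith) (by linarith) : 0 ≤ (b - f i) / (2 * b))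
        (by field_simp; ring)
      have h4 : (b + f i) / (2 * b) * b + (b - f i) / (2 * b) * -b = f i := by
        field_simp; ring
      simp only [smul_eq_mul, h4] at h3
      refine h3.trans (le_of_eq ?_)
      rw [Real.cosh_eq, Real.sinh_eq]
      field_simp
      ring
    refine (Finset.sum_le_sum fun i _ => h1 i).trans ?_
    rw [Finset.sum_add_distrib, ← Finset.sum_mul, hsum]
    simp only [Finset.sum_const, Finset.card_univ, nsmul_eq_mul, zero_mul, add_zero]
    exact mul_le_mul_of_nonneg_left (Real.cosh_le_exp_half_sq b) hc.le

/-- This allows ghost variables in the state: projecting them away recovers the law of the original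
loop. -/
theorem forEach_map {body' : ι → τ → PMF τ} {body : ι → σ → PMF σ} {π : τ → σ}
    (h : ∀ i x, (body' i x).map π = body i (π x)) (l : List ι) (x : τ) :
    (forEach body' l x).map π = forEach body l (π x) := by
  induction l generalizing x with
  | nil => simp [forEach, PMF.pure_map]
  | cons i l ih =>
    simp only [forEach, PMF.map_bind, ih]
    rw [← h, PMF.bind_map]
    rfl

theorem forEach_invariant {body : ℕ → σ → PMF σ} {Inv : ℕ → σ → Prop} {k : ℕ} :
    ∀ {s : ℕ}, (∀ i, s ≤ i → i < s + k → ∀ x, Inv i x → ∀ y ∈ (body i x).support, Inv (i + 1) y) →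
    ∀ x, Inv s x → ∀ y ∈ (forEach body (List.range' s k) x).support, Inv (s + k) y := by
  induction k with
  | zero =>
    intro s _ x hx y hy
    simp only [List.range'_zero, forEach, PMF.support_pure, mem_singleton_iff] at hy
    rw [hy]
    exact hx
  | succ k ih =>
    intro s h x hx y hy
    simp only [List.range'_succ, forEach, PMF.mem_support_bind_iff] at hy
    obtain ⟨z, hz, hy⟩ := hy
    have := ih (s := s + 1) (fun i h1 h2 => h i (by omega) (by omega)) z
      (h s le_rfl (by omega) x hx z hz) y hy
    rwa [show s + (k + 1) = s + 1 + k by omega]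

theorem forEach_range_invariant {body : ℕ → σ → PMF σ} {Inv : ℕ → σ → Prop} {k : ℕ}
    (h : ∀ i < k, ∀ x, Inv i x → ∀ y ∈ (body i x).support, Inv (i + 1) y) {x : σ} (hx : Inv 0 x) :
    ∀ y ∈ (forEach body (List.range k) x).support, Inv k y := by
  have := forEach_invariant (body := body) (Inv := Inv) (k := k) (s := 0)
    (fun i _ h2 => h i (by omega)) x hx
  rwa [← List.range_eq_range', zero_add] at this

theorem expect_forEach_le {body : ℕ → σ → PMF σ} {Inv : ℕ → σ → Prop} {f : σ → ℝ≥0∞} {k : ℕ} :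
    ∀ {s : ℕ}, (∀ i, s ≤ i → i < s + k → ∀ x, Inv i x →
      (∀ y ∈ (body i x).support, Inv (i + 1) y) ∧ expect (body i x) f ≤ f x) →
    ∀ x, Inv s x → expect (forEach body (List.range' s k) x) f ≤ f x := by
  induction k with
  | zero =>
    intro s _ x hx
    simp [List.range'_zero, forEach, expect_pure]
  | succ k ih =>
    intro s h x hx
    simp only [List.range'_succ, forEach, expect_bind]
    have h0 := h s le_rfl (by omega) x hx
    refine le_trans (expect_mono fun z hz => ?_) h0.2
    exact ih (s := s + 1) (fun i h1 h2 => h i (by omega) (by omega)) z (h0.1 z hz)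

/-- A supermartingale property along a random loop, under an invariant. -/
theorem expect_forEach_range_le {body : ℕ → σ → PMF σ} {Inv : ℕ → σ → Prop} {f : σ → ℝ≥0∞}
    {k : ℕ} (h : ∀ i < k, ∀ x, Inv i x →
      (∀ y ∈ (body i x).support, Inv (i + 1) y) ∧ expect (body i x) f ≤ f x)
    {x : σ} (hx : Inv 0 x) : expect (forEach body (List.range k) x) f ≤ f x := by
  have := expect_forEach_le (body := body) (Inv := Inv) (f := f) (k := k) (s := 0)
    (fun i _ h2 => h i (by omega)) x hx
  rwa [← List.range_eq_range'] at this

end Probability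

/-! ### The mirror prox step and the dual potential. -/

section MirrorProx

variable {E : Type*} [NormedAddCommGroup E] [NormedSpace ℝ E] {m : ℕ} {n : Fin m → ℕ}
  {A : Geometry E} {P : Problem E m n} {L G D : ℝ}

theorem bregDiv_nonneg (hA : IsMirrorGeometry A D) (hm : 1 ≤ m) {x z : E × (Fin m → ℝ)}
    (hx : x ∈ mirrorDomain A m) (hz : z ∈ feasible A m) : 0 ≤ bregDiv A D z x :=
  le_trans (by positivity) (half_sq_le_bregDiv hA hm hx hz)

/-- One step of the variance-reduced mirror prox method, before the noise is taken into account. -/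
theorem mirrorProx_step (hA : IsMirrorGeometry A D) (hD : 0 < D) (hm : 1 ≤ m)
    {cur zs half next : E × (Fin m → ℝ)} {pbar gs est : (E →L[ℝ] ℝ) × (Fin m → ℝ)}
    {cbar η α Λ : ℝ} (hη : 0 ≤ η) (hα : 0 ≤ α) (hα1 : α ≤ 1)
    (hcur : cur ∈ mirrorDomain A m)
    (hbar : ∀ z ∈ feasible A m, znorm D (z - zs) ^ 2 / 2 ≤ psi A D z - pair pbar z + cbar)
    (hhalf : half = (prox A D η α gs pbar (gradPsi A D cur).val).val)
    (hnext : next = (prox A D η α est pbar (gradPsi A D cur).val).val)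
    (hlip : ∀ x ∈ feasible A m, ∀ y ∈ feasible A m,
      |pair (est - gs) (x - y)| ≤ Λ * znorm D (half - zs) * znorm D (x - y))
    {z : E × (Fin m → ℝ)} (hz : z ∈ feasible A m) :
    η * pair est (half - z) ≤ α * (psi A D z - pair pbar z + cbar) + (1 - α) * bregDiv A D z cur
      - bregDiv A D z next - α / 2 * znorm D (half - zs) ^ 2
      + η ^ 2 * Λ ^ 2 / 2 * znorm D (half - zs) ^ 2 := by
  obtain ⟨hh, hhg⟩ := prox_spec hA hD hm η α gs pbar (gradPsi A D cur).val
  obtain ⟨hn, hng⟩ := prox_spec hA hD hm η α est pbar (gradPsi A D cur).val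
  rw [← hhalf] at hh hhg
  rw [← hnext] at hn hng
  have hhf := mirrorDomain_subset A m hh
  have hnf := mirrorDomain_subset A m hn
  -- Optimality of `next` is tested at z and that of `half` at `next`; what is left is `est - gs`
  -- paired with `half - next`.
  have h1 := hng z hz
  have h2 := hhg next hnf
  have h3 := half_sq_le_bregDiv hA hm hh hnf
  have h4 := mul_nonneg (sub_nonneg.2 hα1) (bregDiv_nonneg hA hm hcur hhf)
  have h5 := mul_le_mul_of_nonneg_left (hbar half hhf) hα
  have h6 := mul_le_mul_of_nonneg_left ((le_abs_self _).trans (hlip half hhf next hnf)) hη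
  rw [znorm_sub_comm] at h3
  -- Young's inequality: the square of ‖half - next‖ is paid by the strong convexity in `h3`, while
  -- `h5` supplies the negative term -α/2 ‖half - zs‖².
  have h7 : η * (Λ * znorm D (half - zs) * znorm D (half - next)) ≤
      η ^ 2 * Λ ^ 2 / 2 * znorm D (half - zs) ^ 2 + znorm D (half - next) ^ 2 / 2 := by
    nlinarith [sq_nonneg (η * Λ * znorm D (half - zs) - znorm D (half - next))]
  have e1 : bregDiv A D z cur = psi A D z - psi A D cur - pair (gradPsi A D cur).val (z - cur) :=
    rfl
  have e2 : bregDiv A D half cur =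
    psi A D half - psi A D cur - pair (gradPsi A D cur).val (half - cur) := rfl
  rw [e1]
  rw [e2] at h4
  simp only [pair_sub_left, pair_sub_right, pair_add_left, pair_smul_left] at *
  linarith

theorem exists_convex_combination {S : Set (E × (Fin m → ℝ))} (hS : Convex ℝ S) {r s : ℝ}
    (hr : 0 ≤ r) (hs : 0 < s) {x y : E × (Fin m → ℝ)} (hx : x ∈ S) (hy : y ∈ S) :
    (r / (r + s)) • x + (s / (r + s)) • y ∈ S ∧
      r • x + s • y = (r + s) • ((r / (r + s)) • x + (s / (r + s)) • y) := by
  have h0 : 0 < r + s := by linarith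
  refine ⟨hS hx hy (by positivity) (by positivity) (by field_simp), ?_⟩
  rw [smul_add, smul_smul, smul_smul, mul_div_cancel₀ _ h0.ne', mul_div_cancel₀ _ h0.ne']

/-- The gap function of the convex-concave objective. -/
def Problem.gap (P : Problem E m n) (x z : E × (Fin m → ℝ)) : ℝ :=
  P.objective x.1 z.2 - P.objective z.1 x.2

/-- The gap is convex in its first argument, since the objective is convex in w and affine in q.
Weight r = 0 is allowed because the running output starts with rate sum 0. -/
theorem exists_average (h : Assumptions A P L G D) {r s : ℝ} (hr : 0 ≤ r) (hs : 0 < s)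
    {x y : E × (Fin m → ℝ)} (hx : x ∈ feasible A m) (hy : y ∈ feasible A m) :
    ∃ u ∈ feasible A m, r • x + s • y = (r + s) • u ∧
      ∀ z ∈ feasible A m, (r + s) * P.gap u z ≤ r * P.gap x z + s * P.gap y z := by
  have h0 : 0 < r + s := by linarith
  obtain ⟨h1, h2⟩ := exists_convex_combination (feasible_convex h.geometry m) hr hs hx hy
  refine ⟨_, h1, h2, fun z hz => ?_⟩
  have h3 := (objective_convex h hz.2).2 hx.1 hy.1
    (by positivity : 0 ≤ r / (r + s)) (by positivity : 0 ≤ s / (r + s)) (by field_simp)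
  have h4 := objective_affine P z.1 x.2 y.2 (r / (r + s)) (s / (r + s))
  simp only [Problem.gap, Prod.fst_add, Prod.snd_add, Prod.smul_fst, Prod.smul_snd]
  rw [h4]
  simp only [smul_eq_mul] at h3
  have h5 := mul_le_mul_of_nonneg_left h3 h0.le
  have e : ∀ a b : ℝ, (r + s) * (r / (r + s) * a + s / (r + s) * b) = r * a + s * b := by
    intro a b
    field_simp
  rw [e] at h5
  rw [mul_sub, e]
  linarith

/-- The point at which the dual potential is attained. -/
def dualPoint (A : Geometry E) (D : ℝ) (v : (E →L[ℝ] ℝ) × (Fin m → ℝ)) : E × (Fin m → ℝ) :=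
  argminOn (feasible A m) fun z => psi A D z - pair ((1 / 2 : ℝ) • v) z

/-- The conjugate of `2 (ψ - min ψ)` on `Z`. -/
def dualPotential (A : Geometry E) (D : ℝ) (v : (E →L[ℝ] ℝ) × (Fin m → ℝ)) : ℝ :=
  pair v (dualPoint A D v) - 2 * (psi A D (dualPoint A D v) - psi A D (initPoint A m D))

/-- The maximised function is, up to a constant, -2 (ψ - ⟨v/2, ·⟩), so the factor 2 turns the growth
B ≥ ½‖·‖² into a full square. Without the square this is the Fenchel–Young inequality. -/
theorem dualPoint_spec (hA : IsMirrorGeometry A D) (hD : 0 < D) (hm : 1 ≤ m)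
    (v : (E →L[ℝ] ℝ) × (Fin m → ℝ)) :
    dualPoint A D v ∈ feasible A m ∧ ∀ z ∈ feasible A m,
      pair v z - 2 * (psi A D z - psi A D (initPoint A m D)) + znorm D (z - dualPoint A D v) ^ 2 ≤
        dualPotential A D v := by
  have hs := argminOn_spec (f := fun z : E × (Fin m → ℝ) => psi A D z - pair ((1 / 2 : ℝ) • v) z)
    (feasible_isCompact hA m) (feasible_nonempty hA hm)
    ((continuousOn_psi hA m).sub (continuous_pair _).continuousOn)
  refine ⟨hs.1, fun z hz => ?_⟩
  obtain ⟨h1, h2⟩ := growth_of_isMin hA hD hm _ hs.1 fun y hy => hs.2 hy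
  have h3 := h2 z hz
  have h4 := half_sq_le_bregDiv hA hm h1 hz
  rw [pair_smul_left, pair_smul_left] at h3
  rw [dualPotential]
  rw [dualPoint]
  linarith

theorem dualPotential_zero_le (hA : IsMirrorGeometry A D) (hD : 0 < D) (hm : 1 ≤ m) :
    dualPotential A D (0 : (E →L[ℝ] ℝ) × (Fin m → ℝ)) ≤ 0 := by
  have h1 := (dualPoint_spec hA hD hm (0 : (E →L[ℝ] ℝ) × (Fin m → ℝ))).1
  obtain ⟨h2, h3⟩ := initPoint_spec hA hD hm
  have h4 := (bregDiv_nonneg hA hm h2 h1).trans (h3 _ h1)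
  rw [dualPotential, pair_zero_left]
  linarith

/-- The conjugate of a strongly convex function is smooth: the growth around the old maximiser
absorbs the displacement of the new one, by βt ≤ β²/4 + t². -/
theorem dualPotential_add_le (hA : IsMirrorGeometry A D) (hD : 0 < D) (hm : 1 ≤ m)
    (v u : (E →L[ℝ] ℝ) × (Fin m → ℝ)) {β : ℝ}
    (hu : ∀ x ∈ feasible A m, ∀ y ∈ feasible A m, |pair u (x - y)| ≤ β * znorm D (x - y)) :
    dualPotential A D (v + u) ≤ dualPotential A D v + pair u (dualPoint A D v) + β ^ 2 / 4 := by
  obtain ⟨h1, h2⟩ := dualPoint_spec hA hD hm v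
  have h3 := (dualPoint_spec hA hD hm (v + u)).1
  have h4 := h2 _ h3
  have h5 := (le_abs_self _).trans (hu _ h3 _ h1)
  have h6 : β * znorm D (dualPoint A D (v + u) - dualPoint A D v) ≤
      β ^ 2 / 4 + znorm D (dualPoint A D (v + u) - dualPoint A D v) ^ 2 := by
    nlinarith [sq_nonneg (β / 2 - znorm D (dualPoint A D (v + u) - dualPoint A D v))]
  have e : dualPotential A D (v + u) = pair v (dualPoint A D (v + u))
    + pair u (dualPoint A D (v + u))
    - 2 * (psi A D (dualPoint A D (v + u)) - psi A D (initPoint A m D)) := by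
    rw [dualPotential, pair_add_left]
  rw [pair_sub_right] at h5
  rw [e]
  linarith

end MirrorProx

/-! ### The pathwise regret invariant of ALEG. -/

section Trace

variable {E : Type*} [NormedAddCommGroup E] [NormedSpace ℝ E] {m : ℕ} {n : Fin m → ℕ}
  {A : Geometry E} {P : Problem E m n} {L G D : ℝ}

/-- A state of ALEG together with the accumulated gradient noise `noise = -∑ η Δ` and the sum `acc`
of the terms `η ⟨Δ, z_{k+1/2}⟩ - (2/5) α ‖z_{k+1/2} - zˢ‖²`, where `Δ` is the error of the gradient
estimator. -/
structure TracedState (E : Type*) [NormedAddCommGroup E] [NormedSpace ℝ E] (m : ℕ) where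
  st : AlegState E m
  acc : ℝ
  noise : (E →L[ℝ] ℝ) × (Fin m → ℝ)

/-- The extrapolated point `z_{k+1/2}`. -/
def halfPoint (A : Geometry E) (D : ℝ) (pbar gs : (E →L[ℝ] ℝ) × (Fin m → ℝ)) (η α : ℝ)
    (st : AlegState E m) : E × (Fin m → ℝ) :=
  (prox A D η α gs pbar (gradPsi A D st.cur).val).val

/-- The error of the variance-reduced gradient estimator. -/
def estimatorError (P : Problem E m n) (zs half : E × (Fin m → ℝ))
    (gs : (E →L[ℝ] ℝ) × (Fin m → ℝ)) (ξ : (i : Fin m) → Fin (n i)) :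
    (E →L[ℝ] ℝ) × (Fin m → ℝ) :=
  (P.fullGrad half).val - ((P.stochGrad ξ half).val - (P.stochGrad ξ zs).val + gs)

/-- The algorithm's own state is updated by `alegUpdate`; the other fields are ghosts. The
coefficient 2/5 is 1/2 - 1/10: from -α/2 in `mirrorProx_step`, the term η²Λ²/2 ≤ α/10 is deducted.
-/
def tracedUpdate (A : Geometry E) (P : Problem E m n) (D : ℝ) (zs : E × (Fin m → ℝ))
    (pbar gs : (E →L[ℝ] ℝ) × (Fin m → ℝ)) (η α : ℝ) (x : TracedState E m)
    (ξ : (i : Fin m) → Fin (n i)) : TracedState E m where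
  st := alegUpdate A P D zs pbar gs η α x.st ξ
  acc := x.acc
    + η * pair (estimatorError P zs (halfPoint A D pbar gs η α x.st) gs ξ)
        (halfPoint A D pbar gs η α x.st)
    - 2 / 5 * α * znorm D (halfPoint A D pbar gs η α x.st - zs) ^ 2
  noise := x.noise - η • estimatorError P zs (halfPoint A D pbar gs η α x.st) gs ξ

/-- The exponent of the supermartingale. -/
def potential (A : Geometry E) (D : ℝ) (x : TracedState E m) : ℝ :=
  x.acc + dualPotential A D x.noise

/-- The invariant of the inner loop of ALEG with accumulated weight `wt` in an epoch with mirror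
snapshot divergence `bar`. -/
structure TraceInv (A : Geometry E) (P : Problem E m n) (D α : ℝ) (bar : E × (Fin m → ℝ) → ℝ)
    (ρ wt : ℝ) (x : TracedState E m) : Prop where
  cur_mem : x.st.cur ∈ mirrorDomain A m
  wtSum_eq : x.st.wtSum = wt
  le_rateSum : ρ ≤ x.st.rateSum
  ptSum_mem : ∃ u ∈ feasible A m, x.st.ptSum = wt • u
  -- Here wt ψ(z) - ⟨mirrorSum, z⟩ + c stands for the sum of α B(z, z_{k+1}) over the epoch so far,
  -- and the first condition is Jensen's inequality for it. In the regret, each step moves weight α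
  -- from the old snapshot divergence `bar` to this sum, so wt grows from 0 to 1 during an epoch.
  regret : ∃ c : ℝ,
    (∀ z ∈ feasible A m, 0 ≤ wt * psi A D z - pair x.st.mirrorSum z + c ∧
      znorm D (wt • z - x.st.ptSum) ^ 2 ≤
        wt * (2 * (wt * psi A D z - pair x.st.mirrorSum z + c))) ∧
    ∃ u ∈ feasible A m, x.st.outSum = x.st.rateSum • u ∧ ∀ z ∈ feasible A m,
      x.st.rateSum * P.gap u z + (1 - α) * bregDiv A D z x.st.cur
        + (wt * psi A D z - pair x.st.mirrorSum z + c) + (1 - wt) * bar z ≤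
      2 * bregDiv A D z (initPoint A m D) + x.acc + pair x.noise z

/-- Two-term Cauchy–Schwarz, with the cross term bounded by 2√(rY · sX) ≤ rY + sX. No division
occurs, so zero weights are allowed. -/
theorem sq_add_le_mul_add {a b r s X Y : ℝ} (hr : 0 ≤ r) (hs : 0 ≤ s)
    (hX : 0 ≤ X) (hY : 0 ≤ Y) (h1 : a ^ 2 ≤ r * X) (h2 : b ^ 2 ≤ s * Y) :
    (a + b) ^ 2 ≤ (r + s) * (X + Y) := by
  have h3 : 2 * a * b ≤ r * Y + s * X := by
    refine le_of_sq_le_sq ?_ (by positivity)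
    have h4 := mul_le_mul h1 h2 (sq_nonneg b) (by positivity)
    nlinarith [sq_nonneg (r * Y - s * X)]
  nlinarith

theorem estimator_eq (P : Problem E m n) (zs half : E × (Fin m → ℝ))
    (gs : (E →L[ℝ] ℝ) × (Fin m → ℝ)) (ξ : (i : Fin m) → Fin (n i)) (z : E × (Fin m → ℝ)) :
    pair ((P.stochGrad ξ half).val - (P.stochGrad ξ zs).val + gs) z =
      pair (P.fullGrad half).val z - pair (estimatorError P zs half gs ξ) z := by
  rw [estimatorError, pair_sub_left (P.fullGrad half).val]
  ring

theorem TraceInv.update (h : Assumptions A P L G D) (hG : 0 ≤ G) (hD : 0 < D) (hm : 1 ≤ m)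
    {zs : E × (Fin m → ℝ)} {pbar gs : (E →L[ℝ] ℝ) × (Fin m → ℝ)} {cbar η η₀ α ρ wt : ℝ}
    (hzs : zs ∈ feasible A m)
    (hbar : ∀ z ∈ feasible A m, znorm D (z - zs) ^ 2 / 2 ≤ psi A D z - pair pbar z + cbar)
    (hη₀ : 0 < η₀) (hη : η₀ ≤ η) (hα : 0 < α) (hα1 : α ≤ 1)
    (hηα : η ^ 2 * lipConst L G D m ^ 2 ≤ α / 5) (hρ : 0 ≤ ρ) (hwt : 0 ≤ wt)
    {x : TracedState E m}
    (hx : TraceInv A P D α (fun z => psi A D z - pair pbar z + cbar) ρ wt x)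
    (ξ : (i : Fin m) → Fin (n i)) :
    TraceInv A P D α (fun z => psi A D z - pair pbar z + cbar) (ρ + η₀) (wt + α)
      (tracedUpdate A P D zs pbar gs η α x ξ) := by
  have hA := h.geometry
  have hη1 : 0 < η := hη₀.trans_le hη
  set half := halfPoint A D pbar gs η α x.st with hhalf
  set est := (P.stochGrad ξ half).val - (P.stochGrad ξ zs).val + gs with hest
  set next := (prox A D η α est pbar (gradPsi A D x.st.cur).val).val with hnext
  have hcur' : (tracedUpdate A P D zs pbar gs η α x ξ).st.cur = next := rfl
  have hhm : half ∈ mirrorDomain A m := (prox_spec hA hD hm η α gs pbar _).1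
  have hnm : next ∈ mirrorDomain A m := (prox_spec hA hD hm η α est pbar _).1
  have hhf := mirrorDomain_subset A m hhm
  have hnf := mirrorDomain_subset A m hnm
  have hrate : 0 ≤ x.st.rateSum := hρ.trans hx.le_rateSum
  have hstep : ∀ z ∈ feasible A m, η * pair est (half - z) ≤
      α * (psi A D z - pair pbar z + cbar) + (1 - α) * bregDiv A D z x.st.cur
      - bregDiv A D z next - α / 2 * znorm D (half - zs) ^ 2
      + η ^ 2 * lipConst L G D m ^ 2 / 2 * znorm D (half - zs) ^ 2 := fun z hz =>
    mirrorProx_step hA hD hm hη1.le hα.le hα1 hx.cur_mem hbar hhalf hnext (fun a ha b hb => by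
      rw [hest, add_sub_cancel_right]
      exact abs_pair_stochGrad_sub_le h hG hD hm ξ hhf hzs ha hb) hz
  obtain ⟨c, hc1, u, hu, hout, hreg⟩ := hx.regret
  obtain ⟨w, hw, hpt⟩ := hx.ptSum_mem
  have hptSum : (tracedUpdate A P D zs pbar gs η α x ξ).st.ptSum = x.st.ptSum + α • next := rfl
  -- The new constant is chosen so that the accumulated divergence grows by exactly α B(z, next).
  refine ⟨hnm, congrArg (· + α) hx.wtSum_eq, add_le_add hx.le_rateSum hη, ?_,
    c + α * (pair (gradPsi A D next).val next - psi A D next), fun z hz => ?_, ?_⟩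
  · obtain ⟨h1, h2⟩ := exists_convex_combination (feasible_convex hA m) hwt hα hw hnf
    exact ⟨_, h1, by rw [hptSum, hpt, h2]⟩
  · have e1 : (wt + α) • z - (x.st.ptSum + α • next) =
        (wt • z - x.st.ptSum) + α • (z - next) := by
      rw [add_smul, smul_sub]; abel
    have h1 := half_sq_le_bregDiv hA hm hnm hz
    have h2 : znorm D (α • (z - next)) ^ 2 ≤ α * (α * (2 * bregDiv A D z next)) := by
      rw [znorm_smul, abs_of_pos hα, mul_pow, sq α, mul_assoc]
      have : znorm D (z - next) ^ 2 ≤ 2 * bregDiv A D z next := by linarith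
      gcongr
    have h3 := znorm_add_le hD.le (wt • z - x.st.ptSum) (α • (z - next))
    have hY := bregDiv_nonneg hA hm hnm hz
    obtain ⟨hX, hc2⟩ := hc1 z hz
    have hnew : (wt + α) * psi A D z - pair (x.st.mirrorSum + α • (gradPsi A D next).val) z
        + (c + α * (pair (gradPsi A D next).val next - psi A D next)) =
        (wt * psi A D z - pair x.st.mirrorSum z + c) + α * bregDiv A D z next := by
      rw [pair_add_left, pair_smul_left, bregDiv, pair_sub_right]
      ring
    have hmir : (tracedUpdate A P D zs pbar gs η α x ξ).st.mirrorSum =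
        x.st.mirrorSum + α • (gradPsi A D next).val := rfl
    rw [hmir, hnew, hptSum, e1]
    refine ⟨by positivity, ?_⟩
    have h4 := sq_add_le_mul_add hwt hα.le (by positivity) (by positivity) hc2 h2
    refine (pow_le_pow_left₀ (znorm_nonneg _ _) h3 2).trans (h4.trans (le_of_eq ?_))
    ring
  · obtain ⟨v, hv, hv1, hv2⟩ := exists_average h hrate hη1 hu hhf
    have hout' : (tracedUpdate A P D zs pbar gs η α x ξ).st.outSum =
        x.st.outSum + η • half := rfl
    have hrate' : (tracedUpdate A P D zs pbar gs η α x ξ).st.rateSum =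
        x.st.rateSum + η := rfl
    refine ⟨v, hv, by rw [hout', hrate', hout, hv1], fun z hz => ?_⟩
    have hmir : (tracedUpdate A P D zs pbar gs η α x ξ).st.mirrorSum =
        x.st.mirrorSum + α • (gradPsi A D next).val := rfl
    have hacc : (tracedUpdate A P D zs pbar gs η α x ξ).acc = x.acc
        + η * pair (estimatorError P zs half gs ξ) half
        - 2 / 5 * α * znorm D (half - zs) ^ 2 := rfl
    have hnoise : (tracedUpdate A P D zs pbar gs η α x ξ).noise =
        x.noise - η • estimatorError P zs half gs ξ := rfl
    rw [hmir, hacc, hnoise, hcur', hrate', pair_add_left, pair_smul_left, pair_sub_left,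
      pair_smul_left]
    -- The estimator is the full gradient minus the error: the full gradient dominates the gap at
    -- `half`, and the error enters `acc` and `noise`. The new B(z, next) splits into 1 - α for the
    -- current iterate and α for the accumulated divergence.
    have h1 := hstep z hz
    have h2 := hreg z hz
    have h3 := hv2 z hz
    have h4 := mul_le_mul_of_nonneg_left (objective_sub_le_pair h hhf hz) hη1.le
    have h5 := mul_le_mul_of_nonneg_right hηα (sq_nonneg (znorm D (half - zs)))
    have h6 : bregDiv A D z next =
        psi A D z - psi A D next - (pair (gradPsi A D next).val z - pair (gradPsi A D next).val next) := by
      rw [bregDiv, pair_sub_right]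
    rw [hest, estimator_eq, pair_sub_right, pair_sub_right (estimatorError P zs half gs ξ)] at h1
    rw [pair_sub_right] at h4
    change η * P.gap half z ≤ _ at h4
    rw [h6] at h1 ⊢
    linarith

end Trace

/-! ### Variance reduction and the exponential supermartingale. -/

section Supermartingale

variable {E : Type*} [NormedAddCommGroup E] [NormedSpace ℝ E] {m : ℕ} {n : Fin m → ℕ}
  {A : Geometry E} {P : Problem E m n} {L G D : ℝ} [∀ i, NeZero (n i)]

/-- Variance reduction: the error is a difference of two gradient increments between zs and `half`,
so it vanishes as the two points merge. -/
theorem abs_pair_estimatorError_le (h : Assumptions A P L G D) (hG : 0 ≤ G) (hD : 0 < D)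
    (hm : 1 ≤ m) {zs half x y : E × (Fin m → ℝ)} (hzs : zs ∈ feasible A m)
    (hhalf : half ∈ feasible A m) (hx : x ∈ feasible A m) (hy : y ∈ feasible A m)
    (ξ : (i : Fin m) → Fin (n i)) :
    |pair (estimatorError P zs half (P.fullGrad zs).val ξ) (x - y)| ≤
      2 * lipConst L G D m * znorm D (half - zs) * znorm D (x - y) := by
  have e : estimatorError P zs half (P.fullGrad zs).val ξ =
      ((P.fullGrad half).val - (P.fullGrad zs).val)
        - ((P.stochGrad ξ half).val - (P.stochGrad ξ zs).val) := by
    rw [estimatorError]; abel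
  rw [e, pair_sub_left]
  have h1 := abs_pair_fullGrad_sub_le h hG hD hm hhalf hzs hx hy
  have h2 := abs_pair_stochGrad_sub_le h hG hD hm ξ hhalf hzs hx hy
  refine (abs_sub _ _).trans ?_
  linarith

theorem sum_pair_estimatorError (P : Problem E m n) (zs half d : E × (Fin m → ℝ)) :
    ∑ ξ, pair (estimatorError P zs half (P.fullGrad zs).val ξ) d = 0 := by
  have hc : (0 : ℝ) < Fintype.card ((i : Fin m) → Fin (n i)) := by exact_mod_cast Fintype.card_pos
  have h1 := card_inv_mul_sum_pair_stochGrad P half d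
  have h2 := card_inv_mul_sum_pair_stochGrad P zs d
  rw [inv_mul_eq_iff_eq_mul₀ hc.ne'] at h1 h2
  simp only [estimatorError, pair_sub_left, pair_add_left, Finset.sum_sub_distrib,
    Finset.sum_add_distrib, h1, h2]
  simp

/-- The comparison point is replaced by `dualPoint` of the past noise, on which the new draw has no
influence. With β = 2ηΛ‖half - zs‖ the quadratic term β²/4 costs another α/5 of the available 2α/5.
-/
theorem potential_tracedUpdate_le (h : Assumptions A P L G D) (hG : 0 ≤ G) (hD : 0 < D)
    (hm : 1 ≤ m) {zs : E × (Fin m → ℝ)} (pbar : (E →L[ℝ] ℝ) × (Fin m → ℝ)) {η α : ℝ}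
    (hη : 0 ≤ η) (hηα : η ^ 2 * lipConst L G D m ^ 2 ≤ α / 5) (hzs : zs ∈ feasible A m)
    (x : TracedState E m) (ξ : (i : Fin m) → Fin (n i)) :
    potential A D (tracedUpdate A P D zs pbar (P.fullGrad zs).val η α x ξ) ≤
      potential A D x
      + η * pair (estimatorError P zs (halfPoint A D pbar (P.fullGrad zs).val η α x.st)
            (P.fullGrad zs).val ξ)
          (halfPoint A D pbar (P.fullGrad zs).val η α x.st - dualPoint A D x.noise)
      - α / 5 * znorm D (halfPoint A D pbar (P.fullGrad zs).val η α x.st - zs) ^ 2 := by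
  have hA := h.geometry
  set half := halfPoint A D pbar (P.fullGrad zs).val η α x.st with hhalf
  set err := estimatorError P zs half (P.fullGrad zs).val ξ with herr
  have hhf : half ∈ feasible A m := mirrorDomain_subset A m (prox_spec hA hD hm η α _ pbar _).1
  have h1 := dualPotential_add_le hA hD hm x.noise ((-η) • err)
    (β := η * (2 * lipConst L G D m * znorm D (half - zs))) fun a ha b hb => by
      rw [pair_smul_left, abs_mul, abs_neg, abs_of_nonneg hη, mul_assoc η]
      exact mul_le_mul_of_nonneg_left
        (abs_pair_estimatorError_le h hG hD hm hzs hhf ha hb ξ) hη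
  have e : potential A D (tracedUpdate A P D zs pbar (P.fullGrad zs).val η α x ξ) =
      x.acc + η * pair err half - 2 / 5 * α * znorm D (half - zs) ^ 2
        + dualPotential A D (x.noise + (-η) • err) := by
    have e0 : x.noise + (-η) • err = x.noise - η • err := by
      rw [sub_eq_add_neg]; congr 1; exact neg_smul η err
    rw [e0]
    rfl
  have h2 := mul_le_mul_of_nonneg_right hηα (sq_nonneg (znorm D (half - zs)))
  rw [pair_smul_left] at h1
  rw [e, potential, pair_sub_right]
  linarith

/-- One inner iteration of ALEG on traced states. -/
def tracedStep (A : Geometry E) (P : Problem E m n) (D : ℝ) (zs : E × (Fin m → ℝ))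
    (pbar gs : (E →L[ℝ] ℝ) × (Fin m → ℝ)) (η α : ℝ) (x : TracedState E m) :
    PMF (TracedState E m) :=
  (PMF.uniformOfFintype ((i : Fin m) → Fin (n i))).map (tracedUpdate A P D zs pbar gs η α x)

/-- The exponential supermartingale. -/
def expPotential (A : Geometry E) (D : ℝ) (x : TracedState E m) : ℝ≥0∞ :=
  ENNReal.ofReal (Real.exp (potential A D x / 16))

theorem expect_tracedStep_le (h : Assumptions A P L G D) (hG : 0 ≤ G) (hD : 0 < D)
    (hm : 1 ≤ m) {zs : E × (Fin m → ℝ)} (pbar : (E →L[ℝ] ℝ) × (Fin m → ℝ)) {η α : ℝ}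
    (hη : 0 ≤ η) (hηα : η ^ 2 * lipConst L G D m ^ 2 ≤ α / 5) (hzs : zs ∈ feasible A m)
    (x : TracedState E m) :
    expect (tracedStep A P D zs pbar (P.fullGrad zs).val η α x) (expPotential A D) ≤
      expPotential A D x := by
  have hA := h.geometry
  rw [tracedStep, expect_map]
  set half := halfPoint A D pbar (P.fullGrad zs).val η α x.st with hhalf
  set y := dualPoint A D x.noise with hy
  have hhf : half ∈ feasible A m := mirrorDomain_subset A m (prox_spec hA hD hm η α _ pbar _).1
  have hyf : y ∈ feasible A m := (dualPoint_spec hA hD hm x.noise).1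
  set M : ((i : Fin m) → Fin (n i)) → ℝ := fun ξ =>
    η / 16 * pair (estimatorError P zs half (P.fullGrad zs).val ξ) (half - y) with hM
  have hl := lipConst_nonneg (L := L) (G := G) hD.le m
  set r := znorm D (half - zs) with hr
  have hr0 : 0 ≤ r := znorm_nonneg _ _
  have hd : znorm D (half - y) ≤ √8 := Real.le_sqrt_of_sq_le (znorm_sub_sq_le hA hD hm hhf hyf)
  set b : ℝ := η / 16 * (2 * lipConst L G D m * r * √8) with hb
  have hMb : ∀ ξ, |M ξ| ≤ b := fun ξ => by
    rw [hM, hb, abs_mul, abs_of_nonneg (by positivity : 0 ≤ η / 16)]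
    refine mul_le_mul_of_nonneg_left ?_ (by positivity)
    exact (abs_pair_estimatorError_le h hG hD hm hzs hhf hhf hyf ξ).trans
      (mul_le_mul_of_nonneg_left hd (by positivity))
  have hMs : ∑ ξ, M ξ = 0 := by
    rw [hM, ← Finset.mul_sum, sum_pair_estimatorError, mul_zero]
  have hH := card_inv_mul_sum_exp_le (by positivity) hMb hMs
  have hle : ∀ ξ, potential A D (tracedUpdate A P D zs pbar (P.fullGrad zs).val η α x ξ) / 16 ≤
      (potential A D x - α / 5 * r ^ 2) / 16 + M ξ := fun ξ => by
    have := potential_tracedUpdate_le h hG hD hm pbar hη hηα hzs x ξ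
    simp only [hM]
    linarith
  -- Hoeffding's exponent is covered by the remaining α/5: the scale 1/16 is the largest for which
  -- this works with diameter √8 and the factor 2 in the error bound.
  have hb2 : b ^ 2 / 2 ≤ α / 5 * r ^ 2 / 16 := by
    have e : b ^ 2 / 2 = η ^ 2 * lipConst L G D m ^ 2 * r ^ 2 / 16 := by
      rw [hb, mul_pow, mul_pow (2 * lipConst L G D m * r), Real.sq_sqrt (by norm_num)]
      ring
    rw [e]
    exact div_le_div_of_nonneg_right (mul_le_mul_of_nonneg_right hηα (sq_nonneg r)) (by norm_num)
  have e1 : ∀ ξ, expPotential A D (tracedUpdate A P D zs pbar (P.fullGrad zs).val η α x ξ) ≤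
      ENNReal.ofReal (Real.exp ((potential A D x - α / 5 * r ^ 2) / 16) * Real.exp (M ξ)) :=
    fun ξ => by
      rw [← Real.exp_add]
      exact ENNReal.ofReal_le_ofReal (Real.exp_le_exp.2 (hle ξ))
  refine (expect_mono fun ξ _ => e1 ξ).trans ?_
  rw [expect_uniformOfFintype fun ξ => by positivity, ← Finset.mul_sum, mul_left_comm]
  refine ENNReal.ofReal_le_ofReal ?_
  refine (mul_le_mul_of_nonneg_left hH (Real.exp_pos _).le).trans ?_
  rw [← Real.exp_add, Real.exp_le_exp]
  linarith

/-- One epoch of ALEG on traced states. -/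
def tracedEpoch (A : Geometry E) (P : Problem E m n) (D : ℝ) (K : ℕ) (η α : ℕ → ℝ)
    (x : TracedState E m) : PMF (TracedState E m) :=
  forEach (fun k => tracedStep A P D (x.st.wtSum⁻¹ • x.st.ptSum) (x.st.wtSum⁻¹ • x.st.mirrorSum)
      (P.fullGrad (x.st.wtSum⁻¹ • x.st.ptSum)).val (η k) (α k)) (List.range K)
    { x with
      st := { x.st with
        wtSum := 0, ptSum := 0, mirrorSum := 0
        ops := x.st.ops + (2 * (m + 1) + 1) + (P.fullGrad (x.st.wtSum⁻¹ • x.st.ptSum)).ops } }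

theorem tracedEpoch_map_st (A : Geometry E) (P : Problem E m n) (D : ℝ) (K : ℕ) (η α : ℕ → ℝ)
    (x : TracedState E m) :
    (tracedEpoch A P D K η α x).map TracedState.st = alegEpoch A P D K η α x.st :=
  forEach_map (fun k y => by rw [tracedStep, PMF.map_comp]; rfl) _ _

theorem tracedEpoch_spec (h : Assumptions A P L G D) (hG : 0 ≤ G) (hD : 0 < D)
    (hm : 1 ≤ m) {K : ℕ} (hK : 1 ≤ K) {η : ℕ → ℝ} {η₀ ρ : ℝ} (hη₀ : 0 < η₀) (hρ : 0 ≤ ρ)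
    (hη : ∀ k < K, η₀ ≤ η k ∧ η k ^ 2 * lipConst L G D m ^ 2 ≤ 1 / (K : ℝ) / 5)
    {x : TracedState E m} (hx : TraceInv A P D (1 / (K : ℝ)) 0 ρ 1 x) :
    (∀ y ∈ (tracedEpoch A P D K η (fun _ => 1 / (K : ℝ)) x).support,
      TraceInv A P D (1 / (K : ℝ)) 0 (ρ + K * η₀) 1 y) ∧
    expect (tracedEpoch A P D K η (fun _ => 1 / (K : ℝ)) x) (expPotential A D) ≤
      expPotential A D x := by
  have hA := h.geometry
  have hK0 : (0 : ℝ) < K := by exact_mod_cast hK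
  have hα : 0 < 1 / (K : ℝ) := by positivity
  have hα1 : 1 / (K : ℝ) ≤ 1 := by
    rw [div_le_one hK0]; exact_mod_cast hK
  set zs := x.st.wtSum⁻¹ • x.st.ptSum with hzs
  set pbar := x.st.wtSum⁻¹ • x.st.mirrorSum with hpbar
  obtain ⟨w, hw, hpt⟩ := hx.ptSum_mem
  have hzsw : zs = w := by rw [hzs, hx.wtSum_eq, hpt]; simp
  have hptw : x.st.ptSum = w := by rw [hpt, one_smul]
  have hpbar' : pbar = x.st.mirrorSum := by rw [hpbar, hx.wtSum_eq]; simp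
  have hzsf : zs ∈ feasible A m := hzsw ▸ hw
  obtain ⟨c, hc, u, hu, hout, hreg⟩ := hx.regret
  have hbar : ∀ z ∈ feasible A m, znorm D (z - zs) ^ 2 / 2 ≤ psi A D z - pair pbar z + c := by
    intro z hz
    have := (hc z hz).2
    rw [one_smul, one_mul, one_mul, hptw] at this
    rw [hpbar', hzsw]
    linarith
  set x₀ : TracedState E m := { x with
      st := { x.st with
        wtSum := 0, ptSum := 0, mirrorSum := 0
        ops := x.st.ops + (2 * (m + 1) + 1) + (P.fullGrad zs).ops } } with hx₀
  set bar : E × (Fin m → ℝ) → ℝ := fun z => psi A D z - pair pbar z + c with hbardef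
  -- At the epoch boundary the divergence accumulated with weight 1 is renamed `bar`, and
  -- accumulation restarts at weight 0; the regret inequality is unchanged.
  have h0 : TraceInv A P D (1 / (K : ℝ)) bar ρ 0 x₀ := by
    refine ⟨hx.cur_mem, rfl, hx.le_rateSum, ⟨w, hw, (zero_smul _ _).symm⟩, 0, fun z hz => ?_,
      u, hu, hout, fun z hz => ?_⟩
    · simp [hx₀, pair_zero_left, znorm]
    · have := hreg z hz
      simp only [hx₀, pair_zero_left, hbardef, hpbar']
      simp only [Pi.zero_apply, mul_zero, add_zero, one_mul] at this
      linarith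
  have hupd : ∀ k < K, ∀ y, TraceInv A P D (1 / (K : ℝ)) bar (ρ + k * η₀) (k * (1 / (K : ℝ))) y →
      (∀ y' ∈ (tracedStep A P D zs pbar (P.fullGrad zs).val (η k) (1 / (K : ℝ)) y).support,
        TraceInv A P D (1 / (K : ℝ)) bar (ρ + (k + 1 : ℕ) * η₀) ((k + 1 : ℕ) * (1 / (K : ℝ))) y') ∧
      expect (tracedStep A P D zs pbar (P.fullGrad zs).val (η k) (1 / (K : ℝ)) y)
        (expPotential A D) ≤ expPotential A D y := by
    intro k hk y hy
    obtain ⟨h1, h2⟩ := hη k hk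
    refine ⟨fun y' hy' => ?_,
      expect_tracedStep_le h hG hD hm pbar (hη₀.le.trans h1) h2 hzsf y⟩
    rw [tracedStep, PMF.mem_support_map_iff] at hy'
    obtain ⟨ξ, -, rfl⟩ := hy'
    have := hy.update h hG hD hm hzsf hbar hη₀ h1 hα hα1 h2 (by positivity) (by positivity)
      (gs := (P.fullGrad zs).val) ξ
    push_cast
    rw [add_mul, add_mul, one_mul, one_mul, ← add_assoc]
    exact this
  have h0' : TraceInv A P D (1 / (K : ℝ)) bar (ρ + (0 : ℕ) * η₀) ((0 : ℕ) * (1 / (K : ℝ))) x₀ := by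
    simpa using h0
  refine ⟨fun y hy => ?_, ?_⟩
  · have h1 := forEach_range_invariant
      (Inv := fun k => TraceInv A P D (1 / (K : ℝ)) bar (ρ + k * η₀) (k * (1 / (K : ℝ))))
      (fun k hk y hy => (hupd k hk y hy).1) h0' y hy
    -- After K steps of weight 1/K the old snapshot divergence has coefficient 1 - 1 = 0 and may be
    -- forgotten.
    rw [mul_one_div_cancel hK0.ne'] at h1
    obtain ⟨h2, h3, h4, h5, c', hc', u', hu', hout', hreg'⟩ := h1
    refine ⟨h2, h3, h4, h5, c', hc', u', hu', hout', fun z hz => ?_⟩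
    have := hreg' z hz
    rw [sub_self, zero_mul] at this ⊢
    exact this
  · exact expect_forEach_range_le (f := expPotential A D)
      (Inv := fun k => TraceInv A P D (1 / (K : ℝ)) bar (ρ + k * η₀) (k * (1 / (K : ℝ))))
      hupd h0'

end Supermartingale

/-! ### The high-probability gap of ALEG. -/

section HighProbability

variable {E : Type*} [NormedAddCommGroup E] [NormedSpace ℝ E] {m : ℕ} {n : Fin m → ℕ}
  {A : Geometry E} {P : Problem E m n} {L G D : ℝ}

/-- The fictitious epoch contributes B(z, z₀) with weight 1 and the iterate contributes (1 - α) B(z,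
z₀); together they explain the factor 2 in the invariant. -/
theorem traceInv_init (hA : IsMirrorGeometry A D) (P : Problem E m n) (hD : 0 < D) (hm : 1 ≤ m)
    {α : ℝ} (hα : 0 ≤ α) :
    TraceInv A P D α 0 0 1 ⟨alegInit A m D, 0, 0⟩ := by
  obtain ⟨h0, h1⟩ := initPoint_spec hA hD hm
  have h0f := mirrorDomain_subset A m h0
  have e : ∀ z, 1 * psi A D z - pair (alegInit A m D).mirrorSum z
      + (pair (gradPsi A D (initPoint A m D)).val (initPoint A m D)
        - psi A D (initPoint A m D)) = bregDiv A D z (initPoint A m D) := by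
    intro z
    rw [bregDiv, pair_sub_right]
    change 1 * psi A D z - pair (gradPsi A D (initPoint A m D)).val z + _ = _
    ring
  refine ⟨h0, rfl, le_rfl, ⟨initPoint A m D, h0f, (one_smul _ _).symm⟩,
    pair (gradPsi A D (initPoint A m D)).val (initPoint A m D) - psi A D (initPoint A m D),
    fun z hz => ?_, initPoint A m D, h0f, (zero_smul _ _).symm, fun z hz => ?_⟩
  · rw [e, one_smul, one_mul]
    have h2 := half_sq_le_bregDiv hA hm h0 hz
    refine ⟨bregDiv_nonneg hA hm h0 hz, ?_⟩
    change znorm D (z - initPoint A m D) ^ 2 ≤ _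
    linarith
  · rw [e]
    have h2 := mul_nonneg hα (bregDiv_nonneg hA hm h0 hz)
    change 0 * _ + (1 - α) * bregDiv A D z (initPoint A m D) + _ + (1 - 1) * _ ≤ _
    simp only [pair_zero_left]
    linarith

variable [∀ i, NeZero (n i)]

/-- The whole run of ALEG on traced states. -/
def tracedRun (A : Geometry E) (P : Problem E m n) (D : ℝ) (S : ℕ) (K : ℕ → ℕ)
    (η α : ℕ → ℕ → ℝ) : PMF (TracedState E m) :=
  forEach (fun s => tracedEpoch A P D (K s) (η s) (α s)) (List.range S) ⟨alegInit A m D, 0, 0⟩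

theorem aleg_eq_map (A : Geometry E) (P : Problem E m n) (D : ℝ) (S : ℕ) (K : ℕ → ℕ)
    (η α : ℕ → ℕ → ℝ) :
    aleg A P D S K η α = (tracedRun A P D S K η α).map fun x =>
      ⟨x.st.rateSum⁻¹ • x.st.outSum, x.st.ops + (m + 1) + 1⟩ := by
  have h1 : (tracedRun A P D S K η α).map TracedState.st =
      forEach (fun s => alegEpoch A P D (K s) (η s) (α s)) (List.range S) (alegInit A m D) :=
    forEach_map (fun s y => tracedEpoch_map_st A P D (K s) (η s) (α s) y) _ _
  rw [aleg, ← h1, PMF.map_comp]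
  rfl

theorem AdmissibleRates.spec {Λ : ℝ} (hΛ : 0 < Λ) {S K : ℕ} (hK : 1 ≤ K) {η : ℕ → ℕ → ℝ}
    (h : AdmissibleRates Λ S K η) {s k : ℕ} (hs : s < S) (hk : k < K) :
    1 / (10 * Λ * √K) ≤ η s k ∧ η s k ^ 2 * Λ ^ 2 ≤ 1 / (K : ℝ) / 5 := by
  obtain ⟨h1, h2⟩ := h s hs k hk
  have hK0 : (0 : ℝ) < K := by exact_mod_cast hK
  have h3 : 0 ≤ η s k := le_trans (by positivity) h1
  refine ⟨h1, ?_⟩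
  have h4 := pow_le_pow_left₀ h3 h2 2
  have h5 := mul_le_mul_of_nonneg_right h4 (sq_nonneg Λ)
  refine h5.trans (le_of_eq ?_)
  rw [div_pow, mul_pow, Real.sq_sqrt (by positivity)]
  field_simp

/-- High-probability guarantee of ALEG: with probability at least `1 - δ` the output is feasible
and its gap is at most `10 Λ (4 + 16 ln (1 / δ)) / (S √K)`. -/
theorem aleg_gap (h : Assumptions A P L G D) (hL : 0 < L) (hG : 0 ≤ G) (hD : 0 < D)
    (hm : 1 ≤ m) {S K : ℕ} (hS : 1 ≤ S) (hK : 1 ≤ K) {η : ℕ → ℕ → ℝ}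
    (hη : AdmissibleRates (lipConst L G D m) S K η) {δ : ℝ} (hδ : 0 < δ)
    (hδ1 : δ ≤ 1) :
    (aleg A P D S (fun _ => K) η (fun _ _ => 1 / (K : ℝ))).toOuterMeasure
      {r | r.val ∈ feasible A m ∧ ∀ z ∈ feasible A m,
        P.gap r.val z ≤ 10 * lipConst L G D m * (4 + 16 * Real.log (1 / δ)) / (S * √K)}ᶜ ≤
      ENNReal.ofReal δ := by
  have hA := h.geometry
  have hΛ := lipConst_pos (G := G) hL hD m
  set Λ := lipConst L G D m with hΛdef
  have hK0 : (0 : ℝ) < K := by exact_mod_cast hK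
  have hS0 : (0 : ℝ) < S := by exact_mod_cast hS
  set η₀ : ℝ := 1 / (10 * Λ * √K) with hη₀
  have hη₀pos : 0 < η₀ := by positivity
  have hepoch : ∀ s < S, ∀ x, TraceInv A P D (1 / (K : ℝ)) 0 (s * (K * η₀)) 1 x →
      (∀ y ∈ (tracedEpoch A P D K (η s) (fun _ => 1 / (K : ℝ)) x).support,
        TraceInv A P D (1 / (K : ℝ)) 0 ((s + 1 : ℕ) * (K * η₀)) 1 y) ∧
      expect (tracedEpoch A P D K (η s) (fun _ => 1 / (K : ℝ)) x) (expPotential A D) ≤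
        expPotential A D x := by
    intro s hs x hx
    have h1 := tracedEpoch_spec h hG hD hm hK hη₀pos (by positivity)
      (fun k hk => hη.spec hΛ hK hs hk) hx
    have e : ((s + 1 : ℕ) : ℝ) * (K * η₀) = s * (K * η₀) + K * η₀ := by push_cast; ring
    rw [e]
    exact h1
  have hinit : TraceInv A P D (1 / (K : ℝ)) 0 ((0 : ℕ) * (K * η₀)) 1
      ⟨alegInit A m D, 0, 0⟩ := by
    simpa using traceInv_init hA P hD hm (by positivity : 0 ≤ 1 / (K : ℝ))
  have hinv := forEach_range_invariant
    (Inv := fun s => TraceInv A P D (1 / (K : ℝ)) 0 (s * (K * η₀)) 1)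
    (fun s hs x hx => (hepoch s hs x hx).1) hinit
  have hexp := expect_forEach_range_le (f := expPotential A D)
    (Inv := fun s => TraceInv A P D (1 / (K : ℝ)) 0 (s * (K * η₀)) 1) hepoch hinit
  have hone : expPotential A D (⟨alegInit A m D, 0, 0⟩ : TracedState E m) ≤ 1 := by
    rw [expPotential, ENNReal.ofReal_le_one, Real.exp_le_one_iff]
    have := dualPotential_zero_le (m := m) hA hD hm
    simp only [potential]
    linarith
  rw [aleg_eq_map, PMF.toOuterMeasure_map_apply]
  -- Markov's inequality in contrapositive form: a traced run whose exponential potential is below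
  -- 1/δ has a good output.
  have hmk := mul_toOuterMeasure_le_expect (tracedRun A P D S (fun _ => K) η
    (fun _ _ => 1 / (K : ℝ))) (f := expPotential A D) (c := ENNReal.ofReal (1 / δ))
    (s := (fun x : TracedState E m =>
      (⟨x.st.rateSum⁻¹ • x.st.outSum, x.st.ops + (m + 1) + 1⟩ : Timed (E × (Fin m → ℝ)))) ⁻¹'
      {r | r.val ∈ feasible A m ∧ ∀ z ∈ feasible A m,
        P.gap r.val z ≤ 10 * Λ * (4 + 16 * Real.log (1 / δ)) / (S * √K)}ᶜ)
    (fun x hx hbad => by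
      by_contra hlt
      apply hbad
      rw [not_le, expPotential, ENNReal.ofReal_lt_ofReal_iff (by positivity)] at hlt
      have hpot : potential A D x ≤ 16 * Real.log (1 / δ) := by
        have := (Real.lt_log_iff_exp_lt (by positivity)).2 hlt
        linarith
      obtain ⟨h1, h2, h3, h4, c, hc, u, hu, hout, hreg⟩ := hinv x hx
      have hR : 0 < x.st.rateSum := lt_of_lt_of_le (by positivity) h3
      have hval : x.st.rateSum⁻¹ • x.st.outSum = u := by
        rw [hout, smul_smul, inv_mul_cancel₀ hR.ne', one_smul]
      refine ⟨by simpa only [hval] using hu, fun z hz => ?_⟩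
      simp only [hval]
      have h5 := hreg z hz
      have h6 := (dualPoint_spec hA hD hm x.noise).2 z hz
      have h7 := (hc z hz).1
      obtain ⟨h8, h9⟩ := initPoint_spec hA hD hm
      have h10 := h9 z hz
      have h11 := psi_sub_le_one hA hD hz (mirrorDomain_subset A m h8)
      have hα1 : 1 / (K : ℝ) ≤ 1 := by
        rw [div_le_one hK0]; exact_mod_cast hK
      have h12 := mul_nonneg (sub_nonneg.2 hα1) (bregDiv_nonneg hA hm h1 hz)
      have h13 := sq_nonneg (znorm D (z - dualPoint A D x.noise))
      -- The 4 consists of 2 B(z, z₀) ≤ 2 and of the 2 (ψ(z) - ψ(z₀)) ≤ 2 paid for bounding ⟨noise,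
      -- z⟩ by the dual potential.
      have h14 : x.st.rateSum * P.gap u z ≤ 4 + 16 * Real.log (1 / δ) := by
        rw [sub_self, zero_mul] at h5
        rw [potential] at hpot
        linarith
      have e : (S : ℝ) * (K * η₀) = S * √K / (10 * Λ) := by
        rw [hη₀]
        have : (K : ℝ) = √K * √K := (Real.mul_self_sqrt hK0.le).symm
        have h0 : √(K : ℝ) ≠ 0 := by positivity
        field_simp
        rw [sq, ← this]
      -- The rate sum is known only from below, which bounds the gap after division only when the
      -- gap is positive.
      rcases le_or_gt (P.gap u z) 0 with hg | hg
      · refine hg.trans ?_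
        have hx0 : 0 ≤ Real.log (1 / δ) := Real.log_nonneg (by rwa [le_div_iff₀ hδ, one_mul])
        positivity
      · rw [le_div_iff₀ (by positivity)]
        have h15 := (mul_le_mul_of_nonneg_right h3 hg.le).trans h14
        rw [e, div_mul_eq_mul_div, div_le_iff₀ (by positivity)] at h15
        linarith)
  have hfin := hmk.trans (hexp.trans hone)
  have hinv' : ENNReal.ofReal (1 / δ) = (ENNReal.ofReal δ)⁻¹ := by
    rw [one_div, ENNReal.ofReal_inv_of_pos hδ]
  rwa [hinv', ENNReal.inv_mul_le_iff (by simpa using hδ) ENNReal.ofReal_ne_top, mul_one] at hfin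

end HighProbability

/-! ### From ALEG to ALEM. -/

section TwoStages

variable {E : Type*} [NormedAddCommGroup E] [NormedSpace ℝ E] {m : ℕ} {n : Fin m → ℕ}
  {A : Geometry E} {P : Problem E m n} {L G D : ℝ}

theorem Assumptions.single (h : Assumptions A P L G D) (i : Fin m) :
    Assumptions A (P.single i) L G D :=
  ⟨h.nonempty, h.compact, h.convex, h.distGen, h.diameter, fun _ j => h.hasGrad i j,
    fun _ j => h.smooth i j, fun _ j => h.lipschitz i j, fun _ => h.convex_risk i⟩

section

variable [∀ i, NeZero (n i)]

theorem risk_shift (P : Problem E m n) (b : Fin m → ℝ) (i : Fin m) (w : E) :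
    (P.shift b).risk i w = P.risk i w - b i := by
  have : (n i : ℝ) ≠ 0 := by exact_mod_cast NeZero.ne (n i)
  simp only [Problem.risk, Problem.shift, Finset.sum_sub_distrib, Finset.sum_const,
    Finset.card_univ, Fintype.card_fin, nsmul_eq_mul, mul_sub]
  rw [inv_mul_cancel_left₀ this]

theorem Assumptions.shift (h : Assumptions A P L G D) (b : Fin m → ℝ) :
    Assumptions A (P.shift b) L G D := by
  refine ⟨h.nonempty, h.compact, h.convex, h.distGen, h.diameter,
    fun i j w hw => (h.hasGrad i j w hw).sub_const _, h.smooth, fun i j v hv w hw => ?_,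
    fun i => ?_⟩
  · have := h.lipschitz i j v hv w hw
    simpa [Problem.shift] using this
  · have h1 := (h.convex_risk i).add_const (-b i)
    refine h1.congr fun w _ => ?_
    rw [risk_shift]
    rfl

/-- A good estimate of the minimal risks and a small gap of the shifted problem give a small MERO
gap. -/
theorem meroGap_le {b : Fin m → ℝ} {e₁ e₂ : ℝ}
    (hb : ∀ i, 0 ≤ b i - sInf (P.risk i '' A.dom) ∧ b i - sInf (P.risk i '' A.dom) ≤ e₁)
    {z : E × (Fin m → ℝ)} (hz : z ∈ feasible A m)
    (hgap : ∀ z' ∈ feasible A m, (P.shift b).gap z z' ≤ e₂) : meroGap A P z ≤ e₁ + e₂ := by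
  -- The two objectives differ by a term in [0, e₁] depending on q alone: it adds at most e₁ to the
  -- maximum over q, and its sign can only help in the minimum over w.
  have hobj : ∀ (w : E) (q : Fin m → ℝ), meroObjective A P w q =
      (P.shift b).objective w q + ∑ i, q i * (b i - sInf (P.risk i '' A.dom)) := by
    intro w q
    rw [meroObjective, Problem.objective, ← Finset.sum_add_distrib]
    refine Finset.sum_congr rfl fun i _ => ?_
    rw [risk_shift, excessRisk]
    ring
  have key : ∀ q ∈ stdSimplex ℝ (Fin m), ∀ w ∈ A.dom,
      meroObjective A P z.1 q - meroObjective A P w z.2 ≤ e₁ + e₂ := by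
    intro q hq w hw
    have h1 : (P.shift b).objective z.1 q - (P.shift b).objective w z.2 ≤ e₂ :=
      hgap (w, q) ⟨hw, hq⟩
    have h2 : ∑ i, q i * (b i - sInf (P.risk i '' A.dom)) ≤ e₁ := by
      have : ∑ i, q i * e₁ = e₁ := by rw [← Finset.sum_mul, hq.2, one_mul]
      rw [← this]
      exact Finset.sum_le_sum fun i _ => mul_le_mul_of_nonneg_left (hb i).2 (hq.1 i)
    have h3 : 0 ≤ ∑ i, z.2 i * (b i - sInf (P.risk i '' A.dom)) :=
      Finset.sum_nonneg fun i _ => mul_nonneg (hz.2.1 i) (hb i).1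
    rw [hobj, hobj]
    linarith
  rw [meroGap, sub_le_iff_le_add]
  refine csSup_le ⟨_, z.2, hz.2, rfl⟩ ?_
  rintro _ ⟨q, hq, rfl⟩
  rw [← sub_le_iff_le_add']
  refine le_csInf ⟨_, z.1, hz.1, rfl⟩ ?_
  rintro _ ⟨w, hw, rfl⟩
  have := key q hq w hw
  simp only
  linarith

end

/-- The simplex is a point, so the gap tested at (w, z.2) is R_i(z.1) - R_i(w). -/
theorem single_estimate (h : Assumptions A P L G D) (i : Fin m) {z : E × (Fin 1 → ℝ)} {e : ℝ}
    (hz : z ∈ feasible A 1) (hgap : ∀ z' ∈ feasible A 1, (P.single i).gap z z' ≤ e) :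
    0 ≤ P.risk i z.1 - sInf (P.risk i '' A.dom) ∧
      P.risk i z.1 - sInf (P.risk i '' A.dom) ≤ e := by
  have key : ∀ w ∈ A.dom, P.risk i z.1 - e ≤ P.risk i w := by
    intro w hw
    have h1 := hgap (w, z.2) ⟨hw, hz.2⟩
    have h2 : ∀ v : E, (P.single i).objective v z.2 = P.risk i v := by
      intro v
      have h3 := hz.2.2
      simp only [Finset.univ_unique, Finset.sum_singleton] at h3
      simp only [Problem.objective, Finset.univ_unique, Finset.sum_singleton, h3, one_mul]
      rfl
    rw [Problem.gap, h2, h2] at h1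
    linarith
  have hbdd : ∀ x ∈ P.risk i '' A.dom, P.risk i z.1 - e ≤ x := by
    rintro _ ⟨w, hw, rfl⟩
    exact key w hw
  constructor
  · have := csInf_le ⟨_, hbdd⟩ ⟨z.1, hz.1, rfl⟩
    linarith
  · have := le_csInf (h.nonempty.image _) hbdd
    linarith

/-- Union bound for a loop whose i-th pass affects only coordinate i; absence of duplicates
guarantees that a good value is never overwritten. -/
theorem forEach_coordinates {ι σ : Type*} {body : ι → σ → PMF σ} (r : σ → ι → ℝ)
    {good : ι → ℝ → Prop} {b : ℝ≥0∞}
    (hbody : ∀ i x, (body i x).toOuterMeasure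
      {y | good i (r y i) ∧ ∀ k, k ≠ i → r y k = r x k}ᶜ ≤ b) :
    ∀ (l : List ι), l.Nodup → ∀ x, (forEach body l x).toOuterMeasure
      {y | (∀ i ∈ l, good i (r y i)) ∧ ∀ i, i ∉ l → r y i = r x i}ᶜ ≤ l.length * b := by
  intro l
  induction l with
  | nil =>
    intro _ x
    simp [forEach]
  | cons i l ih =>
    intro hl x
    rw [List.nodup_cons] at hl
    have h1 := toOuterMeasure_bind_le (hbody i x) (g := forEach body l)
      (t := {y | (∀ k ∈ i :: l, good k (r y k)) ∧ ∀ k, k ∉ i :: l → r y k = r x k}ᶜ)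
      (b := l.length * b) (fun y hy => by
        refine le_trans (MeasureTheory.measure_mono ?_) (ih hl.2 y)
        refine compl_subset_compl.2 fun y' hy' => ?_
        obtain ⟨h2, h3⟩ := hy
        obtain ⟨h4, h5⟩ := hy'
        refine ⟨fun k hk => ?_, fun k hk => ?_⟩
        · rcases List.mem_cons.1 hk with rfl | hk
          · rw [h5 _ hl.1]; exact h2
          · exact h4 k hk
        · rw [List.mem_cons, not_or] at hk
          rw [h5 k hk.2, h3 k hk.1])
    rw [List.length_cons]
    push_cast
    rw [add_mul, one_mul, add_comm]
    exact h1

variable [∀ i, NeZero (n i)]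

/-- High-probability guarantee of the first stage of ALEM. -/
theorem alemStageOne_good (h : Assumptions A P L G D) (hL : 0 < L) (hG : 0 ≤ G) (hD : 0 < D)
    {S K : ℕ} (hS : 1 ≤ S) (hK : 1 ≤ K) {η : ℕ → ℕ → ℝ}
    (hη : AdmissibleRates (lipConst L G D 1) S K η) {δ e : ℝ} (hδ : 0 < δ) (hδ1 : δ ≤ 1)
    (he : 10 * lipConst L G D 1 * (4 + 16 * Real.log (1 / δ)) / (S * √K) ≤ e) :
    (alemStageOne A P D S (fun _ => K) η (fun _ _ => 1 / (K : ℝ))).toOuterMeasure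
      {out | ∀ i, 0 ≤ out.rhat i - sInf (P.risk i '' A.dom) ∧
        out.rhat i - sInf (P.risk i '' A.dom) ≤ e}ᶜ ≤ m * ENNReal.ofReal δ := by
  have h1 := forEach_coordinates (AlemOutput.rhat (E := E) (m := m))
    (body := fun i (out : AlemOutput E m) =>
      (aleg A (P.single i) D S (fun _ => K) η (fun _ _ => 1 / (K : ℝ))).map fun r =>
        let R := P.evalRisk i r.val.1
        { out with
          wbar := Function.update out.wbar i r.val.1
          rhat := Function.update out.rhat i R.val
          ops := out.ops + r.ops + R.ops })
    (good := fun i v => 0 ≤ v - sInf (P.risk i '' A.dom) ∧ v - sInf (P.risk i '' A.dom) ≤ e)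
    (b := ENNReal.ofReal δ) (fun i x => by
      rw [PMF.toOuterMeasure_map_apply]
      refine le_trans (MeasureTheory.measure_mono ?_)
        (aleg_gap (h.single i) hL hG hD le_rfl hS hK hη hδ hδ1)
      refine compl_subset_compl.2 ?_
      rintro r ⟨hr1, hr2⟩
      have h2 := single_estimate h i hr1 fun z' hz' => (hr2 z' hz').trans he
      refine ⟨?_, fun k hk => ?_⟩
      · simp only [Function.update_self]
        exact h2
      · simp only [Function.update_of_ne hk])
    (List.finRange m) (List.nodup_finRange m) { zbar := 0, wbar := 0, rhat := 0, ops := 0 }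
  rw [List.length_finRange] at h1
  refine le_trans (MeasureTheory.measure_mono ?_) h1
  exact compl_subset_compl.2 fun y hy i => hy.1 i (List.mem_finRange i)

/-- High-probability guarantee of ALEM. -/
theorem alem_good (h : Assumptions A P L G D) (hL : 0 < L) (hG : 0 ≤ G) (hD : 0 < D)
    (hm : 1 ≤ m) {S K : ℕ} (hS : 1 ≤ S) (hK : 1 ≤ K) {η₁ η₂ : ℕ → ℕ → ℝ}
    (hη₁ : AdmissibleRates (lipConst L G D 1) S K η₁)
    (hη₂ : AdmissibleRates (lipConst L G D m) S K η₂) {δ ε : ℝ} (hδ : 0 < δ) (hδ1 : δ ≤ 1)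
    (he₁ : 10 * lipConst L G D 1 * (4 + 16 * Real.log (1 / (δ / (2 * m)))) / (S * √K) ≤ ε / 2)
    (he₂ : 10 * lipConst L G D m * (4 + 16 * Real.log (1 / (δ / 2))) / (S * √K) ≤ ε / 2) :
    ENNReal.ofReal (1 - δ) ≤
      (alem A P D S (fun _ => K) η₁ η₂ (fun _ _ => 1 / (K : ℝ))).toOuterMeasure
        {out | out.zbar ∈ feasible A m ∧ meroGap A P out.zbar ≤ ε} := by
  have hm1 : (1 : ℝ) ≤ m := by exact_mod_cast hm
  have hδm : δ / (2 * m) ≤ 1 := by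
    rw [div_le_one (by positivity)]; linarith
  have hbad : (alem A P D S (fun _ => K) η₁ η₂ (fun _ _ => 1 / (K : ℝ))).toOuterMeasure
      {out | out.zbar ∈ feasible A m ∧ meroGap A P out.zbar ≤ ε}ᶜ ≤ ENNReal.ofReal δ := by
    have h1 := alemStageOne_good h hL hG hD hS hK hη₁ (by positivity) hδm he₁
    -- The budget δ is split as m · δ/(2m) + δ/2. The second-stage guarantee holds for every fixed
    -- shift, so it applies conditionally on any first-stage output.
    refine (toOuterMeasure_bind_le h1 (b := ENNReal.ofReal (δ / 2)) fun out hout => ?_).trans ?_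
    · rw [PMF.toOuterMeasure_map_apply]
      refine le_trans (MeasureTheory.measure_mono ?_)
        (aleg_gap (h.shift out.rhat) hL hG hD hm hS hK hη₂ (by positivity) (by linarith))
      refine compl_subset_compl.2 ?_
      rintro r ⟨hr1, hr2⟩
      refine ⟨hr1, ?_⟩
      have := meroGap_le hout hr1 fun z' hz' => (hr2 z' hz').trans he₂
      simpa using this
    · rw [← ENNReal.ofReal_natCast, ← ENNReal.ofReal_mul (by positivity),
        ← ENNReal.ofReal_add (by positivity) (by positivity)]
      refine ENNReal.ofReal_le_ofReal (le_of_eq ?_)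
      field_simp
      ring
  rw [ENNReal.ofReal_sub _ hδ.le, ENNReal.ofReal_one, tsub_le_iff_right]
  exact (one_le_toOuterMeasure_add_compl _ _).trans (by gcongr)

end TwoStages

/-! ### Operation counts. -/

section Cost

variable {E : Type*} [NormedAddCommGroup E] [NormedSpace ℝ E] {m : ℕ} {n : Fin m → ℕ}

theorem alegUpdate_ops (A : Geometry E) (P : Problem E m n) (D : ℝ) (zs : E × (Fin m → ℝ))
    (pbar gs : (E →L[ℝ] ℝ) × (Fin m → ℝ)) (η α : ℝ) (st : AlegState E m)
    (ξ : (i : Fin m) → Fin (n i)) :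
    (alegUpdate A P D zs pbar gs η α st ξ).ops = st.ops + (43 * m + 26) := by
  simp [alegUpdate, gradPsi, prox, Problem.stochGrad, Timed.sum, Timed.vec, Timed.step,
    Problem.evalGrad, Problem.evalLoss]
  ring

theorem fullGrad_ops (P : Problem E m n) (z : E × (Fin m → ℝ)) :
    (P.fullGrad z).ops = 5 * ∑ i, n i + 5 * m := by
  simp [Problem.fullGrad, Timed.sum, Timed.vec, Timed.step, Problem.evalRiskGrad,
    Problem.evalRisk, Problem.evalGrad, Problem.evalLoss, Finset.sum_add_distrib,
    ← Finset.sum_mul]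
  ring

theorem evalRisk_ops (P : Problem E m n) (i : Fin m) (w : E) :
    (P.evalRisk i w).ops = 3 * n i + 1 := by
  simp [Problem.evalRisk, Timed.sum, Timed.step, Problem.evalLoss]
  ring

theorem forEach_cost {ι σ : Type*} {body : ι → σ → PMF σ} {cost : σ → ℕ} {c : ι → ℕ}
    (hbody : ∀ i x, ∀ y ∈ (body i x).support, cost y = cost x + c i) (l : List ι) :
    ∀ x, ∀ y ∈ (forEach body l x).support, cost y = cost x + (l.map c).sum := by
  induction l with
  | nil =>
    intro x y hy
    simp only [forEach, PMF.support_pure, mem_singleton_iff] at hy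
    simp [hy]
  | cons i l ih =>
    intro x y hy
    simp only [forEach, PMF.mem_support_bind_iff] at hy
    obtain ⟨z, hz, hy⟩ := hy
    rw [ih z y hy, hbody i x z hz, List.map_cons, List.sum_cons, add_assoc]

variable [∀ i, NeZero (n i)]

/-- No cost depends on the samples drawn, so the invariant is an equality valid in every run. -/
theorem aleg_ops (A : Geometry E) (P : Problem E m n) (D : ℝ) (S K : ℕ) (η α : ℕ → ℕ → ℝ) :
    ∀ r ∈ (aleg A P D S (fun _ => K) η α).support,
      r.ops = 7 * m + 5 + S * (5 * ∑ i, n i + 7 * m + 3 + K * (43 * m + 26)) := by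
  intro r hr
  rw [aleg, PMF.mem_support_map_iff] at hr
  obtain ⟨st, hst, rfl⟩ := hr
  have h1 := forEach_range_invariant (k := S)
    (body := fun s => alegEpoch A P D K (η s) (α s))
    (Inv := fun s st => st.ops =
      6 * m + 3 + s * (5 * ∑ i, n i + 7 * m + 3 + K * (43 * m + 26)))
    (fun s _ x hx y hy => by
      have h2 := forEach_range_invariant (k := K)
        (body := fun k => alegStep A P D (x.wtSum⁻¹ • x.ptSum) (x.wtSum⁻¹ • x.mirrorSum)
          (P.fullGrad (x.wtSum⁻¹ • x.ptSum)).val (η s k) (α s k))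
        (Inv := fun k st => st.ops = x.ops + (2 * (m + 1) + 1)
          + (P.fullGrad (x.wtSum⁻¹ • x.ptSum)).ops + k * (43 * m + 26))
        (fun k _ u hu v hv => by
          rw [alegStep, PMF.mem_support_map_iff] at hv
          obtain ⟨ξ, -, rfl⟩ := hv
          rw [alegUpdate_ops, hu]
          ring)
        (x := { x with
          wtSum := 0, ptSum := 0, mirrorSum := 0
          ops := x.ops + (2 * (m + 1) + 1) + (P.fullGrad (x.wtSum⁻¹ • x.ptSum)).ops })
        (by simp) y hy
      rw [h2, fullGrad_ops, hx]
      ring)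
    (x := alegInit A m D) (by simp [alegInit, gradPsi]; ring) st hst
  simp only [h1]
  ring

theorem alem_ops (A : Geometry E) (P : Problem E m n) (D : ℝ) (S K : ℕ)
    (η₁ η₂ α : ℕ → ℕ → ℝ) :
    ∀ out ∈ (alem A P D S (fun _ => K) η₁ η₂ α).support,
      out.ops = 20 * m + 5 + 3 * ∑ i, n i
        + S * (10 * ∑ i, n i + 17 * m + 3 + K * (112 * m + 26)) := by
  intro out hout
  rw [alem, PMF.mem_support_bind_iff] at hout
  obtain ⟨out₁, h1, h2⟩ := hout
  rw [PMF.mem_support_map_iff] at h2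
  obtain ⟨r, hr, rfl⟩ := h2
  have h3 := aleg_ops A (P.shift out₁.rhat) D S K η₂ α r hr
  -- The summand is `aleg_ops` for m = 1 plus the evaluation of R_i at the returned point.
  have h4 := forEach_cost (cost := AlemOutput.ops (E := E) (m := m))
    (c := fun i => 12 + S * (5 * n i + 10 + K * 69) + (3 * n i + 1)) (fun i x y hy => by
      rw [PMF.mem_support_map_iff] at hy
      obtain ⟨r, hr, rfl⟩ := hy
      simp only [evalRisk_ops, aleg_ops A (P.single i) D S K η₁ α r hr]
      simp
      ring) (List.finRange m) _ out₁ h1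
  rw [← Fin.sum_univ_def] at h4
  simp only [h3, h4, Finset.sum_add_distrib, ← Finset.mul_sum]
  simp
  ring

end Cost

/-! ### Choice of the budget and size of the total cost. -/

section Complexity

theorem lipConst_one_le {L G D : ℝ} (hD : 0 ≤ D) (m : ℕ) : lipConst L G D 1 ≤ lipConst L G D m := by
  have hlog := Real.log_natCast_nonneg m
  refine mul_le_mul_of_nonneg_left (max_le ?_ ?_) (by positivity)
  · refine le_max_of_le_left (Real.sqrt_le_sqrt ?_)
    simp only [Nat.cast_one, Real.log_one]
    nlinarith [mul_nonneg (sq_nonneg G) hlog]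
  · refine le_max_of_le_left ?_
    simp

/-- From m ≥ 2 one has ln m ≥ 1/2, so the smoothness term 2D²L² is absorbed into 4D²L² ln m. -/
theorem lipConst_le {L G D : ℝ} (hG : 0 ≤ G) (hD : 0 ≤ D) {m : ℕ} (hm : 2 ≤ m) :
    lipConst L G D m ≤ 2 * D * √(4 * D ^ 2 * L ^ 2 + 2 * G ^ 2) * √(Real.log m) := by
  have hlog : 1 / 2 ≤ Real.log m := by
    have h1 : Real.log 2 ≤ Real.log m := Real.log_le_log two_pos (by exact_mod_cast hm)
    have h2 := Real.log_two_gt_d9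
    linarith
  rw [mul_assoc, ← Real.sqrt_mul (by positivity)]
  refine mul_le_mul_of_nonneg_left (max_le (Real.sqrt_le_sqrt ?_) ?_) (by positivity)
  · have h3 : 0 ≤ D ^ 2 * L ^ 2 := by positivity
    have h4 : 0 ≤ G ^ 2 := sq_nonneg G
    nlinarith
  · rw [← Real.sqrt_sq hG, ← Real.sqrt_mul (by positivity), Real.sqrt_sq hG]
    refine Real.sqrt_le_sqrt ?_
    have h3 : 0 ≤ D ^ 2 * L ^ 2 := by positivity
    nlinarith

/-- In the regime of many samples per group and small accuracy `ln m` is absorbed by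
`ln (1 + 1 / ε)`. -/
theorem log_le_of_regime {c N ε μ : ℝ} (hc : 0 < c) (hN : 0 < N) (hε : 0 < ε) (hμ : 1 < μ)
    (h1 : μ ≤ c * N) (h2 : ε ≤ c * √(Real.log μ / N)) :
    Real.log μ ≤ (4 + 2 * |Real.log (2 * c ^ 3)|) * (1 + Real.log (1 + 1 / ε)) := by
  have hμ0 : 0 < μ := by linarith
  have hlog : 0 < Real.log μ := Real.log_pos hμ
  have hε2 : ε ^ 2 * N ≤ c ^ 2 * Real.log μ := by
    have := pow_le_pow_left₀ hε.le h2 2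
    rw [mul_pow, Real.sq_sqrt (by positivity), mul_div_assoc', le_div_iff₀ hN] at this
    exact this
  have hs : Real.log μ ≤ 2 * √μ := by
    have := Real.log_le_sub_one_of_pos (Real.sqrt_pos.2 hμ0)
    rw [Real.log_sqrt hμ0.le] at this
    linarith
  -- The two regime conditions and ln μ ≤ 2√μ force μ to be polynomially bounded in 1/ε.
  have h3 : μ * ε ^ 2 ≤ 2 * c ^ 3 * √μ := by
    calc μ * ε ^ 2 ≤ c * N * ε ^ 2 := by gcongr
      _ = c * (ε ^ 2 * N) := by ring
      _ ≤ c * (c ^ 2 * (2 * √μ)) :=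
        mul_le_mul_of_nonneg_left (hε2.trans (by gcongr)) hc.le
      _ = 2 * c ^ 3 * √μ := by ring
  have hsq : √μ * √μ = μ := Real.mul_self_sqrt hμ0.le
  have hsp : 0 < √μ := Real.sqrt_pos.2 hμ0
  have h4 : √μ ≤ 2 * c ^ 3 * (1 / ε) ^ 2 := by
    rw [one_div, inv_pow, ← div_eq_mul_inv, le_div_iff₀ (by positivity)]
    refine le_of_mul_le_mul_left ?_ hsp
    calc √μ * (√μ * ε ^ 2) = μ * ε ^ 2 := by rw [← mul_assoc, hsq]
      _ ≤ 2 * c ^ 3 * √μ := h3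
      _ = √μ * (2 * c ^ 3) := by ring
  have h5 := Real.log_le_log hsp h4
  rw [Real.log_sqrt hμ0.le, Real.log_mul (by positivity) (by positivity), Real.log_pow] at h5
  have h6 : Real.log (1 / ε) ≤ Real.log (1 + 1 / ε) :=
    Real.log_le_log (by positivity) (by linarith)
  have h7 : 0 ≤ Real.log (1 + 1 / ε) :=
    Real.log_nonneg (by have : 0 < 1 / ε := by positivity
                        linarith)
  have h8 := le_abs_self (Real.log (2 * c ^ 3))
  have h9 := mul_nonneg (abs_nonneg (Real.log (2 * c ^ 3))) h7
  push_cast at h5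
  linarith

/-- The budget of ALEM. -/
def budget (L G D ε δ : ℝ) (m : ℕ) : ℝ :=
  320 * lipConst L G D m * (1 + Real.log (2 * m / δ)) / ε

theorem budget_pos {L G D ε δ : ℝ} {m : ℕ} (hL : 0 < L) (hD : 0 < D) (hm : 1 ≤ m) (hε : 0 < ε)
    (hδ : 0 < δ) (hδ1 : δ < 1) : 0 < budget L G D ε δ m := by
  have hΛ := lipConst_pos (G := G) hL hD m
  have hm1 : (1 : ℝ) ≤ m := by exact_mod_cast hm
  have : 0 ≤ Real.log (2 * m / δ) := Real.log_nonneg (by rw [le_div_iff₀ hδ]; linarith)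
  unfold budget
  positivity

/-- The 320 comes from 10Λ(4 + 16ℓ) ≤ 160Λ(1 + ℓ) = (ε/2) · 320Λ(1 + ℓ)/ε. One budget serves both
stages, since Λ₁ ≤ Λ_m and neither failure probability is below δ/(2m). -/
theorem gap_bound_le_half {L G D ε δ δ' X Λ : ℝ} {m : ℕ} (hL : 0 < L) (hD : 0 < D) (hm : 1 ≤ m)
    (hε : 0 < ε) (hδ : 0 < δ) (hδ1 : δ < 1) (hδ' : δ / (2 * m) ≤ δ') (hδ'1 : δ' ≤ 1)
    (hΛ0 : 0 ≤ Λ) (hΛ : Λ ≤ lipConst L G D m) (hX : budget L G D ε δ m ≤ X) :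
    10 * Λ * (4 + 16 * Real.log (1 / δ')) / X ≤ ε / 2 := by
  have hT := budget_pos (G := G) hL hD hm hε hδ hδ1
  have hX0 : 0 < X := hT.trans_le hX
  have hm1 : (1 : ℝ) ≤ m := by exact_mod_cast hm
  have hδ'0 : 0 < δ' := lt_of_lt_of_le (by positivity) hδ'
  have h1 : Real.log (1 / δ') ≤ Real.log (2 * m / δ) := by
    refine Real.log_le_log (by positivity) ?_
    rw [div_le_div_iff₀ hδ'0 hδ]
    rw [div_le_iff₀ (by positivity)] at hδ'
    linarith
  have h0 : 0 ≤ Real.log (1 / δ') := Real.log_nonneg (by rwa [le_div_iff₀ hδ'0, one_mul])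
  rw [div_le_iff₀ hX0]
  have h2 : ε / 2 * budget L G D ε δ m =
      160 * (lipConst L G D m * (1 + Real.log (2 * m / δ))) := by
    rw [budget]
    field_simp
    ring
  have h3 := mul_le_mul_of_nonneg_left hX (by positivity : 0 ≤ ε / 2)
  have h4 : Λ * (1 + Real.log (1 / δ')) ≤ lipConst L G D m * (1 + Real.log (2 * m / δ)) :=
    mul_le_mul hΛ (by linarith) (by linarith) (hΛ0.trans hΛ)
  nlinarith

theorem budget_le {L G D ε δ : ℝ} {m : ℕ} (hG : 0 ≤ G) (hD : 0 < D) (hm : 2 ≤ m) (hε : 0 < ε)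
    (hδ : 0 < δ) (hδ1 : δ < 1) :
    budget L G D ε δ m ≤ 1280 * D * √(4 * D ^ 2 * L ^ 2 + 2 * G ^ 2) *
      (√(Real.log m) / ε * (1 + Real.log (1 / δ) + Real.log m)) := by
  have hm0 : (0 : ℝ) < m := by exact_mod_cast (by omega : 0 < m)
  have hlm := Real.log_natCast_nonneg m
  have hld : 0 ≤ Real.log (1 / δ) := Real.log_nonneg (by rw [le_div_iff₀ hδ]; linarith)
  have h1 : Real.log (2 * m / δ) ≤ 1 + Real.log (1 / δ) + Real.log m := by
    have h2 : 2 * (m : ℝ) / δ = 2 * (m * (1 / δ)) := by ring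
    have h3 := Real.log_two_lt_d9
    rw [h2, Real.log_mul (by norm_num) (by positivity), Real.log_mul (by positivity)
      (by positivity)]
    linarith
  have h4 := lipConst_le (L := L) hG hD.le hm
  have h5 : lipConst L G D m * (1 + Real.log (2 * m / δ)) ≤
      2 * D * √(4 * D ^ 2 * L ^ 2 + 2 * G ^ 2) * √(Real.log m) *
        (2 * (1 + Real.log (1 / δ) + Real.log m)) := by
    refine mul_le_mul h4 (by linarith) ?_ (by positivity)
    have : 0 ≤ Real.log (2 * m / δ) := Real.log_nonneg (by
      have : (2 : ℝ) ≤ m := by exact_mod_cast hm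
      rw [le_div_iff₀ hδ]; linarith)
    linarith
  have h6 := mul_le_mul_of_nonneg_left h5 (by positivity : 0 ≤ 320 / ε)
  calc budget L G D ε δ m = 320 / ε * (lipConst L G D m * (1 + Real.log (2 * m / δ))) := by
        rw [budget]; ring
    _ ≤ _ := h6
    _ = _ := by ring

variable {m : ℕ} {n : Fin m → ℕ} [∀ i, NeZero (n i)]

theorem one_le_avgSize (hm : 1 ≤ m) : 1 ≤ avgSize n := by
  have hm0 : (0 : ℝ) < m := by exact_mod_cast hm
  rw [avgSize, le_div_iff₀ hm0, one_mul]
  have : ∑ _i : Fin m, (1 : ℝ) ≤ ∑ i, (n i : ℝ) := Finset.sum_le_sum fun i _ => by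
    exact_mod_cast Nat.one_le_iff_ne_zero.2 (NeZero.ne (n i))
  simpa using this

/-- With K ≤ 2n̄ an epoch costs at most 306 m n̄, as much as a full gradient up to a constant. The
factor T/√n̄ gives m√n̄ T, and rounding S up gives the separate term m n̄. -/
theorem ops_le_of_budget (hm : 1 ≤ m) {T : ℝ} (hT : 0 ≤ T) {S K ops : ℕ}
    (hS : S = ⌈T / √(avgSize n)⌉₊) (hK : K = ⌈avgSize n⌉₊)
    (hops : ops = 20 * m + 5 + 3 * ∑ i, n i
        + S * (10 * ∑ i, n i + 17 * m + 3 + K * (112 * m + 26))) :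
    (ops : ℝ) ≤ 400 * (m * avgSize n + m * √(avgSize n) * T) := by
  have hm1 : (1 : ℝ) ≤ m := by exact_mod_cast hm
  set N := avgSize n with hN
  have hN1 : 1 ≤ N := one_le_avgSize hm
  have hN0 : 0 < N := by linarith
  have hsum : (∑ i, (n i : ℝ)) = m * N := by
    rw [hN, avgSize, mul_div_cancel₀]; positivity
  have hS' : (S : ℝ) ≤ T / √N + 1 := by
    rw [hS]; exact (Nat.ceil_lt_add_one (by positivity)).le
  have hK' : (K : ℝ) ≤ 2 * N := by
    have := (Nat.ceil_lt_add_one hN0.le).le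
    rw [hK]; linarith
  have hmN : (m : ℝ) ≤ m * N := le_mul_of_one_le_right (by positivity) hN1
  have h1mN : (1 : ℝ) ≤ m * N := hm1.trans hmN
  have hepoch : 10 * (m * N) + 17 * m + 3 + (K : ℝ) * (112 * m + 26) ≤ 306 * (m * N) := by
    have : (K : ℝ) * (112 * m + 26) ≤ 2 * N * (138 * m) := by
      refine mul_le_mul hK' (by linarith) (by positivity) (by positivity)
    linarith
  have hmul : (S : ℝ) * (10 * (m * N) + 17 * m + 3 + (K : ℝ) * (112 * m + 26)) ≤
      (T / √N + 1) * (306 * (m * N)) :=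
    mul_le_mul hS' hepoch (by positivity) (by positivity)
  have hNs : T / √N * (m * N) = m * √N * T := by
    have h0 : √N ≠ 0 := by positivity
    rw [div_mul_eq_mul_div, div_eq_iff h0]
    nth_rewrite 1 [← Real.mul_self_sqrt hN0.le]
    ring
  have h0 : 0 ≤ m * √N * T := by positivity
  rw [hops]
  push_cast
  rw [hsum]
  linarith

end Complexity

end Mero

end

/-! ### The complexity theorem. -/

theorem mainTheorem6 (L G D c : ℝ) (hL : 0 < L) (hG : 0 ≤ G) (hD : 0 < D) (hc : 0 < c) :
    ∃ C : ℝ, 0 < C ∧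
      ∀ (m : ℕ) (n : Fin m → ℕ) [∀ i, NeZero (n i)] (ε δ : ℝ),
        2 ≤ m → 0 < ε → 0 < δ → δ < 1 →
        ∃ T : ℝ, 0 < T ∧
          ∀ (E : Type*) [NormedAddCommGroup E] [NormedSpace ℝ E] [FiniteDimensional ℝ E]
            (A : Mero.Geometry E) (P : Mero.Problem E m n) (S K : ℕ) (η₁ η₂ : ℕ → ℕ → ℝ),
            Mero.Assumptions A P L G D →
            S = ⌈T / √(Mero.avgSize n)⌉₊ →
            K = ⌈Mero.avgSize n⌉₊ →
            Mero.AdmissibleRates (Mero.lipConst L G D 1) S K η₁ →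
            Mero.AdmissibleRates (Mero.lipConst L G D m) S K η₂ →
            -- with probability at least `1 - δ` the output is feasible and `ε`-accurate
            ENNReal.ofReal (1 - δ) ≤
              (Mero.alem A P D S (fun _ => K) η₁ η₂ (fun _ _ => 1 / (K : ℝ))).toOuterMeasure
                {out | out.zbar ∈ Mero.feasible A m ∧ Mero.meroGap A P out.zbar ≤ ε} ∧
            -- the total computation of both stages, in every run
            ∀ out ∈ (Mero.alem A P D S (fun _ => K) η₁ η₂ (fun _ _ => 1 / (K : ℝ))).support,
              (out.ops : ℝ) ≤
                C * (m * Mero.avgSize n + m * √(Mero.avgSize n * Real.log m) / ε *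
                  (1 + Real.log (1 + 1 / ε) + Real.log (1 / δ) + Real.log m)) ∧
              ((m : ℝ) ≤ c * Mero.avgSize n → ε ≤ c * √(Real.log m / Mero.avgSize n) →
                (out.ops : ℝ) ≤
                  C * (m * √(Mero.avgSize n * Real.log m) / ε *
                    (1 + Real.log (1 + 1 / ε) + Real.log (1 / δ)))) := by
  set B : ℝ := 1280 * D * √(4 * D ^ 2 * L ^ 2 + 2 * G ^ 2) with hB
  set Q : ℝ := 4 + 2 * |Real.log (2 * c ^ 3)| with hQ
  have hB0 : 0 ≤ B := by positivity
  have hQ0 : 0 ≤ Q := by positivity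
  -- B scales the budget, Q pays for absorbing ln m into ln(1 + 1/ε), and 1 and c pay for the term m
  -- n̄ in the first and in the second bound.
  refine ⟨400 * (1 + c + B * (1 + Q)), by positivity, fun m n _ ε δ hm hε hδ hδ1 => ?_⟩
  have hm1 : 1 ≤ m := by omega
  have hmR : (1 : ℝ) ≤ m := by exact_mod_cast hm1
  have hT := Mero.budget_pos (G := G) hL hD hm1 hε hδ hδ1
  refine ⟨Mero.budget L G D ε δ m, hT, fun E _ _ _ A P S K η₁ η₂ h hS hK hη₁ hη₂ => ?_⟩
  have hN1 : 1 ≤ Mero.avgSize n := Mero.one_le_avgSize hm1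
  set N := Mero.avgSize n with hN
  have hN0 : 0 < N := by linarith
  have hNs : 0 < √N := Real.sqrt_pos.2 hN0
  have hS1 : 1 ≤ S := by rw [hS, Nat.one_le_ceil_iff]; positivity
  have hK1 : 1 ≤ K := by rw [hK, Nat.one_le_ceil_iff]; positivity
  -- Both roundings go upwards, so S√K is at least (T/√n̄) √n̄ = T.
  have hSK : Mero.budget L G D ε δ m ≤ S * √(K : ℝ) := by
    have h1 : Mero.budget L G D ε δ m / √N ≤ S := by rw [hS]; exact Nat.le_ceil _
    have h2 : √N ≤ √(K : ℝ) := Real.sqrt_le_sqrt (by rw [hK]; exact Nat.le_ceil _)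
    rw [div_le_iff₀ hNs] at h1
    exact h1.trans (by gcongr)
  have hδm : δ / (2 * m) ≤ δ / 2 := by
    gcongr
    linarith
  refine ⟨Mero.alem_good h hL hG hD hm1 hS1 hK1 hη₁ hη₂ hδ hδ1.le
    (Mero.gap_bound_le_half hL hD hm1 hε hδ hδ1 le_rfl (by linarith)
      (Mero.lipConst_nonneg hD.le 1) (Mero.lipConst_one_le hD.le m) hSK)
    (Mero.gap_bound_le_half hL hD hm1 hε hδ hδ1 hδm (by linarith)
      (Mero.lipConst_nonneg hD.le m) le_rfl hSK), fun out hout => ?_⟩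
  have hops := Mero.ops_le_of_budget hm1 hT.le hS hK (Mero.alem_ops A P D S K η₁ η₂ _ out hout)
  rw [← hN] at hops
  have hbud := Mero.budget_le (L := L) hG hD hm hε hδ hδ1
  rw [← hB] at hbud
  have hlm : 0 ≤ Real.log (m : ℝ) := Real.log_natCast_nonneg m
  have hld : 0 ≤ Real.log (1 / δ) := Real.log_nonneg (by rw [le_div_iff₀ hδ]; linarith)
  have hε1 : 0 < 1 / ε := by positivity
  have hle : 0 ≤ Real.log (1 + 1 / ε) := Real.log_nonneg (by linarith)
  set W : ℝ := m * √(N * Real.log m) / ε with hW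
  have hW0 : 0 ≤ W := by positivity
  have hmain : m * √N * Mero.budget L G D ε δ m ≤
      B * (W * (1 + Real.log (1 / δ) + Real.log m)) := by
    refine (mul_le_mul_of_nonneg_left hbud (by positivity)).trans (le_of_eq ?_)
    rw [hW, Real.sqrt_mul hN0.le]
    ring
  have hmN : 0 ≤ m * N := by positivity
  refine ⟨?_, fun h1 h2 => ?_⟩
  · have h3 : W * (1 + Real.log (1 / δ) + Real.log m) ≤
        W * (1 + Real.log (1 + 1 / ε) + Real.log (1 / δ) + Real.log m) :=
      mul_le_mul_of_nonneg_left (by linarith) hW0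
    set V := W * (1 + Real.log (1 + 1 / ε) + Real.log (1 / δ) + Real.log m) with hV
    have hV0 : 0 ≤ V := by positivity
    have h4 := mul_le_mul_of_nonneg_left h3 hB0
    have h5 : 0 ≤ c * (m * N + V) := by positivity
    have h6 : 0 ≤ B * Q * (m * N + V) := by positivity
    have h7 : 0 ≤ B * (m * N) := by positivity
    linarith
  · have hlog := Mero.log_le_of_regime hc hN0 hε (by exact_mod_cast hm : (1 : ℝ) < m) h1 h2
    rw [← hQ] at hlog
    set V := W * (1 + Real.log (1 + 1 / ε) + Real.log (1 / δ)) with hV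
    have hV0 : 0 ≤ V := by positivity
    have h3 : W * (1 + Real.log (1 / δ) + Real.log m) ≤ (1 + Q) * V := by
      have h4 : 1 + Real.log (1 / δ) + Real.log m ≤
          (1 + Q) * (1 + Real.log (1 + 1 / ε) + Real.log (1 / δ)) := by
        nlinarith [mul_nonneg hQ0 hld]
      calc _ ≤ W * ((1 + Q) * (1 + Real.log (1 + 1 / ε) + Real.log (1 / δ))) :=
            mul_le_mul_of_nonneg_left h4 hW0
        _ = _ := by rw [hV]; ring
    -- Small ε makes the cost of one full pass negligible: √n̄ ε ≤ c √(ln m), multiplied by m√n̄/ε.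
    have h4 : m * N ≤ c * V := by
      have h5 : √N * ε ≤ c * √(Real.log m) := by
        rw [Real.sqrt_div hlm, mul_div_assoc', le_div_iff₀ hNs] at h2
        linarith
      have h6 : m * N ≤ c * W := by
        rw [hW, Real.sqrt_mul hN0.le, mul_div_assoc', le_div_iff₀ hε]
        calc m * N * ε = m * √N * (√N * ε) := by
              nth_rewrite 1 [← Real.mul_self_sqrt hN0.le]
              ring
          _ ≤ m * √N * (c * √(Real.log m)) := by gcongr
          _ = _ := by ring
      have h7 : W ≤ V := le_mul_of_one_le_right hW0 (by linarith)
      exact h6.trans (mul_le_mul_of_nonneg_left h7 hc.le)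
    have h5 := mul_le_mul_of_nonneg_left h3 hB0
    linarith
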